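/- Let $d\ge 1$ and $k\ge 2$ be integers. \textbf{Networks.} Let $\sigma_2(x)=\max\{0,x\}^2$, applied componentwise. For $L\ge 2$ let $\Phi^{d_1,d_2}(L,W,S,B)$ be the set of maps $\mathbb{R}^{d_1}\to\mathbb{R}^{d_2}$ of the form $$\big(W^{(L)}\sigma_2(\cdot)+b^{(L)}\big)\circ\cdots\circ\big(W^{(2)}\sigma_2(\cdot)+b^{(2)}\big)\circ\big(W^{(1)}\,\cdot\,+b^{(1)}\big)$$ with $W^{(1)}\in\mathbb{R}^{W\times d_1}$, $W^{(l)}\in\mathbb{R}^{W\times W}$ for $1<l<L$, $W^{(L)}\in\mathbb{R}^{d_2\times W}$, $b^{(l)}\in\mathbb{R}^W$ for $l<L$, $b^{(L)}\in\mathbb{R}^{d_2}$, having in total at most $S$ nonzero entries, all of absolute value at most $B$. \textbf{Objective.} For a velocity field $g:\mathbb{R}^d\times\mathbb{R}\to\mathbb{R}^d$, let $X_g(x,\cdot)$ be the solution on $[0,1]$ of $\frac{d}{dt}X_g(x,t)=g(X_g(x,t),t)$, $X_g(x,0)=x$, and set $$R_x(g)=\int_0^1\big|\nabla_x g(X_g(x,t),t)\,g(X_g(x,t),t)+\partial_t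 g(X_g(x,t),t)\big|^2\,dt,\qquad R(g)=\int_{[0,1]^d}R_x(g)\,dx,$$ $$J_{\rm W}(g)=W_2\big(\rho,X_g(\cdot,1)_\sharp\pi\big)^2+R(g),$$ where $W_2$ is the Wasserstein distance of order $2$ on $\mathbb{R}^d$ with the Euclidean norm and $\sharp$ denotes push-forward. \textbf{Theorem.} There is a constant $C_{d,k}$ depending only on $d,k$, and for all $L_1>1$, $L_2>0$ there are constants $C'_{d,k,L_1,L_2}$ and $C_{d,k,L_1,L_2}$ depending only on $d,k,L_1,L_2$, such that the following holds. Let $\rho,\pi$ be probability measures on $[0,1]^d$ with Lebesgue densities $p_\rho,p_\pi\in C^k([0,1]^d)$ such that for $p\in\{p_\rho,p_\pi\}$ $$\|p\|_{C^k([0,1]^d)}=\sup_{n\le k}\,\sup_{x\in[0,1]^d}\|D^np(x)\|\le L_1,\qquad \inf_{x\in[0,1]^d}p(x)\ge L_2$$ (operator norms of the Fréchet derivatives with respect to the Euclidean norm). Then for every $\varepsilon\in(0,1]$ there are $L,W,S,B$ with $$L\le C_{d,k},\quad W\le C'_{d,k,L_1,L_2}\,\varepsilon^{-\frac{d+1}{k-1}},\quad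 S\le C'_{d,k,L_1,L_2}\,\varepsilon^{-\frac{d+1}{k-1}},\quad B\le C'_{d,k,L_1,L_2}\,\varepsilon^{-\frac1{k-1}}$$ and a ReLU$^2$ network $g\in\Phi^{d+1,d}(L,W,S,B)$ such that for every $x\in[0,1]^d$ the solution $X_g(x,\cdot)$ exists on $[0,1]$ and is unique, and $$J_{\rm W}(g)\le C_{d,k,L_1,L_2}\,\varepsilon^2,$$ and also, pointwise, $W_2\big(\rho,X_g(\cdot,1)_\sharp\pi\big)^2+R_x(g)\le C_{d,k,L_1,L_2}\,\varepsilon^2$ for every $x\in[0,1]^d$. -/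

import Mathlib

open MeasureTheory Set
open scoped ENNReal Matrix

noncomputable section

/-- The closed unit cube `[0,1]^d` in Euclidean space. -/
def unitCube (d : ℕ) : Set (EuclideanSpace ℝ (Fin d)) :=
  {x | ∀ i, x i ∈ Icc (0 : ℝ) 1}

/-- The `C^k(S)` norm: supremum over `n ≤ k` and `x ∈ S` of the operator norm of the `n`-th
Fréchet derivative (taken within `S`, so that `S` may be a closed cube). -/
def ckNorm {E F : Type*} [NormedAddCommGroup E] [NormedSpace ℝ E]
    [NormedAddCommGroup F] [NormedSpace ℝ F] (k : ℕ) (f : E → F) (S : Set E) : ℝ≥0∞ :=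
  ⨆ n : ℕ, ⨆ _ : n ≤ k, ⨆ x : E, ⨆ _ : x ∈ S, ‖iteratedFDerivWithin ℝ n f S x‖ₑ

/-- `μ` is a measure on `[0,1]^d` with a Lebesgue density `p ∈ C^k([0,1]^d)` such that
`‖p‖_{C^k([0,1]^d)} ≤ L₁` and `p ≥ L₂` on `[0,1]^d`. -/
def HasRegularDensity (d k : ℕ) (L₁ L₂ : ℝ) (μ : Measure (EuclideanSpace ℝ (Fin d))) : Prop :=
  ∃ p : EuclideanSpace ℝ (Fin d) → ℝ,
    ContDiffOn ℝ k p (unitCube d) ∧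
    ckNorm k p (unitCube d) ≤ ENNReal.ofReal L₁ ∧
    (∀ x ∈ unitCube d, L₂ ≤ p x) ∧
    μ = (volume.restrict (unitCube d)).withDensity (fun x => ENNReal.ofReal (p x))

/-- Wasserstein distance of order `p` (with values in `[0, ∞]`). -/
def wassersteinDist {X : Type*} [PseudoEMetricSpace X] [MeasurableSpace X] (p : ℝ)
    (μ ν : Measure X) : ℝ≥0∞ :=
  (⨅ γ : Measure (X × X), ⨅ _ : γ.map Prod.fst = μ ∧ γ.map Prod.snd = ν,
    ∫⁻ z, edist z.1 z.2 ^ p ∂γ) ^ (1 / p)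

/-- `γ` solves `γ' = f(γ, t)` on `[0,1]` with `γ(0) = x`. -/
def IsTrajectory {d : ℕ} (f : EuclideanSpace ℝ (Fin d) → ℝ → EuclideanSpace ℝ (Fin d))
    (x : EuclideanSpace ℝ (Fin d)) (γ : ℝ → EuclideanSpace ℝ (Fin d)) : Prop :=
  γ 0 = x ∧ ∀ t ∈ Icc (0 : ℝ) 1, HasDerivWithinAt γ (f (γ t) t) (Icc 0 1) t

/-- Existence and uniqueness on `[0,1]` of the trajectory of `f` started at `x`. -/
def HasUniqueTrajectory {d : ℕ}
    (f : EuclideanSpace ℝ (Fin d) → ℝ → EuclideanSpace ℝ (Fin d))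
    (x : EuclideanSpace ℝ (Fin d)) : Prop :=
  ∃ γ, IsTrajectory f x γ ∧ ∀ γ', IsTrajectory f x γ' → EqOn γ' γ (Icc 0 1)

open Classical in
/-- The flow map `X_f(x, t)`, `t ∈ [0,1]`; meaningful at those `x` with
`HasUniqueTrajectory f x`. -/
def flowMap {d : ℕ} (f : EuclideanSpace ℝ (Fin d) → ℝ → EuclideanSpace ℝ (Fin d))
    (x : EuclideanSpace ℝ (Fin d)) (t : ℝ) : EuclideanSpace ℝ (Fin d) :=
  if h : ∃ γ, IsTrajectory f x γ then h.choose t else x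

/-- The Lagrangian acceleration `(∇_x f(x,t)) f(x,t) + ∂_t f(x,t)`. -/
def acceleration {d : ℕ} (f : EuclideanSpace ℝ (Fin d) → ℝ → EuclideanSpace ℝ (Fin d))
    (x : EuclideanSpace ℝ (Fin d)) (t : ℝ) : EuclideanSpace ℝ (Fin d) :=
  fderiv ℝ (fun y => f y t) x (f x t) + deriv (fun s => f x s) t

/-- The squared acceleration integrated along the trajectory started at `x`. -/
def pathRegularizer {d : ℕ} (f : EuclideanSpace ℝ (Fin d) → ℝ → EuclideanSpace ℝ (Fin d))
    (x : EuclideanSpace ℝ (Fin d)) : ℝ≥0∞ :=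
  ∫⁻ t in Icc (0 : ℝ) 1, ‖acceleration f (flowMap f x t) t‖ₑ ^ 2

/-- The regularizer `R(f)`: the path regularizer integrated over `[0,1]^d`. -/
def regularizer {d : ℕ} (f : EuclideanSpace ℝ (Fin d) → ℝ → EuclideanSpace ℝ (Fin d)) : ℝ≥0∞ :=
  ∫⁻ x in unitCube d, pathRegularizer f x

/-- `W₂(ρ, X_f(·,1)_♯ π)²`. -/
def wassersteinLoss {d : ℕ} (ρ π : Measure (EuclideanSpace ℝ (Fin d)))
    (f : EuclideanSpace ℝ (Fin d) → ℝ → EuclideanSpace ℝ (Fin d)) : ℝ≥0∞ :=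
  wassersteinDist 2 ρ (π.map (fun x => flowMap f x 1)) ^ 2

/-- The objective `J_W(f) = W₂(ρ, X_f(·,1)_♯ π)² + R(f)`. -/
def objectiveW {d : ℕ} (ρ π : Measure (EuclideanSpace ℝ (Fin d)))
    (f : EuclideanSpace ℝ (Fin d) → ℝ → EuclideanSpace ℝ (Fin d)) : ℝ≥0∞ :=
  wassersteinLoss ρ π f + regularizer f

/-- The activation `σ₂(x) = max{0,x}²`, applied componentwise. -/
def reluSq {ι : Type*} (v : ι → ℝ) : ι → ℝ := fun i => (max 0 (v i)) ^ 2

/-- An affine layer `z ↦ A z + b` with `n` inputs and `m` outputs. -/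
structure AffineLayer (n m : ℕ) where
  weight : Matrix (Fin m) (Fin n) ℝ
  bias : Fin m → ℝ

namespace AffineLayer

variable {n m : ℕ}

def apply (A : AffineLayer n m) (z : Fin n → ℝ) : Fin m → ℝ := A.weight *ᵥ z + A.bias

open Classical in
/-- The number of nonzero entries of weight matrix and bias. -/
def numNonzero (A : AffineLayer n m) : ℕ :=
  (Finset.univ.filter fun ij : Fin m × Fin n => A.weight ij.1 ij.2 ≠ 0).card +
    (Finset.univ.filter fun i : Fin m => A.bias i ≠ 0).card

/-- All entries of weight matrix and bias are at most `B` in absolute value. -/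
def BoundedBy (A : AffineLayer n m) (B : ℝ) : Prop :=
  (∀ i j, |A.weight i j| ≤ B) ∧ ∀ i, |A.bias i| ≤ B

end AffineLayer

/-- The parameters of a feedforward network of width `W` from `ℝ^{d₁}` to `ℝ^{d₂}`: an input
layer, a list of hidden layers (in the order of application) and an output layer. -/
structure ReLUSqNetwork (d₁ d₂ W : ℕ) where
  input : AffineLayer d₁ W
  hidden : List (AffineLayer W W)
  output : AffineLayer W d₂

namespace ReLUSqNetwork

variable {d₁ d₂ W : ℕ}

/-- The number of affine layers. -/
def depth (N : ReLUSqNetwork d₁ d₂ W) : ℕ := N.hidden.length + 2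

/-- The function computed by the network. -/
def eval (N : ReLUSqNetwork d₁ d₂ W) (x : Fin d₁ → ℝ) : Fin d₂ → ℝ :=
  N.output.apply (reluSq (N.hidden.foldl (fun z A => A.apply (reluSq z)) (N.input.apply x)))

/-- The total number of nonzero parameters. -/
def numNonzero (N : ReLUSqNetwork d₁ d₂ W) : ℕ :=
  N.input.numNonzero + (N.hidden.map AffineLayer.numNonzero).sum + N.output.numNonzero

/-- All parameters are at most `B` in absolute value. -/
def BoundedBy (N : ReLUSqNetwork d₁ d₂ W) (B : ℝ) : Prop :=
  N.input.BoundedBy B ∧ (∀ A ∈ N.hidden, A.BoundedBy B) ∧ N.output.BoundedBy B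

end ReLUSqNetwork

/-- The class `Φ^{d₁,d₂}(L, W, S, B)` of (functions computed by) ReLU² networks of depth `L`,
width `W`, sparsity `S` and weight bound `B`. -/
def reluSqClass (d₁ d₂ L W S : ℕ) (B : ℝ) : Set ((Fin d₁ → ℝ) → (Fin d₂ → ℝ)) :=
  {φ | ∃ N : ReLUSqNetwork d₁ d₂ W,
    N.depth = L ∧ N.numNonzero ≤ S ∧ N.BoundedBy B ∧ N.eval = φ}

/-- The velocity field `(x, t) ↦ φ(x₁, …, x_d, t)`. -/
def toVelocity {d : ℕ} (φ : (Fin (d + 1) → ℝ) → (Fin d → ℝ)) :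
    EuclideanSpace ℝ (Fin d) → ℝ → EuclideanSpace ℝ (Fin d) :=
  fun x t => WithLp.toLp 2 (φ (Fin.snoc (α := fun _ => ℝ) (WithLp.ofLp x) t))

end

/-! The target velocity field comes from Knothe-Rosenblatt rearrangements, not from optimal
transport. For a density `q` on the cube, bounded below and `C^k`, the map built from the
conditional distribution functions sends `q` to the uniform measure. It is triangular, increasing in
each diagonal variable, `C^k` up to the boundary, and fixes every face. Its inverse `G` has the same
properties (`TriFamily.inverse`).

Let `G₀`, `G₁` be these inverses for the densities of `π` and `ρ`, and move the label `u` along the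
straight line `(1 - t) G₀ u + t G₁ u`. Convex combinations keep triangularity, monotonicity and
faces, so `(u, t) ↦ ((1 - t) G₀ u + t G₁ u, t)` is again a triangular `C^k` bijection of the
space-time cube (`triFamily_interpMap`). Reading the constant velocities `G₁ u - G₀ u` through its
inverse gives a field `f` that is `C^k` on the closed cube, tangential to the faces, carries `π`
exactly to `ρ`, and has zero acceleration: `Df (f, 1) = 0` (`exists_transport_velocity`). Both terms
of the objective vanish for `f`. The `C^k` bounds must depend on `d`, `k`, `L₁`, `L₂` only; this is
why all the calculus is done for families with common bounds (`UnifCk`).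

The field is then replaced by a network. Taylor polynomials at grid points of mesh `1/N`, glued by a
partition of unity of `C¹` quadratic splines, are sums of products of spline and affine factors.
ReLU² networks compute these exactly, because `xy` is a combination of four values of the activation
(`exists_product_network`). Values and first derivatives are approximated to order `N^{-(k-1)}`
(`quasiInterpolant_error`), and `N ~ ε^{-1/(k-1)}` makes this `O(ε)`.

The approximation is controlled on the cube only, so trajectories must not leave it. Hence not `f`
but `f + 4ε(1/2 - x)` is approximated: its normal component on the faces is `2ε` inwards and beats
the network error `ε`. The network field is then strictly inward, which gives existence, uniqueness
and confinement of trajectories (`InwardField`). Grönwall's inequality puts its flow within `O(ε)`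
of the flow of `f`; coupling the two flows bounds `W₂`. The acceleration `Dφ (φ, 1)` is `O(ε)` at
every point of the space-time cube, which gives the pointwise and the integrated bound together. -/

noncomputable section

open scoped Topology
open Filter Metric

/-! ### Calculus of `C^n` bounds that are uniform over a family of functions. -/

section UniformFamilies

variable {I J E F G H : Type*} [NormedAddCommGroup E] [NormedSpace ℝ E]
  [NormedAddCommGroup F] [NormedSpace ℝ F] [NormedAddCommGroup G] [NormedSpace ℝ G]
  [NormedAddCommGroup H] [NormedSpace ℝ H]

/-- A family of functions that is `C^n` on `s` with bounds, uniform over the family, on all the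
derivatives up to order `n`. -/
def UnifCk (n : ℕ) (f : I → E → F) (s : Set E) : Prop :=
  ∃ C : ℝ, ∀ i, ContDiffOn ℝ n (f i) s ∧
    ∀ m ≤ n, ∀ x ∈ s, ‖iteratedFDerivWithin ℝ m (f i) s x‖ ≤ C

namespace UnifCk

variable {n : ℕ} {f f' : I → E → F} {s : Set E}

theorem contDiffOn (h : UnifCk n f s) (i : I) : ContDiffOn ℝ n (f i) s :=
  let ⟨_, hC⟩ := h; (hC i).1

theorem continuousOn (h : UnifCk n f s) (i : I) : ContinuousOn (f i) s :=
  (h.contDiffOn i).continuousOn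

theorem exists_nonneg (h : UnifCk n f s) : ∃ C : ℝ, 0 ≤ C ∧ ∀ i, ContDiffOn ℝ n (f i) s ∧
    ∀ m ≤ n, ∀ x ∈ s, ‖iteratedFDerivWithin ℝ m (f i) s x‖ ≤ C := by
  obtain ⟨C, hC⟩ := h
  exact ⟨max C 0, le_max_right _ _, fun i => ⟨(hC i).1,
    fun m hm x hx => ((hC i).2 m hm x hx).trans (le_max_left _ _)⟩⟩

theorem exists_bound (h : UnifCk n f s) : ∃ C : ℝ, 0 ≤ C ∧ ∀ i, ∀ x ∈ s, ‖f i x‖ ≤ C := by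
  obtain ⟨C, h0, hC⟩ := h.exists_nonneg
  exact ⟨C, h0, fun i x hx => by simpa using (hC i).2 0 (Nat.zero_le _) x hx⟩

theorem of_le {m : ℕ} (h : UnifCk n f s) (hmn : m ≤ n) : UnifCk m f s := by
  obtain ⟨C, hC⟩ := h
  exact ⟨C, fun i => ⟨(hC i).1.of_le (by exact_mod_cast hmn),
    fun l hl => (hC i).2 l (hl.trans hmn)⟩⟩

theorem congr (h : UnifCk n f s) (hff : ∀ i, EqOn (f' i) (f i) s) : UnifCk n f' s := by
  obtain ⟨C, hC⟩ := h
  refine ⟨C, fun i => ⟨(hC i).1.congr (hff i), fun m hm x hx => ?_⟩⟩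
  rw [iteratedFDerivWithin_congr (hff i) hx]
  exact (hC i).2 m hm x hx

theorem reindex (h : UnifCk n f s) (φ : J → I) : UnifCk n (fun j => f (φ j)) s :=
  let ⟨C, hC⟩ := h; ⟨C, fun j => hC (φ j)⟩

theorem clm_comp (L : F →L[ℝ] G) (h : UnifCk n f s) (hs : UniqueDiffOn ℝ s) :
    UnifCk n (fun i x => L (f i x)) s := by
  obtain ⟨C, hC⟩ := h
  refine ⟨‖L‖ * C, fun i => ⟨L.contDiff.comp_contDiffOn (hC i).1, fun m hm x hx => ?_⟩⟩
  refine (L.norm_iteratedFDerivWithin_comp_left ((hC i).1 x hx) hs hx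
    (by exact_mod_cast hm)).trans ?_
  gcongr
  exact (hC i).2 m hm x hx

theorem add (h : UnifCk n f s) (h' : UnifCk n f' s) (hs : UniqueDiffOn ℝ s) :
    UnifCk n (fun i x => f i x + f' i x) s := by
  obtain ⟨C, hC⟩ := h
  obtain ⟨C', hC'⟩ := h'
  refine ⟨C + C', fun i => ⟨(hC i).1.add (hC' i).1, fun m hm x hx => ?_⟩⟩
  have hm' : (m : WithTop ℕ∞) ≤ n := by exact_mod_cast hm
  have := iteratedFDerivWithin_add_apply (((hC i).1 x hx).of_le hm')
    (((hC' i).1 x hx).of_le hm') hs hx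
  change ‖iteratedFDerivWithin ℝ m (f i + f' i) s x‖ ≤ _
  rw [this]
  exact (norm_add_le _ _).trans (add_le_add ((hC i).2 m hm x hx) ((hC' i).2 m hm x hx))

theorem neg (h : UnifCk n f s) (hs : UniqueDiffOn ℝ s) : UnifCk n (fun i x => - f i x) s := by
  simpa using h.clm_comp (-(ContinuousLinearMap.id ℝ F)) hs

theorem sub (h : UnifCk n f s) (h' : UnifCk n f' s) (hs : UniqueDiffOn ℝ s) :
    UnifCk n (fun i x => f i x - f' i x) s := by
  simpa only [sub_eq_add_neg] using h.add (h'.neg hs) hs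

theorem bilinear {g : I → E → G} (B : F →L[ℝ] G →L[ℝ] H) (h : UnifCk n f s) (hg : UnifCk n g s)
    (hs : UniqueDiffOn ℝ s) : UnifCk n (fun i x => B (f i x) (g i x)) s := by
  obtain ⟨C, h0, hC⟩ := h.exists_nonneg
  obtain ⟨C', h0', hC'⟩ := hg.exists_nonneg
  refine ⟨‖B‖ * ((2 : ℝ) ^ n * (C * C')), fun i =>
    ⟨B.isBoundedBilinearMap.contDiff.comp_contDiffOn ((hC i).1.prodMk (hC' i).1),
      fun m hm x hx => ?_⟩⟩
  refine (B.norm_iteratedFDerivWithin_le_of_bilinear (hC i).1 (hC' i).1 hs hx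
    (by exact_mod_cast hm)).trans ?_
  gcongr
  calc _ ≤ ∑ l ∈ Finset.range (m + 1), (m.choose l : ℝ) * (C * C') := by
        refine Finset.sum_le_sum fun l hl => ?_
        rw [mul_assoc]
        have hl' := Finset.mem_range.1 hl
        gcongr
        · exact (hC i).2 l (by omega) x hx
        · exact (hC' i).2 _ (by omega) x hx
    _ = (2 : ℝ) ^ m * (C * C') := by
        rw [← Finset.sum_mul]
        congr 1
        exact_mod_cast Nat.sum_range_choose m
    _ ≤ _ := by gcongr; norm_num

theorem smul {a : I → E → ℝ} (ha : UnifCk n a s) (h : UnifCk n f s) (hs : UniqueDiffOn ℝ s) :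
    UnifCk n (fun i x => a i x • f i x) s := by
  simpa using ha.bilinear (ContinuousLinearMap.lsmul ℝ ℝ) h hs

theorem mul {a b : I → E → ℝ} (ha : UnifCk n a s) (hb : UnifCk n b s) (hs : UniqueDiffOn ℝ s) :
    UnifCk n (fun i x => a i x * b i x) s := by
  simpa using ha.smul hb hs

theorem const (c : I → F) {C : ℝ} (hc : ∀ i, ‖c i‖ ≤ C) :
    UnifCk n (fun i (_ : E) => c i) s := by
  refine ⟨max C 0, fun i => ⟨contDiffOn_const, fun m hm x hx => ?_⟩⟩
  rcases m with _ | m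
  · simpa using Or.inl (hc i)
  · rw [iteratedFDerivWithin_succ_const]
    simp

theorem sum {ι : Type*} (u : Finset ι) {f : ι → I → E → F} (h : ∀ j ∈ u, UnifCk n (f j) s)
    (hs : UniqueDiffOn ℝ s) : UnifCk n (fun i x => ∑ j ∈ u, f j i x) s := by
  classical
  induction u using Finset.induction_on with
  | empty => simpa using UnifCk.const (n := n) (fun _ : I => (0 : F)) (C := 0) (by simp)
  | insert a u ha ih =>
    simp only [Finset.sum_insert ha]
    exact (h a (by simp)).add (ih fun j hj => h j (by simp [hj])) hs

theorem pi {ι : Type*} [Fintype ι] {f : I → E → ι → F} (h : ∀ j, UnifCk n (fun i x => f i x j) s)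
    (hs : UniqueDiffOn ℝ s) : UnifCk n f s := by
  classical
  refine (UnifCk.sum Finset.univ
    (fun j _ => (h j).clm_comp (ContinuousLinearMap.single ℝ (fun _ => F) j) hs) hs).congr ?_
  intro i x _
  ext j
  simp [Finset.sum_apply, Pi.single_apply]

theorem apply {ι : Type*} [Fintype ι] {f : I → E → ι → F} (h : UnifCk n f s)
    (hs : UniqueDiffOn ℝ s) (j : ι) : UnifCk n (fun i x => f i x j) s :=
  h.clm_comp (ContinuousLinearMap.proj (R := ℝ) (φ := fun _ : ι => F) j) hs

/-- The Faà di Bruno estimate. Derivatives of the outer functions are bounded only at the points `f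
i x`, so that `t` may be an open set on which they are unbounded, as for inversion. -/
theorem comp_aux {t : Set F} {g : I → F → G} (hg : ∀ i, ContDiffOn ℝ n (g i) t)
    (ht : UniqueDiffOn ℝ t) {C : ℝ}
    (hC : ∀ i, ∀ m ≤ n, ∀ x ∈ s, ‖iteratedFDerivWithin ℝ m (g i) t (f i x)‖ ≤ C)
    (h : UnifCk n f s) (hs : UniqueDiffOn ℝ s) (hst : ∀ i, MapsTo (f i) s t) :
    UnifCk n (fun i x => g i (f i x)) s := by
  obtain ⟨D, h0, hD⟩ := h.exists_nonneg
  refine ⟨(n.factorial : ℝ) * max C 0 * (max 1 D) ^ n, fun i =>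
    ⟨(hg i).comp (hD i).1 (hst i), fun m hm x hx => ?_⟩⟩
  refine (norm_iteratedFDerivWithin_comp_le (hg i) (hD i).1 (by exact_mod_cast hm) ht hs (hst i)
    hx (C := max C 0) (D := max 1 D) (fun l hl => ?_) (fun l hl hl' => ?_)).trans ?_
  · exact (hC i l (hl.trans hm) x hx).trans (le_max_left _ _)
  -- The composition estimate wants a bound `D ^ l` on the `l`-th derivative; passing to `max 1 D`
  -- makes a plain bound `D` sufficient for `l ≥ 1`.
  · exact ((hD i).2 l (hl'.trans hm) x hx).trans
      ((le_max_right 1 D).trans (le_self_pow₀ (le_max_left _ _) (by omega)))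
  · gcongr
    exact le_max_left _ _

theorem comp {t : Set F} {g : I → F → G} (hg : UnifCk n g t) (ht : UniqueDiffOn ℝ t)
    (h : UnifCk n f s) (hs : UniqueDiffOn ℝ s) (hst : ∀ i, MapsTo (f i) s t) :
    UnifCk n (fun i x => g i (f i x)) s := by
  obtain ⟨C, hC⟩ := hg
  exact comp_aux (fun i => (hC i).1) ht (C := C)
    (fun i m hm x hx => (hC i).2 m hm _ (hst i hx)) h hs hst

theorem bound_of_compact {t K : Set F} {g : F → G} (hg : ContDiffOn ℝ n g t)
    (ht : UniqueDiffOn ℝ t) (hK : IsCompact K) (hKt : K ⊆ t) :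
    ∃ C : ℝ, ∀ m ≤ n, ∀ y ∈ K, ‖iteratedFDerivWithin ℝ m g t y‖ ≤ C := by
  have : ∀ m : ℕ, ∃ C : ℝ, m ≤ n → ∀ y ∈ K, ‖iteratedFDerivWithin ℝ m g t y‖ ≤ C := by
    intro m
    by_cases hm : m ≤ n
    · obtain ⟨C, hC⟩ := hK.exists_bound_of_continuousOn
        ((hg.continuousOn_iteratedFDerivWithin (by exact_mod_cast hm) ht).mono hKt)
      exact ⟨C, fun _ => hC⟩
    · exact ⟨0, fun h => absurd h hm⟩
  choose C hC using this
  refine ⟨∑ m ∈ Finset.range (n + 1), |C m|, fun m hm y hy => ?_⟩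
  refine ((hC m hm y hy).trans (le_abs_self _)).trans ?_
  exact Finset.single_le_sum (f := fun m => |C m|) (fun _ _ => abs_nonneg _)
    (Finset.mem_range.2 (by omega))

/-- One fixed outer function has bounded derivatives on a compact set containing all values of the
family. This handles reciprocals and inverses of linear maps. -/
theorem comp_contDiffOn {t K : Set F} {g : F → G} (hg : ContDiffOn ℝ n g t)
    (ht : UniqueDiffOn ℝ t) (hK : IsCompact K) (hKt : K ⊆ t)
    (h : UnifCk n f s) (hs : UniqueDiffOn ℝ s) (hst : ∀ i, MapsTo (f i) s K) :
    UnifCk n (fun i x => g (f i x)) s := by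
  obtain ⟨C, hC⟩ := bound_of_compact hg ht hK hKt
  exact comp_aux (g := fun _ => g) (fun _ => hg) ht
    (fun i m hm x hx => hC m hm _ (hst i hx)) h hs (fun i x hx => hKt (hst i hx))

theorem of_contDiffOn {g : E → F} (hg : ContDiffOn ℝ n g s) (hs : UniqueDiffOn ℝ s)
    (hK : IsCompact s) : UnifCk n (fun _ : I => g) s := by
  obtain ⟨C, hC⟩ := bound_of_compact hg hs hK subset_rfl
  exact ⟨C, fun _ => ⟨hg, hC⟩⟩

theorem inv {a : I → E → ℝ} {c : ℝ} (hc : 0 < c) (ha : UnifCk n a s) (hs : UniqueDiffOn ℝ s)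
    (hca : ∀ i, ∀ x ∈ s, c ≤ a i x) : UnifCk n (fun i x => (a i x)⁻¹) s := by
  obtain ⟨C, h0, hC⟩ := ha.exists_bound
  refine comp_contDiffOn (t := Ioi 0) (K := Icc c C) (g := fun y : ℝ => y⁻¹)
    (fun y hy => (contDiffAt_inv ℝ (ne_of_gt hy)).contDiffWithinAt) (isOpen_Ioi.uniqueDiffOn)
    isCompact_Icc (fun y hy => hc.trans_le hy.1) ha hs
    (fun i x hx => ⟨hca i x hx, (le_abs_self _).trans (hC i x hx)⟩)

/-- The induction principle for the regularity proofs: it trades one order of smoothness for passing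
to the derivative. -/
theorem succ_iff (hs : UniqueDiffOn ℝ s) :
    UnifCk (n + 1) f s ↔ (∃ C : ℝ, ∀ i, ∀ x ∈ s, ‖f i x‖ ≤ C) ∧
      (∀ i, DifferentiableOn ℝ (f i) s) ∧ UnifCk n (fun i => fderivWithin ℝ (f i) s) s := by
  constructor
  · intro h
    refine ⟨let ⟨C, _, hC⟩ := h.exists_bound; ⟨C, hC⟩, fun i => ?_, ?_⟩
    · exact (h.contDiffOn i).differentiableOn (by simp)
    · obtain ⟨C, hC⟩ := h
      refine ⟨C, fun i => ⟨?_, fun m hm x hx => ?_⟩⟩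
      · exact (hC i).1.fderivWithin hs (by norm_cast)
      · rw [norm_iteratedFDerivWithin_fderivWithin hs hx]
        exact (hC i).2 (m + 1) (by omega) x hx
  · rintro ⟨⟨C, hC⟩, hd, C', hC'⟩
    refine ⟨max C C', fun i => ⟨?_, fun m hm x hx => ?_⟩⟩
    · have := contDiffOn_succ_of_fderivWithin (n := n) (hd i) (by simp) (hC' i).1
      exact_mod_cast this
    · rcases m with _ | m
      · simpa using Or.inl (hC i x hx)
      · rw [← norm_iteratedFDerivWithin_fderivWithin hs hx]
        exact ((hC' i).2 m (by omega) x hx).trans (le_max_right _ _)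

end UnifCk

/-! ### Integrals depending on a parameter. -/

omit [NormedSpace ℝ E] [NormedSpace ℝ F] in
theorem ContinuousOn.intervalIntegrable_slice {S : Set E} {g : E × ℝ → F}
    (hg : ContinuousOn g (S ×ˢ Icc (0 : ℝ) 1)) {x : E} (hx : x ∈ S) :
    IntervalIntegrable (fun s => g (x, s)) volume 0 1 := by
  apply ContinuousOn.intervalIntegrable
  rw [uIcc_of_le zero_le_one]
  exact hg.comp (by fun_prop) (fun s hs => ⟨hx, hs⟩)

omit [NormedSpace ℝ E] [NormedSpace ℝ F] in
theorem UniformContinuousOn.exists_slice_close {S : Set E} {g : E × ℝ → F} (hS : IsCompact S)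
    (hg : ContinuousOn g (S ×ˢ Icc (0 : ℝ) 1)) {ε : ℝ} (hε : 0 < ε) :
    ∃ δ > 0, ∀ x ∈ S, ∀ y ∈ S, dist y x < δ → ∀ s ∈ Icc (0 : ℝ) 1, ‖g (y, s) - g (x, s)‖ < ε := by
  have hu := (hS.prod isCompact_Icc).uniformContinuousOn_of_continuous hg
  obtain ⟨δ, hδ, h⟩ := Metric.uniformContinuousOn_iff.1 hu ε hε
  refine ⟨δ, hδ, fun x hx y hy hxy s hs => ?_⟩
  rw [← dist_eq_norm]
  exact h (y, s) ⟨hy, hs⟩ (x, s) ⟨hx, hs⟩ (by simpa [Prod.dist_eq] using hxy)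

omit [NormedSpace ℝ E] in
theorem ContinuousOn.parametric_integral {S : Set E} {g : E × ℝ → F} (hS : IsCompact S)
    (hg : ContinuousOn g (S ×ˢ Icc (0 : ℝ) 1)) :
    ContinuousOn (fun x => ∫ s in (0 : ℝ)..1, g (x, s)) S := by
  intro x hx
  rw [Metric.continuousWithinAt_iff]
  intro ε hε
  obtain ⟨δ, hδ, h⟩ := UniformContinuousOn.exists_slice_close hS hg (half_pos hε)
  refine ⟨δ, hδ, fun {y} hy hxy => ?_⟩
  rw [dist_eq_norm, ← intervalIntegral.integral_sub (hg.intervalIntegrable_slice hy)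
    (hg.intervalIntegrable_slice hx)]
  refine (intervalIntegral.norm_integral_le_of_norm_le_const (C := ε / 2) fun s hs => ?_).trans_lt
    (by norm_num; linarith)
  rw [uIoc_of_le zero_le_one] at hs
  exact (h x hx y hy hxy s ⟨hs.1.le, hs.2⟩).le

/-- By uniform continuity, `A (·, s)` varies by less than `ε` on a small ball, uniformly in `s`. The
mean value inequality on the convex set `S ∩ ball` then bounds the remainder of the integrand by `ε
‖y - x‖` for every `s`, and this integrates. -/
theorem HasFDerivWithinAt.parametric_integral [CompleteSpace F] {S : Set E} {g : E × ℝ → F}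
    (hS : IsCompact S) (hconv : Convex ℝ S) {A : E × ℝ → E →L[ℝ] F}
    (hg : ContinuousOn g (S ×ˢ Icc (0 : ℝ) 1)) (hA : ContinuousOn A (S ×ˢ Icc (0 : ℝ) 1))
    (hd : ∀ x ∈ S, ∀ s ∈ Icc (0 : ℝ) 1, HasFDerivWithinAt (fun y => g (y, s)) (A (x, s)) S x)
    {x : E} (hx : x ∈ S) :
    HasFDerivWithinAt (fun y => ∫ s in (0 : ℝ)..1, g (y, s)) (∫ s in (0 : ℝ)..1, A (x, s)) S x := by
  rw [hasFDerivWithinAt_iff_isLittleO, Asymptotics.isLittleO_iff]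
  intro ε hε
  obtain ⟨δ, hδ, h⟩ := UniformContinuousOn.exists_slice_close hS hA hε
  filter_upwards [self_mem_nhdsWithin, mem_nhdsWithin_of_mem_nhds (ball_mem_nhds x hδ)] with y hy hyx
  have hAi := hA.intervalIntegrable_slice hx
  have hAy : IntervalIntegrable (fun s => A (x, s) (y - x)) volume 0 1 := by
    apply ContinuousOn.intervalIntegrable
    rw [uIcc_of_le zero_le_one]
    exact (hA.comp (by fun_prop) (fun s hs => ⟨hx, hs⟩)).clm_apply continuousOn_const
  rw [ContinuousLinearMap.intervalIntegral_apply hAi,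
    ← intervalIntegral.integral_sub (hg.intervalIntegrable_slice hy)
    (hg.intervalIntegrable_slice hx), ← intervalIntegral.integral_sub
    ((hg.intervalIntegrable_slice hy).sub (hg.intervalIntegrable_slice hx)) hAy]
  refine (intervalIntegral.norm_integral_le_of_norm_le_const (C := ε * ‖y - x‖)
    fun s hs => ?_).trans (by simp)
  rw [uIoc_of_le zero_le_one] at hs
  have hs' : s ∈ Icc (0 : ℝ) 1 := ⟨hs.1.le, hs.2⟩
  refine (hconv.inter (convex_ball x δ)).norm_image_sub_le_of_norm_hasFDerivWithin_le'
    (f := fun y => g (y, s)) (f' := fun z => A (z, s)) (fun z hz => ?_) (fun z hz => ?_)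
    ⟨hx, mem_ball_self hδ⟩ ⟨hy, hyx⟩
  · exact (hd z hz.1 s hs').mono inter_subset_left
  · exact (h x hx z hz.1 hz.2 s hs').le

/-- Induction on the order, differentiating under the integral sign. The target changes from `F` to
`E →L[ℝ] F` at each step, hence the generalization over `F` and the choice of one universe for `E`
and `F`. -/
theorem UnifCk.parametric_integral {n : ℕ} {E : Type} [NormedAddCommGroup E] [NormedSpace ℝ E]
    {S : Set E} (hS : IsCompact S) (hconv : Convex ℝ S)
    (hu : UniqueDiffOn ℝ S) {F : Type} [NormedAddCommGroup F] [NormedSpace ℝ F] [CompleteSpace F]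
    {g : I → E × ℝ → F} (hg : UnifCk n g (S ×ˢ Icc (0 : ℝ) 1)) :
    UnifCk n (fun i x => ∫ s in (0 : ℝ)..1, g i (x, s)) S := by
  have hu' : UniqueDiffOn ℝ (S ×ˢ Icc (0 : ℝ) 1) := hu.prod uniqueDiffOn_Icc_zero_one
  induction n generalizing F with
  | zero =>
    obtain ⟨C, h0, hC⟩ := hg.exists_bound
    refine ⟨C, fun i => ⟨?_, fun m hm x hx => ?_⟩⟩
    · simpa using (hg.continuousOn i).parametric_integral hS
    · obtain rfl : m = 0 := by omega
      rw [norm_iteratedFDerivWithin_zero]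
      refine (intervalIntegral.norm_integral_le_of_norm_le_const (C := C) fun s hs => ?_).trans
        (by simp)
      rw [uIoc_of_le zero_le_one] at hs
      exact hC i _ ⟨hx, hs.1.le, hs.2⟩
  | succ n ih =>
    have h1 := (UnifCk.succ_iff hu').1 hg
    obtain ⟨⟨C, hC⟩, hd, hD⟩ := h1
    have hD' := hD.clm_comp ((ContinuousLinearMap.compL ℝ E (E × ℝ) F).flip
      (ContinuousLinearMap.inl ℝ E ℝ)) hu'
    have hder : ∀ i, ∀ x ∈ S, HasFDerivWithinAt (fun x => ∫ s in (0 : ℝ)..1, g i (x, s))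
        (∫ s in (0 : ℝ)..1, ((ContinuousLinearMap.compL ℝ E (E × ℝ) F).flip
      (ContinuousLinearMap.inl ℝ E ℝ)) (fderivWithin ℝ (g i) (S ×ˢ Icc (0 : ℝ) 1) (x, s))) S x := by
      intro i x hx
      refine HasFDerivWithinAt.parametric_integral hS hconv
        (A := fun z => ((ContinuousLinearMap.compL ℝ E (E × ℝ) F).flip
      (ContinuousLinearMap.inl ℝ E ℝ)) (fderivWithin ℝ (g i) (S ×ˢ Icc (0 : ℝ) 1) z))
        (hg.continuousOn i) (hD'.continuousOn i) (fun y hy s hs => ?_) hx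
      have h2 := (hd i (y, s) ⟨hy, hs⟩).hasFDerivWithinAt
      have h3 : HasFDerivWithinAt (fun y : E => (y, s)) (ContinuousLinearMap.inl ℝ E ℝ) S y := 
        (hasFDerivWithinAt_id y S).prodMk (hasFDerivWithinAt_const s y S)
      exact HasFDerivWithinAt.comp y h2 h3 (fun z hz => ⟨hz, hs⟩)
    refine (UnifCk.succ_iff hu).2 ⟨?_, fun i x hx => (hder i x hx).differentiableWithinAt, ?_⟩
    · refine ⟨C, fun i x hx => ?_⟩
      refine (intervalIntegral.norm_integral_le_of_norm_le_const (C := C) fun s hs => ?_).trans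
        (by simp)
      rw [uIoc_of_le zero_le_one] at hs
      exact hC i _ ⟨hx, hs.1.le, hs.2⟩
    · exact (ih hD').congr fun i x hx => (hder i x hx).fderivWithin (hu x hx)

/-! ### Regularity of inverse maps, up to the boundary. -/

theorem ContinuousOn.of_inverse_compact {X : Type*} [TopologicalSpace X] [T2Space X]
    {s : Set X} (hs : IsCompact s)
    {f g : X → X} (hf : ContinuousOn f s) (hfs : MapsTo f s s) (hgs : MapsTo g s s)
    (hgf : ∀ x ∈ s, g (f x) = x) (hfg : ∀ x ∈ s, f (g x) = x) : ContinuousOn g s := by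
  have : CompactSpace s := isCompact_iff_compactSpace.1 hs
  let e : s ≃ s :=
    { toFun := hfs.restrict f s s
      invFun := hgs.restrict g s s
      left_inv := fun x => Subtype.ext (hgf x x.2)
      right_inv := fun x => Subtype.ext (hfg x x.2) }
  have he : Continuous e := hf.mapsToRestrict hfs
  have h2 : Continuous e.symm := (he.homeoOfEquivCompactToT2).symm.continuous
  rw [continuousOn_iff_continuous_domRestrict]
  exact continuous_subtype_val.comp h2

/-- In finite dimension the operators with norm at most `C` and `|det| ≥ c` form a compact subset of
the open set of invertible ones, where inversion is smooth. -/
theorem UnifCk.clm_inverse [FiniteDimensional ℝ E] {n : ℕ} {s : Set F} {A : I → F → E →L[ℝ] E}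
    (hA : UnifCk n A s) (hs : UniqueDiffOn ℝ s) {c : ℝ} (hc : 0 < c)
    (hdet : ∀ i, ∀ x ∈ s, c ≤ |(A i x).det|) :
    UnifCk n (fun i x => (A i x).inverse) s := by
  have : CompleteSpace E := FiniteDimensional.complete ℝ E
  have : FiniteDimensional ℝ (E →L[ℝ] E) := inferInstance
  have : ProperSpace (E →L[ℝ] E) := FiniteDimensional.proper_real _
  obtain ⟨C, h0, hC⟩ := hA.exists_bound
  have hcont : Continuous fun B : E →L[ℝ] E => B.det := ContinuousLinearMap.continuous_det
  have hopen : IsOpen {B : E →L[ℝ] E | B.det ≠ 0} := isOpen_ne.preimage hcont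
  refine comp_contDiffOn (t := {B | B.det ≠ 0}) (K := closedBall 0 C ∩ {B : E →L[ℝ] E | c ≤ |B.det|})
    (g := ContinuousLinearMap.inverse) (fun B hB => ?_) hopen.uniqueDiffOn ?_ ?_ hA hs
    (fun i x hx => ⟨by simpa using hC i x hx, hdet i x hx⟩)
  · have := contDiffAt_map_inverse (𝕜 := ℝ) (n := n) (B.toContinuousLinearEquivOfDetNeZero hB)
    exact this.contDiffWithinAt
  · exact (isCompact_closedBall _ _).inter_right (isClosed_le continuous_const hcont.abs)
  · rintro B ⟨-, hB⟩ h0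
    have : c ≤ |B.det| := hB
    rw [h0] at this
    simp at this
    linarith

theorem HasFDerivWithinAt.inverse_of_det_ne_zero [FiniteDimensional ℝ E] {s : Set E}
    {Φ Ψ : E → E} {A : E →L[ℝ] E} {x : E} (hx : x ∈ s) (hΨs : MapsTo Ψ s s)
    (hΨ : ContinuousWithinAt Ψ s x) (hright : ∀ y ∈ s, Φ (Ψ y) = y)
    (hΦ : HasFDerivWithinAt Φ A s (Ψ x)) (hdet : A.det ≠ 0) :
    HasFDerivWithinAt Ψ A.inverse s x := by
  have : CompleteSpace E := FiniteDimensional.complete ℝ E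
  have h1 : A = (A.toContinuousLinearEquivOfDetNeZero hdet : E →L[ℝ] E) := rfl
  rw [h1] at hΦ ⊢
  rw [ContinuousLinearMap.inverse_equiv]
  exact HasFDerivWithinAt.of_local_left_inverse (hΨ.tendsto_nhdsWithin hΨs) hΦ hx
    (eventually_of_mem self_mem_nhdsWithin hright)

/-- Bootstrapping on `DΨ = (DΦ ∘ Ψ)⁻¹`: if `Ψ` is uniformly `C^n` and `Φ` uniformly `C^{n+1}`, the
right side is uniformly `C^n`. The start is continuity of the inverse of a continuous bijection of a
compact set. Bijectivity being given, no inverse function theorem at boundary points is needed. -/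
theorem UnifCk.inverse {E : Type} [NormedAddCommGroup E] [NormedSpace ℝ E]
    [FiniteDimensional ℝ E] {s : Set E} (hs : IsCompact s)
    (hu : UniqueDiffOn ℝ s) {Φ Ψ : I → E → E} {n : ℕ} (hΦ : UnifCk n Φ s)
    (hΦs : ∀ i, MapsTo (Φ i) s s) (hΨs : ∀ i, MapsTo (Ψ i) s s)
    (hleft : ∀ i, ∀ x ∈ s, Ψ i (Φ i x) = x) (hright : ∀ i, ∀ x ∈ s, Φ i (Ψ i x) = x)
    {c : ℝ} (hc : 0 < c) (hdet : ∀ i, ∀ x ∈ s, c ≤ |(fderivWithin ℝ (Φ i) s x).det|) :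
    UnifCk n Ψ s := by
  have hcont : ∀ i, ContinuousOn (Ψ i) s := fun i =>
    (hΦ.continuousOn i).of_inverse_compact hs (hΦs i) (hΨs i) (hleft i) (hright i)
  obtain ⟨C, hC⟩ := hs.exists_bound_of_continuousOn (f := fun x : E => x) continuousOn_id
  induction n with
  | zero =>
    refine ⟨C, fun i => ⟨?_, fun m hm x hx => ?_⟩⟩
    · simpa using hcont i
    · obtain rfl : m = 0 := by omega
      rw [norm_iteratedFDerivWithin_zero]
      exact hC _ (hΨs i hx)
  | succ n ih =>
    have ihn := ih (hΦ.of_le (Nat.le_succ n))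
    obtain ⟨-, hd, hD⟩ := (UnifCk.succ_iff hu).1 hΦ
    have hder : ∀ i, ∀ x ∈ s, HasFDerivWithinAt (Ψ i)
        (fderivWithin ℝ (Φ i) s (Ψ i x)).inverse s x := fun i x hx =>
      HasFDerivWithinAt.inverse_of_det_ne_zero hx (hΨs i) (hcont i x hx) (hright i)
        (hd i _ (hΨs i hx)).hasFDerivWithinAt
        (fun h0 => by
          have := hdet i _ (hΨs i hx)
          rw [h0, abs_zero] at this
          linarith)
    refine (UnifCk.succ_iff hu).2 ⟨⟨C, fun i x hx => hC _ (hΨs i hx)⟩,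
      fun i x hx => (hder i x hx).differentiableWithinAt, ?_⟩
    refine ((hD.comp hu ihn hu hΨs).clm_inverse hu hc
      (fun i x hx => hdet i _ (hΨs i hx))).congr fun i x hx => ?_
    exact (hder i x hx).fderivWithin (hu x hx)

/-! ### Triangular maps of the cube and their inverses. -/

/-- A family of maps of the cube `[0,1]^n` that is uniformly `C^k`, upper triangular (the `j`-th
component depends on the coordinates `l ≥ j` only), uniformly increasing on the diagonal, and that
preserves the faces of the cube. -/
structure TriFamily (k n : ℕ) (Φ : I → (Fin n → ℝ) → Fin n → ℝ) : Prop where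
  unifCk : UnifCk k Φ (Icc 0 1)
  dep : ∀ i, ∀ x ∈ Icc (0 : Fin n → ℝ) 1, ∀ y ∈ Icc (0 : Fin n → ℝ) 1, ∀ j,
    (∀ l, j ≤ l → x l = y l) → Φ i x j = Φ i y j
  mono : ∃ c > 0, ∀ i, ∀ x ∈ Icc (0 : Fin n → ℝ) 1, ∀ j, ∀ b ∈ Icc (x j) 1,
    c * (b - x j) ≤ Φ i (Function.update x j b) j - Φ i x j
  face_zero : ∀ i, ∀ x ∈ Icc (0 : Fin n → ℝ) 1, ∀ j, x j = 0 → Φ i x j = 0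
  face_one : ∀ i, ∀ x ∈ Icc (0 : Fin n → ℝ) 1, ∀ j, x j = 1 → Φ i x j = 1

section Cube

variable {n : ℕ}

theorem uniqueDiffOn_cube : UniqueDiffOn ℝ (Icc (0 : Fin n → ℝ) 1) := by
  rw [← pi_univ_Icc]
  exact UniqueDiffOn.univ_pi fun _ => uniqueDiffOn_Icc_zero_one

theorem update_mem_cube {x : Fin n → ℝ} (hx : x ∈ Icc (0 : Fin n → ℝ) 1) (j : Fin n) {b : ℝ}
    (hb : b ∈ Icc (0 : ℝ) 1) : Function.update x j b ∈ Icc (0 : Fin n → ℝ) 1 := by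
  rw [← pi_univ_Icc] at hx ⊢
  rw [update_mem_pi_iff_of_mem hx]
  exact fun _ => hb

theorem cube_apply {x : Fin n → ℝ} (hx : x ∈ Icc (0 : Fin n → ℝ) 1) (j : Fin n) :
    x j ∈ Icc (0 : ℝ) 1 := ⟨hx.1 j, hx.2 j⟩

end Cube

namespace TriFamily

variable {k n : ℕ} {Φ : I → (Fin n → ℝ) → Fin n → ℝ}

/-- Moving the `j`-th coordinate to `0` or `1` lands on a face, where the `j`-th component is known;
monotonicity compares it with the value at `x`. -/
theorem mapsTo (h : TriFamily k n Φ) (i : I) : MapsTo (Φ i) (Icc 0 1) (Icc 0 1) := by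
  obtain ⟨c, hc, hm⟩ := h.mono
  intro x hx
  rw [mem_Icc, Pi.le_def, Pi.le_def, ← forall_and]
  intro j
  have hxj := cube_apply hx j
  have h0 := update_mem_cube hx j (left_mem_Icc.2 zero_le_one)
  constructor
  · have := hm i _ h0 j (x j) (by simpa using hxj)
    rw [Function.update_idem, Function.update_eq_self, h.face_zero i _ h0 j (by simp)] at this
    simp only [Function.update_self] at this
    have := mul_nonneg hc.le hxj.1
    simp only [Pi.zero_apply]
    linarith
  · have := hm i x hx j 1 ⟨hxj.2, le_rfl⟩
    rw [h.face_one i _ (update_mem_cube hx j (right_mem_Icc.2 zero_le_one)) j (by simp)] at this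
    have := mul_nonneg hc.le (sub_nonneg.2 hxj.2)
    simp only [Pi.one_apply]
    linarith

/-- If `Φ x` and `Φ y` agree in the coordinates `l ≥ j`, so do `x` and `y`. -/
theorem coord_inj (h : TriFamily k n Φ) (i : I) {x y : Fin n → ℝ} (hx : x ∈ Icc (0 : Fin n → ℝ) 1)
    (hy : y ∈ Icc (0 : Fin n → ℝ) 1) (j : Fin n) (hxy : ∀ l, j ≤ l → Φ i x l = Φ i y l) :
    ∀ l, j ≤ l → x l = y l := by
  obtain ⟨c, hc, hm⟩ := h.mono
  have key : ∀ x ∈ Icc (0 : Fin n → ℝ) 1, ∀ y ∈ Icc (0 : Fin n → ℝ) 1, ∀ l,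
      (∀ m, l < m → x m = y m) → Φ i x l = Φ i y l → x l ≤ y l → x l = y l := by
    intro x hx y hy l hlm hl hle
    have h1 := hm i x hx l (y l) ⟨hle, (cube_apply hy l).2⟩
    rw [h.dep i _ (update_mem_cube hx l (cube_apply hy l)) y hy l, hl, sub_self] at h1
    · nlinarith
    · intro m hm
      rcases hm.eq_or_lt with rfl | hm
      · simp
      · rw [Function.update_of_ne hm.ne']
        exact hlm m hm
  -- Descending induction on the coordinate: `n ≤ p + l` says that `l` is among the last `p`
  -- coordinates.
  suffices ∀ p : ℕ, ∀ l : Fin n, j ≤ l → n ≤ p + l → x l = y l from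
    fun l hl => this n l hl (by omega)
  intro p
  induction p using Nat.strong_induction_on with
  | _ p ih =>
    intro l hl hp
    have hlm : ∀ m, l < m → x m = y m := fun m hm =>
      ih (p - 1) (by have := m.2; omega) m (hl.trans hm.le) (by omega)
    rcases le_total (x l) (y l) with hle | hle
    · exact key x hx y hy l hlm (hxy l hl) hle
    · exact (key y hy x hx l (fun m hm => (hlm m hm).symm) (hxy l hl).symm hle).symm

theorem injOn (h : TriFamily k n Φ) (i : I) : InjOn (Φ i) (Icc 0 1) := by
  intro x hx y hy hxy
  ext l
  exact h.coord_inj i hx hy l (fun m _ => by rw [hxy]) l le_rfl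

/-- The equation is solved one coordinate at a time, from the last to the first. The face conditions
provide the end values for the intermediate value theorem, and by triangularity the choice of
coordinate `j` does not disturb the components `l > j` already matched. -/
theorem surjOn (h : TriFamily k n Φ) (i : I) : SurjOn (Φ i) (Icc 0 1) (Icc 0 1) := by
  intro y hy
  suffices ∀ p : ℕ, ∃ x ∈ Icc (0 : Fin n → ℝ) 1, ∀ l : Fin n, n ≤ p + l → Φ i x l = y l by
    obtain ⟨x, hx, hl⟩ := this n
    exact ⟨x, hx, funext fun l => hl l (by omega)⟩
  intro p
  induction p with
  | zero => exact ⟨0, left_mem_Icc.2 zero_le_one, fun l hl => by omega⟩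
  | succ p ih =>
    obtain ⟨x, hx, hl⟩ := ih
    by_cases hp : p < n
    · let j : Fin n := ⟨n - (p + 1), by omega⟩
      have hcont : ContinuousOn (fun b => Φ i (Function.update x j b) j) (Icc 0 1) := by
        have h1 := (h.unifCk.continuousOn i).comp (s := Icc (0 : ℝ) 1)
          (f := fun b => Function.update x j b)
          (by fun_prop) (fun b hb => update_mem_cube hx j hb)
        exact (continuous_apply j).comp_continuousOn h1
      have h2 := intermediate_value_Icc zero_le_one hcont
      rw [h.face_zero i _ (update_mem_cube hx j (left_mem_Icc.2 zero_le_one)) j (by simp),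
        h.face_one i _ (update_mem_cube hx j (right_mem_Icc.2 zero_le_one)) j (by simp)] at h2
      obtain ⟨b, hb, hbj⟩ := h2 (cube_apply hy j)
      refine ⟨Function.update x j b, update_mem_cube hx j hb, fun l hl' => ?_⟩
      by_cases hlj : l = j
      · rw [hlj]; exact hbj
      · have hjl : (j : ℕ) ≠ l := fun h => hlj (Fin.ext h.symm)
        have : (j : ℕ) = n - (p + 1) := rfl
        rw [← hl l (by omega)]
        refine h.dep i _ (update_mem_cube hx j hb) x hx l fun m hm => ?_
        rw [Function.update_of_ne]
        rintro rfl
        have : (l : ℕ) ≤ j := hm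
        omega
    · exact ⟨x, hx, fun l _ => hl l (by omega)⟩

end TriFamily

theorem UnifCk.exists_lipschitz {k : ℕ} (hk : 1 ≤ k) {f : I → E → F} {s : Set E}
    (h : UnifCk k f s) (hs : UniqueDiffOn ℝ s) (hconv : Convex ℝ s) :
    ∃ C : ℝ, 0 < C ∧ ∀ i, (∀ x ∈ s, ‖fderivWithin ℝ (f i) s x‖ ≤ C) ∧
      ∀ x ∈ s, ∀ y ∈ s, ‖f i y - f i x‖ ≤ C * ‖y - x‖ := by
  obtain ⟨-, hd, hD⟩ := (UnifCk.succ_iff (n := 0) hs).1 (h.of_le hk)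
  obtain ⟨C, h0, hC⟩ := hD.exists_bound
  have hC' : ∀ i, ∀ x ∈ s, ‖fderivWithin ℝ (f i) s x‖ ≤ C + 1 :=
    fun i x hx => (hC i x hx).trans (by linarith)
  exact ⟨C + 1, by linarith, fun i => ⟨hC' i, fun x hx y hy =>
    hconv.norm_image_sub_le_of_norm_fderivWithin_le (hd i) (hC' i) hx hy⟩⟩

theorem ContinuousLinearMap.det_eq_prod_of_upperTriangular {n : ℕ}
    (A : (Fin n → ℝ) →L[ℝ] Fin n → ℝ) (hA : ∀ j l, l < j → A (Pi.single l 1) j = 0) :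
    A.det = ∏ j, A (Pi.single j 1) j := by
  rw [ContinuousLinearMap.det, ← LinearMap.det_toMatrix', Matrix.det_of_isUpperTriangular]
  · simp [LinearMap.toMatrix'_apply]
  · intro j l hlj
    simpa [LinearMap.toMatrix'_apply] using hA j l hlj

theorem HasFDerivWithinAt.partial_cube {n : ℕ} {Φ : (Fin n → ℝ) → Fin n → ℝ}
    {A : (Fin n → ℝ) →L[ℝ] Fin n → ℝ} {x : Fin n → ℝ} (hx : x ∈ Icc (0 : Fin n → ℝ) 1)
    (h : HasFDerivWithinAt Φ A (Icc 0 1) x) (l j : Fin n) :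
    HasDerivWithinAt (fun b => Φ (Function.update x l b) j) (A (Pi.single l 1) j)
      (Icc 0 1) (x l) := by
  have h1 : HasDerivWithinAt (fun b => Function.update x l b) (Pi.single l 1) (Icc 0 1) (x l) :=
    (hasDerivAt_update x l (x l)).hasDerivWithinAt
  have h2 : HasFDerivWithinAt Φ A (Icc 0 1) (Function.update x l (x l)) := by
    rwa [Function.update_eq_self]
  have h3 := h2.comp_hasDerivWithinAt (x l) h1 (fun b hb => update_mem_cube hx l hb)
  exact (hasDerivWithinAt_pi.1 h3) j

namespace TriFamily

variable {k n : ℕ} {Φ : I → (Fin n → ℝ) → Fin n → ℝ}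

theorem fderivWithin_lower (h : TriFamily k n Φ) (i : I) {x : Fin n → ℝ}
    (hx : x ∈ Icc (0 : Fin n → ℝ) 1) {A : (Fin n → ℝ) →L[ℝ] Fin n → ℝ}
    (hA : HasFDerivWithinAt (Φ i) A (Icc 0 1) x) (j l : Fin n) (hlj : l < j) :
    A (Pi.single l 1) j = 0 := by
  have h1 := hA.partial_cube hx l j
  have h2 : HasDerivWithinAt (fun b => Φ i (Function.update x l b) j) 0 (Icc 0 1) (x l) := by
    refine (hasDerivWithinAt_const (x l) _ (Φ i x j)).congr (fun b hb => ?_) ?_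
    · refine h.dep i _ (update_mem_cube hx l hb) _ hx j fun m hm => ?_
      rw [Function.update_of_ne (hlj.trans_le hm).ne']
    · rw [Function.update_eq_self]
  exact (uniqueDiffOn_Icc_zero_one _ (cube_apply hx l)).eq_deriv _ h1 h2

/-- After subtracting `c * b`, the restriction to the `j`-th coordinate line is still monotone, so
its derivative is nonnegative. -/
theorem le_fderivWithin_diag {c : ℝ} (i : I)
    (hm : ∀ x ∈ Icc (0 : Fin n → ℝ) 1, ∀ j, ∀ b ∈ Icc (x j) 1,
      c * (b - x j) ≤ Φ i (Function.update x j b) j - Φ i x j) {x : Fin n → ℝ}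
    (hx : x ∈ Icc (0 : Fin n → ℝ) 1) {A : (Fin n → ℝ) →L[ℝ] Fin n → ℝ}
    (hA : HasFDerivWithinAt (Φ i) A (Icc 0 1) x) (j : Fin n) :
    c ≤ A (Pi.single j 1) j := by
  have h1 := hA.partial_cube hx j j
  have h2 := h1.sub ((hasDerivWithinAt_id (x j) (Icc 0 1)).const_mul c)
  have hmono : MonotoneOn ((fun b => Φ i (Function.update x j b) j) - fun b => c * id b)
      (Icc 0 1) := by
    intro a ha b hb hab
    have := hm _ (update_mem_cube hx j ha) j b (by simpa using ⟨hab, hb.2⟩)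
    rw [Function.update_idem] at this
    simp only [Function.update_self, Pi.sub_apply, id] at this ⊢
    linarith
  have h3 := hmono.derivWithin_nonneg (x := x j)
  rw [h2.derivWithin (uniqueDiffOn_Icc_zero_one _ (cube_apply hx j))] at h3
  linarith

theorem hasFDerivWithinAt (h : TriFamily k n Φ) (hk : 1 ≤ k) (i : I) {x : Fin n → ℝ}
    (hx : x ∈ Icc (0 : Fin n → ℝ) 1) :
    HasFDerivWithinAt (Φ i) (fderivWithin ℝ (Φ i) (Icc 0 1) x) (Icc 0 1) x :=
  (((h.unifCk.contDiffOn i).differentiableOn (by norm_cast; omega)) x hx).hasFDerivWithinAt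

theorem exists_le_det (h : TriFamily k n Φ) (hk : 1 ≤ k) :
    ∃ c : ℝ, 0 < c ∧ ∀ i, ∀ x ∈ Icc (0 : Fin n → ℝ) 1,
      c ≤ |(fderivWithin ℝ (Φ i) (Icc 0 1) x).det| := by
  obtain ⟨c, hc, hm⟩ := h.mono
  refine ⟨c ^ n, pow_pos hc n, fun i x hx => ?_⟩
  have hA := h.hasFDerivWithinAt hk i hx
  rw [ContinuousLinearMap.det_eq_prod_of_upperTriangular _ (h.fderivWithin_lower i hx hA)]
  refine le_trans ?_ (le_abs_self _)
  calc c ^ n = ∏ _j : Fin n, c := by simp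
    _ ≤ _ := Finset.prod_le_prod (fun _ _ => hc.le)
      fun j _ => le_fderivWithin_diag i (hm i) hx hA j

/-- The inverse on the cube. -/
def inv (Φ : I → (Fin n → ℝ) → Fin n → ℝ) (i : I) : (Fin n → ℝ) → Fin n → ℝ :=
  Function.invFunOn (Φ i) (Icc 0 1)

theorem inv_mapsTo (h : TriFamily k n Φ) (i : I) : MapsTo (inv Φ i) (Icc 0 1) (Icc 0 1) :=
  (h.surjOn i).mapsTo_invFunOn

theorem apply_inv (h : TriFamily k n Φ) (i : I) {y : Fin n → ℝ} (hy : y ∈ Icc (0 : Fin n → ℝ) 1) :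
    Φ i (inv Φ i y) = y := (h.surjOn i).rightInvOn_invFunOn hy

theorem inv_apply (h : TriFamily k n Φ) (i : I) {x : Fin n → ℝ} (hx : x ∈ Icc (0 : Fin n → ℝ) 1) :
    inv Φ i (Φ i x) = x := (h.injOn i).leftInvOn_invFunOn hx

/-- Triangularity passes to the inverse because the last coordinates of `Φ x` determine those of
`x`. The lower slope bound of the inverse is the reciprocal of a common Lipschitz constant of the `Φ
i`. -/
theorem inverse (h : TriFamily k n Φ) (hk : 1 ≤ k) : TriFamily k n (inv Φ) := by
  obtain ⟨c, hc, hdet⟩ := h.exists_le_det hk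
  have hcoord : ∀ i, ∀ x ∈ Icc (0 : Fin n → ℝ) 1, ∀ y ∈ Icc (0 : Fin n → ℝ) 1, ∀ j,
      (∀ l, j ≤ l → x l = y l) → ∀ l, j ≤ l → inv Φ i x l = inv Φ i y l := by
    intro i x hx y hy j hxy
    refine h.coord_inj i (h.inv_mapsTo i hx) (h.inv_mapsTo i hy) j fun l hl => ?_
    rw [h.apply_inv i hx, h.apply_inv i hy, hxy l hl]
  refine ⟨UnifCk.inverse isCompact_Icc uniqueDiffOn_cube h.unifCk h.mapsTo h.inv_mapsTo
    (fun i x hx => h.inv_apply i hx) (fun i x hx => h.apply_inv i hx) hc hdet, ?_, ?_, ?_, ?_⟩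
  · intro i x hx y hy j hxy
    exact hcoord i x hx y hy j hxy j le_rfl
  · obtain ⟨C, hC, hL⟩ := h.unifCk.exists_lipschitz hk uniqueDiffOn_cube (convex_Icc 0 1)
    obtain ⟨c', hc', hm⟩ := h.mono
    refine ⟨C⁻¹, inv_pos.2 hC, fun i y hy j b hb => ?_⟩
    have hb01 : b ∈ Icc (0 : ℝ) 1 := ⟨(cube_apply hy j).1.trans hb.1, hb.2⟩
    have hy' := update_mem_cube hy j hb01
    set y' := Function.update y j b with hy'def
    set x := inv Φ i y with hxdef
    set x' := inv Φ i y' with hx'def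
    have hx := h.inv_mapsTo i hy
    have hx' := h.inv_mapsTo i hy'
    rw [← hxdef] at hx
    rw [← hx'def] at hx'
    have hxx : ∀ l, j < l → x l = x' l := fun l hl => by
      refine hcoord i y hy y' hy' l (fun m hm => ?_) l le_rfl
      rw [hy'def, Function.update_of_ne (hl.trans_le hm).ne']
    -- Two points that agree beyond `j` may be compared by changing the `j`-th coordinate alone:
    -- component `j` does not see the earlier ones.
    have hxu : ∀ z ∈ Icc (0 : Fin n → ℝ) 1, ∀ z' ∈ Icc (0 : Fin n → ℝ) 1,
        (∀ l, j < l → z l = z' l) → Φ i z' j = Φ i (Function.update z j (z' j)) j := by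
      intro z hz z' hz' hzz
      refine h.dep i _ hz' _ (update_mem_cube hz j (cube_apply hz' j)) j fun l hl => ?_
      rcases hl.eq_or_lt with rfl | hl
      · simp
      · rw [Function.update_of_ne hl.ne', hzz l hl]
    have hyy : Φ i x' j - Φ i x j = b - y j := by
      rw [h.apply_inv i hy, h.apply_inv i hy', hy'def, Function.update_self]
    have h1 : b - y j ≤ C * |x' j - x j| := by
      have h2 := (hL i).2 x hx _ (update_mem_cube hx j (cube_apply hx' j))
      have h3 := (norm_le_pi_norm (Φ i (Function.update x j (x' j)) - Φ i x) j).trans h2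
      rw [Pi.sub_apply, ← hxu x hx x' hx' hxx, hyy, Real.norm_eq_abs] at h3
      refine (le_abs_self _).trans (h3.trans ?_)
      gcongr
      refine (pi_norm_le_iff_of_nonneg (abs_nonneg _)).2 fun l => ?_
      by_cases hl : l = j
      · subst hl; simp
      · simp [Function.update_of_ne hl]
    have h4 : x j ≤ x' j := by
      by_contra hlt
      push Not at hlt
      have h5 := hm i x' hx' j (x j) ⟨hlt.le, (cube_apply hx j).2⟩
      rw [← hxu x' hx' x hx fun l hl => (hxx l hl).symm] at h5
      have : 0 < c' * (x j - x' j) := mul_pos hc' (sub_pos.2 hlt)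
      linarith [hb.1]
    rw [abs_of_nonneg (sub_nonneg.2 h4)] at h1
    rw [inv_mul_le_iff₀ hC]
    exact h1
  · intro i y hy j hyj
    obtain ⟨c', hc', hm⟩ := h.mono
    have hx := h.inv_mapsTo i hy
    -- The `j`-th component of `Φ i` vanishes both at the preimage and at its projection to the face
    -- `0`; the slope bound between the two forces the coordinate to be `0`.
    have h0 := update_mem_cube hx j (left_mem_Icc.2 zero_le_one)
    have := hm i _ h0 j (inv Φ i y j) (by simpa using cube_apply hx j)
    rw [Function.update_idem, Function.update_eq_self, h.apply_inv i hy, hyj,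
      h.face_zero i _ h0 j (by simp), Function.update_self] at this
    have h2 := (cube_apply hx j).1
    nlinarith
  · intro i y hy j hyj
    obtain ⟨c', hc', hm⟩ := h.mono
    have hx := h.inv_mapsTo i hy
    have := hm i _ hx j 1 (by simpa using (cube_apply hx j).2)
    rw [h.apply_inv i hy, hyj, h.face_one i _ (update_mem_cube hx j
      (right_mem_Icc.2 zero_le_one)) j (by simp)] at this
    have h2 := (cube_apply hx j).2
    nlinarith

end TriFamily

/-! ### The Knothe-Rosenblatt map from a density to the uniform measure. -/

section KnotheRosenblatt

variable {n k : ℕ}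

/-- The density `q` with the coordinates `l < j` integrated out over `[0,1]`. -/
def tailMarginal (q : (Fin n → ℝ) → ℝ) : ℕ → (Fin n → ℝ) → ℝ
  | 0 => q
  | j + 1 => fun x => if h : j < n then
      ∫ s in (0 : ℝ)..1, tailMarginal q j (Function.update x ⟨j, h⟩ s) else tailMarginal q j x

theorem tailMarginal_succ (q : (Fin n → ℝ) → ℝ) (j : Fin n) (x : Fin n → ℝ) :
    tailMarginal q (j + 1) x = ∫ s in (0 : ℝ)..1, tailMarginal q j (Function.update x j s) := by
  simp [tailMarginal]

/-- The Knothe-Rosenblatt map of a density `q` on the cube to the uniform density. -/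
def knotheMap (q : (Fin n → ℝ) → ℝ) (x : Fin n → ℝ) : Fin n → ℝ := fun j =>
  x j * (∫ s in (0 : ℝ)..1, tailMarginal q j (Function.update x j (s * x j))) *
    (tailMarginal q (j + 1) x)⁻¹

theorem tailMarginal_dep (q : (Fin n → ℝ) → ℝ) (j : ℕ) {x y : Fin n → ℝ}
    (hxy : ∀ l : Fin n, j ≤ l → x l = y l) : tailMarginal q j x = tailMarginal q j y := by
  induction j generalizing x y with
  | zero =>
    congr
    ext l
    exact hxy l (Nat.zero_le _)
  | succ j ih =>
    by_cases hj : j < n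
    · rw [tailMarginal_succ q ⟨j, hj⟩ x, tailMarginal_succ q ⟨j, hj⟩ y]
      congr 1
      ext s
      refine ih fun l hl => ?_
      by_cases hlj : l = ⟨j, hj⟩
      · subst hlj; simp
      · rw [Function.update_of_ne hlj, Function.update_of_ne hlj]
        exact hxy l (by
          have : (l : ℕ) ≠ j := fun h => hlj (Fin.ext h)
          omega)
    · simp only [tailMarginal, hj, dif_neg, not_false_eq_true]
      exact ih fun l _ => absurd l.2 (by omega)

/-- The definition integrates over the fixed interval `[0,1]`, as the lemma on parametric integrals
requires. Rescaling shows that it is the conditional distribution function of the `j`-th coordinate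
given the later ones. -/
theorem knotheMap_eq_integral (q : (Fin n → ℝ) → ℝ) (x : Fin n → ℝ) (j : Fin n) :
    knotheMap q x j = (∫ s in (0 : ℝ)..x j, tailMarginal q j (Function.update x j s)) *
      (tailMarginal q (j + 1) x)⁻¹ := by
  rw [knotheMap, intervalIntegral.mul_integral_comp_mul_right
    (f := fun s => tailMarginal q j (Function.update x j s))]
  simp

theorem knotheMap_update (q : (Fin n → ℝ) → ℝ) (x : Fin n → ℝ) (j : Fin n) (b : ℝ) :
    knotheMap q (Function.update x j b) j =
      (∫ s in (0 : ℝ)..b, tailMarginal q j (Function.update x j s)) *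
      (tailMarginal q (j + 1) x)⁻¹ := by
  rw [knotheMap_eq_integral]
  simp only [Function.update_self, Function.update_idem]
  congr 2
  refine tailMarginal_dep q _ fun l hl => ?_
  rw [Function.update_of_ne]
  rintro rfl
  omega

variable {p : I → (Fin n → ℝ) → ℝ}

theorem convex_cube : Convex ℝ (Icc (0 : Fin n → ℝ) 1) := convex_Icc 0 1

theorem contDiff_update_prod (j : Fin n) :
    ContDiff ℝ k fun z : (Fin n → ℝ) × ℝ => Function.update z.1 j z.2 := by
  rw [contDiff_pi]
  intro l
  by_cases hl : l = j
  · subst hl; simp only [Function.update_self]; fun_prop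
  · simp only [Function.update_of_ne hl]; fun_prop

/-- The function `a` is `s` for the marginals and `s * x j` for the rescaled distribution functions.
-/
theorem UnifCk.integral_update (hp : UnifCk k p (Icc 0 1)) (j : Fin n) {a : (Fin n → ℝ) × ℝ → ℝ}
    (ha : ContDiff ℝ k a)
    (ham : MapsTo a (Icc (0 : Fin n → ℝ) 1 ×ˢ Icc (0 : ℝ) 1) (Icc 0 1)) :
    UnifCk k (fun i x => ∫ s in (0 : ℝ)..1, p i (Function.update x j (a (x, s)))) (Icc 0 1) := by
  have hu : UniqueDiffOn ℝ (Icc (0 : Fin n → ℝ) 1 ×ˢ Icc (0 : ℝ) 1) :=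
    uniqueDiffOn_cube.prod uniqueDiffOn_Icc_zero_one
  refine UnifCk.parametric_integral (g := fun i z => p i (Function.update z.1 j (a z)))
    isCompact_Icc convex_cube uniqueDiffOn_cube ?_
  refine hp.comp uniqueDiffOn_cube (UnifCk.of_contDiffOn (I := I)
    (g := fun z : (Fin n → ℝ) × ℝ => Function.update z.1 j (a z)) ?_ hu
    (isCompact_Icc.prod isCompact_Icc)) hu fun i z hz => update_mem_cube hz.1 j (ham hz)
  exact ((contDiff_update_prod j).comp (contDiff_fst.prodMk ha)).contDiffOn

theorem UnifCk.tailMarginal (hp : UnifCk k p (Icc 0 1)) (j : ℕ) :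
    UnifCk k (fun i => tailMarginal (p i) j) (Icc 0 1) := by
  induction j with
  | zero => exact hp
  | succ j ih =>
    by_cases hj : j < n
    · refine (ih.integral_update ⟨j, hj⟩ (a := fun z => z.2) contDiff_snd
        (fun z hz => hz.2)).congr fun i x _ => ?_
      exact tailMarginal_succ (p i) ⟨j, hj⟩ x
    · simpa only [_root_.tailMarginal, hj, dif_neg, not_false_eq_true] using ih

theorem continuousOn_tailMarginal_update (hp : UnifCk k p (Icc 0 1)) (i : I) (j : ℕ) (l : Fin n)
    {x : Fin n → ℝ} (hx : x ∈ Icc (0 : Fin n → ℝ) 1) :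
    ContinuousOn (fun s => tailMarginal (p i) j (Function.update x l s)) (Icc 0 1) :=
  ((hp.tailMarginal j).continuousOn i).comp (by fun_prop) (fun _ hs => update_mem_cube hx l hs)

theorem intervalIntegrable_tailMarginal (hp : UnifCk k p (Icc 0 1)) (i : I) (j : ℕ) (l : Fin n)
    {x : Fin n → ℝ} (hx : x ∈ Icc (0 : Fin n → ℝ) 1) {a b : ℝ} (ha : a ∈ Icc (0 : ℝ) 1)
    (hb : b ∈ Icc (0 : ℝ) 1) :
    IntervalIntegrable (fun s => tailMarginal (p i) j (Function.update x l s)) volume a b :=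
  ((continuousOn_tailMarginal_update hp i j l hx).mono
    (uIcc_subset_Icc ha hb)).intervalIntegrable

theorem le_tailMarginal (hp : UnifCk k p (Icc 0 1)) {c : ℝ}
    (hc : ∀ i, ∀ x ∈ Icc (0 : Fin n → ℝ) 1, c ≤ p i x) (j : ℕ) (i : I) {x : Fin n → ℝ}
    (hx : x ∈ Icc (0 : Fin n → ℝ) 1) : c ≤ tailMarginal (p i) j x := by
  induction j generalizing x with
  | zero => exact hc i x hx
  | succ j ih =>
    by_cases hj : j < n
    · rw [tailMarginal_succ (p i) ⟨j, hj⟩ x]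
      have h := intervalIntegral.integral_mono_on (μ := volume) (a := 0) (b := 1) zero_le_one
        (intervalIntegrable_const (c := c))
        (intervalIntegrable_tailMarginal hp i j ⟨j, hj⟩ hx (left_mem_Icc.2 zero_le_one)
          (right_mem_Icc.2 zero_le_one)) fun s hs => ih (update_mem_cube hx ⟨j, hj⟩ hs)
      simpa using h
    · simpa only [_root_.tailMarginal, hj, dif_neg, not_false_eq_true] using ih hx

/-- Averaging over unit intervals preserves the lower bound `c`, so the denominators stay away from
zero. The diagonal slope is a quotient of consecutive marginals, hence at least `c / C` with `C` a
common upper bound. At `x j = 1` the numerator is the next marginal itself, which gives the value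
`1` on that face. -/
theorem triFamily_knotheMap (hp : UnifCk k p (Icc 0 1)) {c : ℝ} (hc0 : 0 < c)
    (hc : ∀ i, ∀ x ∈ Icc (0 : Fin n → ℝ) 1, c ≤ p i x) :
    TriFamily k n (fun i => knotheMap (p i)) := by
  have hu : UniqueDiffOn ℝ (Icc (0 : Fin n → ℝ) 1) := uniqueDiffOn_cube
  refine ⟨UnifCk.pi (fun j => ?_) hu, ?_, ?_, ?_, ?_⟩
  · refine UnifCk.mul (UnifCk.mul (UnifCk.of_contDiffOn (g := fun x : Fin n → ℝ => x j)
      (by fun_prop) hu isCompact_Icc) ((hp.tailMarginal j).integral_update j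
        (a := fun z => z.2 * z.1 j) (by fun_prop) fun z hz => ?_) hu)
      (UnifCk.inv hc0 (hp.tailMarginal (j + 1)) hu
        fun i x hx => le_tailMarginal hp hc (j + 1) i hx) hu
    have h1 := cube_apply hz.1 j
    exact ⟨mul_nonneg hz.2.1 h1.1, mul_le_one₀ hz.2.2 h1.1 h1.2⟩
  · intro i x hx y hy j hxy
    rw [knotheMap_eq_integral, knotheMap_eq_integral, hxy j le_rfl,
      tailMarginal_dep (p i) (j + 1) (x := x) (y := y) fun l hl => hxy l
        (by rw [Fin.le_def]; omega)]
    congr 2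
    ext s
    refine tailMarginal_dep (p i) j fun l hl => ?_
    by_cases hlj : l = j
    · subst hlj; simp
    · rw [Function.update_of_ne hlj, Function.update_of_ne hlj]
      exact hxy l hl
  · have hC : ∃ C : ℝ, 0 < C ∧ ∀ i, ∀ j : Fin n, ∀ x ∈ Icc (0 : Fin n → ℝ) 1,
        tailMarginal (p i) (j + 1) x ≤ C := by
      have : ∀ j : Fin n, ∃ C : ℝ, 0 ≤ C ∧ ∀ i, ∀ x ∈ Icc (0 : Fin n → ℝ) 1,
        ‖tailMarginal (p i) (j + 1) x‖ ≤ C := fun j => (hp.tailMarginal (j + 1)).exists_bound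
      choose C hC0 hC using this
      refine ⟨1 + ∑ j, C j, by have := Finset.sum_nonneg fun j (_ : j ∈ Finset.univ) => hC0 j
                               linarith, fun i j x hx => ?_⟩
      have h1 := (le_abs_self _).trans (hC j i x hx)
      have h2 := Finset.single_le_sum (fun j _ => hC0 j) (Finset.mem_univ j)
      linarith
    obtain ⟨C, hC0, hC⟩ := hC
    refine ⟨c * C⁻¹, by positivity, fun i x hx j b hb => ?_⟩
    have hxj := cube_apply hx j
    have hb' : b ∈ Icc (0 : ℝ) 1 := ⟨hxj.1.trans hb.1, hb.2⟩
    have h0 : (0 : ℝ) ∈ Icc (0 : ℝ) 1 := left_mem_Icc.2 zero_le_one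
    rw [knotheMap_update, knotheMap_eq_integral, ← sub_mul, intervalIntegral.integral_interval_sub_left
      (intervalIntegrable_tailMarginal hp i j j hx h0 hb')
      (intervalIntegrable_tailMarginal hp i j j hx h0 hxj)]
    have h := intervalIntegral.integral_mono_on (μ := volume) (a := x j) (b := b) hb.1
        (intervalIntegrable_const (c := c))
        (intervalIntegrable_tailMarginal hp i j j hx hxj hb') fun s hs => le_tailMarginal hp hc j i
        (update_mem_cube hx j ⟨hxj.1.trans hs.1, hs.2.trans hb.2⟩)
    rw [intervalIntegral.integral_const, smul_eq_mul] at h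
    have hm0 : 0 < tailMarginal (p i) (j + 1) x := hc0.trans_le (le_tailMarginal hp hc _ i hx)
    have h2 : C⁻¹ ≤ (tailMarginal (p i) (j + 1) x)⁻¹ := inv_anti₀ hm0 (hC i j x hx)
    have h3 : 0 ≤ (b - x j) * c := mul_nonneg (sub_nonneg.2 hb.1) hc0.le
    calc c * C⁻¹ * (b - x j) = (b - x j) * c * C⁻¹ := by ring
      _ ≤ _ := mul_le_mul h h2 (inv_pos.2 hC0).le (h3.trans h)
  · intro i x hx j hxj
    simp [knotheMap, hxj]
  · intro i x hx j hxj
    have hm0 : 0 < tailMarginal (p i) (j + 1) x := hc0.trans_le (le_tailMarginal hp hc _ i hx)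
    rw [knotheMap_eq_integral, hxj, ← tailMarginal_succ]
    exact mul_inv_cancel₀ hm0.ne'

/-- The matrix is triangular and its `j`-th diagonal entry is the quotient of the `j`-th by the
`(j+1)`-st marginal, so the product telescopes. -/
theorem det_fderivWithin_knotheMap (hp : UnifCk k p (Icc 0 1)) (hk : 1 ≤ k) {c : ℝ} (hc0 : 0 < c)
    (hc : ∀ i, ∀ x ∈ Icc (0 : Fin n → ℝ) 1, c ≤ p i x) (i : I) {x : Fin n → ℝ}
    (hx : x ∈ Icc (0 : Fin n → ℝ) 1) :
    (fderivWithin ℝ (knotheMap (p i)) (Icc 0 1) x).det = p i x / tailMarginal (p i) n x := by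
  have hT := triFamily_knotheMap hp hc0 hc
  have hA := hT.hasFDerivWithinAt hk i hx
  have hdiag : ∀ j, fderivWithin ℝ (knotheMap (p i)) (Icc 0 1) x (Pi.single j 1) j =
      tailMarginal (p i) j x / tailMarginal (p i) (j + 1) x := by
    intro j
    have hxj := cube_apply hx j
    have h1 := hA.partial_cube hx j j
    simp only [knotheMap_update] at h1
    have hcont := continuousOn_tailMarginal_update hp i j j hx
    -- The one-sided fundamental theorem of calculus, valid also at the end points, finds this
    -- membership by instance search.
    have : Fact (x j ∈ Icc (0 : ℝ) 1) := ⟨hxj⟩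
    have h2 := (intervalIntegral.integral_hasDerivWithinAt_right (a := 0) (b := x j)
      (s := Icc (0 : ℝ) 1) (t := Icc (0 : ℝ) 1)
      (intervalIntegrable_tailMarginal hp i j j hx (left_mem_Icc.2 zero_le_one) hxj)
      (hcont.stronglyMeasurableAtFilter_nhdsWithin measurableSet_Icc _)
      (hcont _ hxj)).mul_const (tailMarginal (p i) (j + 1) x)⁻¹
    rw [(uniqueDiffOn_Icc_zero_one _ hxj).eq_deriv _ h1 h2, Function.update_eq_self, div_eq_mul_inv]
  rw [ContinuousLinearMap.det_eq_prod_of_upperTriangular _ (hT.fderivWithin_lower i hx hA)]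
  simp only [hdiag]
  rw [Fin.prod_univ_eq_prod_range (fun j => tailMarginal (p i) j x / tailMarginal (p i) (j + 1) x) n]
  have htel : ∀ N, ∏ j ∈ Finset.range N, tailMarginal (p i) j x / tailMarginal (p i) (j + 1) x =
      p i x / tailMarginal (p i) N x := by
    have hpos : ∀ j, tailMarginal (p i) j x ≠ 0 := fun j =>
      (hc0.trans_le (le_tailMarginal hp hc j i hx)).ne'
    intro N
    induction N with
    | zero => exact (div_self (hpos 0)).symm
    | succ N ih => rw [Finset.prod_range_succ, ih, div_mul_div_cancel₀ (hpos N)]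
  exact htel n

theorem volume_cube : volume (Icc (0 : Fin n → ℝ) 1) = 1 := by
  rw [Real.volume_Icc_pi]
  simp

/-- The Jacobian determinant is `p / M`, with `M` the density integrated over all coordinates, so
the change of variables formula gives `M` times the uniform measure. That `M = 1` needs no Fubini
argument: both sides have the same total mass, and that of the left side is one. -/
theorem map_knotheMap (hp : UnifCk k p (Icc 0 1)) (hk : 1 ≤ k) {c : ℝ} (hc0 : 0 < c)
    (hc : ∀ i, ∀ x ∈ Icc (0 : Fin n → ℝ) 1, c ≤ p i x) (i : I)
    (hprob : IsProbabilityMeasure ((volume.restrict (Icc (0 : Fin n → ℝ) 1)).withDensity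
      fun x => ENNReal.ofReal (p i x))) :
    ((volume.restrict (Icc (0 : Fin n → ℝ) 1)).withDensity
      fun x => ENNReal.ofReal (p i x)).map (knotheMap (p i)) = volume.restrict (Icc 0 1) := by
  have hT := triFamily_knotheMap hp hc0 hc
  set M := tailMarginal (p i) n 0 with hM
  have hMx : ∀ x, tailMarginal (p i) n x = M := fun x =>
    tailMarginal_dep (p i) n fun l hl => absurd l.2 (by omega)
  have hM0 : 0 < M := hc0.trans_le (le_tailMarginal hp hc n i (left_mem_Icc.2 zero_le_one))
  have h1 := map_withDensity_abs_det_fderiv_eq_addHaar volume measurableSet_Icc.nullMeasurableSet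
    (fun x hx => hT.hasFDerivWithinAt hk i hx) (hT.injOn i)
  rw [(hT.surjOn i).image_eq_of_mapsTo (hT.mapsTo i)] at h1
  have h2 : (volume.restrict (Icc (0 : Fin n → ℝ) 1)).withDensity
      (fun x => ENNReal.ofReal (p i x)) = ENNReal.ofReal M •
      (volume.restrict (Icc (0 : Fin n → ℝ) 1)).withDensity (fun x => ENNReal.ofReal
        |(fderivWithin ℝ (knotheMap (p i)) (Icc 0 1) x).det|) := by
    rw [← withDensity_smul' _ _ ENNReal.ofReal_ne_top]
    refine withDensity_congr_ae ((ae_restrict_iff' measurableSet_Icc).2 (ae_of_all _ fun x hx => ?_))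
    rw [Pi.smul_apply, smul_eq_mul, det_fderivWithin_knotheMap hp hk hc0 hc i hx, hMx,
      ← ENNReal.ofReal_mul hM0.le, abs_of_pos (div_pos (hc0.trans_le (hc i x hx)) hM0),
      mul_div_cancel₀ _ hM0.ne']
  have h3 : ((volume.restrict (Icc (0 : Fin n → ℝ) 1)).withDensity
      (fun x => ENNReal.ofReal (p i x))).map (knotheMap (p i)) =
      ENNReal.ofReal M • volume.restrict (Icc 0 1) := by
    rw [h2, Measure.map_smul, h1]
  have hae : AEMeasurable (knotheMap (p i)) ((volume.restrict (Icc (0 : Fin n → ℝ) 1)).withDensity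
      (fun x => ENNReal.ofReal (p i x))) :=
    ((hT.unifCk.continuousOn i).aemeasurable measurableSet_Icc).mono_ac
      (withDensity_absolutelyContinuous _ _)
  have h4 := congrArg (fun μ => μ univ) h3
  simp only [Measure.map_apply_of_aemeasurable hae MeasurableSet.univ, preimage_univ,
    measure_univ, Measure.smul_apply, Measure.restrict_apply_univ, volume_cube, smul_eq_mul,
    mul_one] at h4
  rw [h3, ← h4, one_smul]

theorem map_inv_knotheMap (hp : UnifCk k p (Icc 0 1)) (hk : 1 ≤ k) {c : ℝ} (hc0 : 0 < c)
    (hc : ∀ i, ∀ x ∈ Icc (0 : Fin n → ℝ) 1, c ≤ p i x) (i : I)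
    (hprob : IsProbabilityMeasure ((volume.restrict (Icc (0 : Fin n → ℝ) 1)).withDensity
      fun x => ENNReal.ofReal (p i x))) :
    (volume.restrict (Icc 0 1)).map (TriFamily.inv (fun i => knotheMap (p i)) i) =
      (volume.restrict (Icc (0 : Fin n → ℝ) 1)).withDensity fun x => ENNReal.ofReal (p i x) := by
  have hT := triFamily_knotheMap hp hc0 hc
  have h1 := map_knotheMap hp hk hc0 hc i hprob
  have hac := withDensity_absolutelyContinuous (volume.restrict (Icc (0 : Fin n → ℝ) 1))
    (fun x => ENNReal.ofReal (p i x))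
  have hae := ((hT.unifCk.continuousOn i).aemeasurable (μ := volume) measurableSet_Icc).mono_ac hac
  have hae' := ((hT.inverse hk).unifCk.continuousOn i).aemeasurable (μ := volume) measurableSet_Icc
  set μ := (volume.restrict (Icc (0 : Fin n → ℝ) 1)).withDensity fun x => ENNReal.ofReal (p i x)
  have hid : TriFamily.inv (fun i => knotheMap (p i)) i ∘ knotheMap (p i) =ᵐ[μ] id :=
    hac.ae_le ((ae_restrict_iff' measurableSet_Icc).2 (ae_of_all _ fun x hx => hT.inv_apply i hx))
  rw [← h1] at hae' ⊢
  rw [AEMeasurable.map_map_of_aemeasurable hae' hae, Measure.map_congr hid, Measure.map_id]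

end KnotheRosenblatt

/-! ### Displacement interpolation and its Eulerian velocity field. -/

section Interpolation

variable {d k : ℕ}

/-- Adjoin the time `t` as the last coordinate. -/
def withTime (x : Fin d → ℝ) (t : ℝ) : Fin (d + 1) → ℝ := Fin.snoc (α := fun _ => ℝ) x t

/-- Forget the last coordinate. -/
def space (z : Fin (d + 1) → ℝ) : Fin d → ℝ := fun j => z j.castSucc

@[simp] theorem withTime_castSucc (x : Fin d → ℝ) (t : ℝ) (j : Fin d) :
    withTime x t j.castSucc = x j := by simp [withTime]

@[simp] theorem withTime_last (x : Fin d → ℝ) (t : ℝ) : withTime x t (Fin.last d) = t := by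
  simp [withTime]

@[simp] theorem space_withTime (x : Fin d → ℝ) (t : ℝ) : space (withTime x t) = x := by
  ext j; simp [space]

@[simp] theorem withTime_space (z : Fin (d + 1) → ℝ) : withTime (space z) (z (Fin.last d)) = z := by
  ext j
  refine Fin.lastCases ?_ (fun j => ?_) j <;> simp [space]

theorem withTime_mem_cube {x : Fin d → ℝ} {t : ℝ} :
    withTime x t ∈ Icc (0 : Fin (d + 1) → ℝ) 1 ↔ x ∈ Icc (0 : Fin d → ℝ) 1 ∧ t ∈ Icc (0 : ℝ) 1 := by
  simp only [mem_Icc, Pi.le_def, Fin.forall_fin_succ', withTime_castSucc, withTime_last,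
    Pi.zero_apply, Pi.one_apply]
  tauto

theorem space_mem_cube {z : Fin (d + 1) → ℝ} (hz : z ∈ Icc (0 : Fin (d + 1) → ℝ) 1) :
    space z ∈ Icc (0 : Fin d → ℝ) 1 := by
  rw [← withTime_space z] at hz
  exact (withTime_mem_cube.1 hz).1

theorem HasDerivWithinAt.withTime {γ : ℝ → Fin d → ℝ} {v : Fin d → ℝ} {s : Set ℝ} {t : ℝ}
    (h : HasDerivWithinAt γ v s t) :
    HasDerivWithinAt (fun τ => withTime (γ τ) τ) (_root_.withTime v 1) s t := by
  rw [hasDerivWithinAt_pi] at h ⊢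
  intro j
  refine Fin.lastCases ?_ (fun j => ?_) j
  · simp only [withTime_last]
    exact hasDerivWithinAt_id t s
  · simpa using h j

theorem UnifCk.comp_space {f : I → (Fin d → ℝ) → F} (hf : UnifCk k f (Icc 0 1)) :
    UnifCk k (fun i z => f i (space z)) (Icc (0 : Fin (d + 1) → ℝ) 1) := by
  refine hf.comp uniqueDiffOn_cube (f := fun _ z => space z) (UnifCk.of_contDiffOn ?_
    uniqueDiffOn_cube isCompact_Icc) uniqueDiffOn_cube fun i z hz => space_mem_cube hz
  unfold space
  fun_prop

/-- The displacement interpolation of two maps, with the time as last coordinate. -/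
def interpMap (G₀ G₁ : (Fin d → ℝ) → Fin d → ℝ) (z : Fin (d + 1) → ℝ) : Fin (d + 1) → ℝ :=
  withTime (fun j => (1 - z (Fin.last d)) * G₀ (space z) j + z (Fin.last d) * G₁ (space z) j)
    (z (Fin.last d))

theorem space_update_castSucc (z : Fin (d + 1) → ℝ) (j : Fin d) (b : ℝ) :
    space (Function.update z j.castSucc b) = Function.update (space z) j b := by
  ext l
  by_cases hl : l = j
  · subst hl; simp [space]
  · rw [Function.update_of_ne hl, space, Function.update_of_ne (by simpa using hl), space]

variable {G₀ G₁ : I → (Fin d → ℝ) → Fin d → ℝ}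

/-- Each condition is stable under convex combination. The time is the last coordinate, so upper
triangularity lets every component depend on it. -/
theorem triFamily_interpMap (h₀ : TriFamily k d G₀) (h₁ : TriFamily k d G₁) :
    TriFamily k (d + 1) (fun i => interpMap (G₀ i) (G₁ i)) := by
  have hu : UniqueDiffOn ℝ (Icc (0 : Fin (d + 1) → ℝ) 1) := uniqueDiffOn_cube
  refine ⟨UnifCk.pi (fun j => ?_) hu, ?_, ?_, ?_, ?_⟩
  · refine Fin.lastCases ?_ (fun j => ?_) j
    · simp only [interpMap, withTime_last]
      exact UnifCk.of_contDiffOn (g := fun z : Fin (d + 1) → ℝ => z (Fin.last d)) (by fun_prop)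
        hu isCompact_Icc
    · simp only [interpMap, withTime_castSucc]
      exact ((UnifCk.of_contDiffOn (g := fun z : Fin (d + 1) → ℝ => 1 - z (Fin.last d))
        (by fun_prop) hu isCompact_Icc).mul (h₀.unifCk.comp_space.apply hu j) hu).add
        ((UnifCk.of_contDiffOn (g := fun z : Fin (d + 1) → ℝ => z (Fin.last d))
        (by fun_prop) hu isCompact_Icc).mul (h₁.unifCk.comp_space.apply hu j) hu) hu
  · intro i x hx y hy j hxy
    have hl := hxy (Fin.last d) (Fin.le_last j)
    induction j using Fin.lastCases with
    | last => simpa [interpMap] using hl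
    | cast j =>
      have hsp : ∀ l, j ≤ l → space x l = space y l := fun l hl => hxy _ (by simpa using hl)
      simp only [interpMap, withTime_castSucc, hl]
      rw [h₀.dep i _ (space_mem_cube hx) _ (space_mem_cube hy) j hsp,
        h₁.dep i _ (space_mem_cube hx) _ (space_mem_cube hy) j hsp]
  · obtain ⟨c₀, hc₀, hm₀⟩ := h₀.mono
    obtain ⟨c₁, hc₁, hm₁⟩ := h₁.mono
    refine ⟨min 1 (min c₀ c₁), by positivity, fun i x hx j b hb => ?_⟩
    have hb0 := sub_nonneg.2 hb.1
    induction j using Fin.lastCases with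
    | last =>
      simp only [interpMap, withTime_last, Function.update_self]
      exact mul_le_of_le_one_left hb0 (min_le_left _ _)
    | cast j =>
      have ht := cube_apply hx (Fin.last d)
      simp only [interpMap, withTime_castSucc, space_update_castSucc]
      rw [Function.update_of_ne (Fin.castSucc_lt_last j).ne']
      have e₀ := hm₀ i _ (space_mem_cube hx) j b hb
      have e₁ := hm₁ i _ (space_mem_cube hx) j b hb
      change c₀ * (b - x j.castSucc) ≤ _ at e₀
      change c₁ * (b - x j.castSucc) ≤ _ at e₁
      set t := x (Fin.last d)
      have f₀ : min 1 (min c₀ c₁) * (b - x j.castSucc) ≤ c₀ * (b - x j.castSucc) :=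
        mul_le_mul_of_nonneg_right ((min_le_right _ _).trans (min_le_left _ _)) hb0
      have f₁ : min 1 (min c₀ c₁) * (b - x j.castSucc) ≤ c₁ * (b - x j.castSucc) :=
        mul_le_mul_of_nonneg_right ((min_le_right _ _).trans (min_le_right _ _)) hb0
      have g₀ := mul_le_mul_of_nonneg_left (f₀.trans e₀) (sub_nonneg.2 ht.2)
      have g₁ := mul_le_mul_of_nonneg_left (f₁.trans e₁) ht.1
      linarith
  · intro i x hx j hj
    induction j using Fin.lastCases with
    | last => simpa [interpMap] using hj
    | cast j =>
      simp only [interpMap, withTime_castSucc]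
      rw [h₀.face_zero i _ (space_mem_cube hx) j hj, h₁.face_zero i _ (space_mem_cube hx) j hj]
      ring
  · intro i x hx j hj
    induction j using Fin.lastCases with
    | last => simpa [interpMap] using hj
    | cast j =>
      simp only [interpMap, withTime_castSucc]
      rw [h₀.face_one i _ (space_mem_cube hx) j hj, h₁.face_one i _ (space_mem_cube hx) j hj]
      ring

/-- The velocity field of the displacement interpolation in Eulerian coordinates. -/
def interpVelocity (G₀ G₁ : I → (Fin d → ℝ) → Fin d → ℝ) (i : I) (z : Fin (d + 1) → ℝ) :
    Fin d → ℝ :=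
  G₁ i (space (TriFamily.inv (fun i => interpMap (G₀ i) (G₁ i)) i z)) -
    G₀ i (space (TriFamily.inv (fun i => interpMap (G₀ i) (G₁ i)) i z))

theorem unifCk_interpVelocity (h₀ : TriFamily k d G₀) (h₁ : TriFamily k d G₁) (hk : 1 ≤ k) :
    UnifCk k (interpVelocity G₀ G₁) (Icc 0 1) := by
  have hT := triFamily_interpMap h₀ h₁
  have hu : UniqueDiffOn ℝ (Icc (0 : Fin (d + 1) → ℝ) 1) := uniqueDiffOn_cube
  exact (h₁.unifCk.comp_space.comp hu (hT.inverse hk).unifCk hu hT.inv_mapsTo).sub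
    (h₀.unifCk.comp_space.comp hu (hT.inverse hk).unifCk hu hT.inv_mapsTo) hu

/-- Inverting the space-time map at a point of the line recovers its label `u`; hence the velocity
is constant along the line. -/
theorem interpVelocity_interpMap (h₀ : TriFamily k d G₀) (h₁ : TriFamily k d G₁) (i : I)
    {u : Fin d → ℝ} (hu : u ∈ Icc (0 : Fin d → ℝ) 1) {t : ℝ} (ht : t ∈ Icc (0 : ℝ) 1) :
    interpVelocity G₀ G₁ i (withTime ((1 - t) • G₀ i u + t • G₁ i u) t) = G₁ i u - G₀ i u := by
  have hT := triFamily_interpMap h₀ h₁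
  have h := hT.inv_apply i (withTime_mem_cube.2 ⟨hu, ht⟩)
  have h2 : interpMap (G₀ i) (G₁ i) (withTime u t) =
      withTime ((1 - t) • G₀ i u + t • G₁ i u) t := by
    simp only [interpMap, withTime_last, space_withTime]
    rfl
  change TriFamily.inv _ i (interpMap (G₀ i) (G₁ i) (withTime u t)) = _ at h
  rw [h2] at h
  rw [interpVelocity, h, space_withTime]

theorem interp_mem_cube (h₀ : TriFamily k d G₀) (h₁ : TriFamily k d G₁) (i : I)
    {u : Fin d → ℝ} (hu : u ∈ Icc (0 : Fin d → ℝ) 1) {t : ℝ} (ht : t ∈ Icc (0 : ℝ) 1) :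
    (1 - t) • G₀ i u + t • G₁ i u ∈ Icc (0 : Fin d → ℝ) 1 :=
  convex_cube (h₀.mapsTo i hu) (h₁.mapsTo i hu) (sub_nonneg.2 ht.2) ht.1 (by ring)

theorem hasDerivWithinAt_interp (h₀ : TriFamily k d G₀) (h₁ : TriFamily k d G₁) (i : I)
    {u : Fin d → ℝ} (hu : u ∈ Icc (0 : Fin d → ℝ) 1) {t : ℝ} (ht : t ∈ Icc (0 : ℝ) 1) :
    HasDerivWithinAt (fun t => (1 - t) • G₀ i u + t • G₁ i u)
      (interpVelocity G₀ G₁ i (withTime ((1 - t) • G₀ i u + t • G₁ i u) t)) (Icc 0 1) t := by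
  rw [interpVelocity_interpMap h₀ h₁ i hu ht]
  have h1 := (((hasDerivAt_id t).const_sub 1).smul_const (G₀ i u)).add
    ((hasDerivAt_id t).smul_const (G₁ i u))
  refine (h1.congr_deriv ?_).hasDerivWithinAt
  rw [neg_smul, one_smul, one_smul]
  abel

theorem exists_interp_eq (h₀ : TriFamily k d G₀) (h₁ : TriFamily k d G₁) (i : I)
    {z : Fin (d + 1) → ℝ} (hz : z ∈ Icc (0 : Fin (d + 1) → ℝ) 1) :
    ∃ u ∈ Icc (0 : Fin d → ℝ) 1, ∃ t ∈ Icc (0 : ℝ) 1,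
      z = withTime ((1 - t) • G₀ i u + t • G₁ i u) t := by
  have hT := triFamily_interpMap h₀ h₁
  have hw := hT.inv_mapsTo i hz
  refine ⟨_, space_mem_cube hw, _, cube_apply hw (Fin.last d), ?_⟩
  exact (hT.apply_inv i hz).symm

/-- The label of a point on a face lies on the same face, and `G₀` and `G₁` both fix the
corresponding coordinate. -/
theorem interpVelocity_face (h₀ : TriFamily k d G₀) (h₁ : TriFamily k d G₁) (hk : 1 ≤ k) (i : I)
    {z : Fin (d + 1) → ℝ} (hz : z ∈ Icc (0 : Fin (d + 1) → ℝ) 1) (j : Fin d)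
    (hj : z j.castSucc = 0 ∨ z j.castSucc = 1) : interpVelocity G₀ G₁ i z j = 0 := by
  have hT := (triFamily_interpMap h₀ h₁).inverse hk
  have hw := space_mem_cube (hT.mapsTo i hz)
  rw [interpVelocity, Pi.sub_apply]
  rcases hj with hj | hj
  · have h := hT.face_zero i z hz _ hj
    rw [h₁.face_zero i _ hw j h, h₀.face_zero i _ hw j h, sub_zero]
  · have h := hT.face_one i z hz _ hj
    rw [h₁.face_one i _ hw j h, h₀.face_one i _ hw j h, sub_self]

/-- Vanishing acceleration: every point of the space-time cube lies on one of the lines, and the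
derivative of the field along that line is the derivative of a constant. -/
theorem fderivWithin_interpVelocity (h₀ : TriFamily k d G₀) (h₁ : TriFamily k d G₁) (hk : 1 ≤ k)
    (i : I) {z : Fin (d + 1) → ℝ} (hz : z ∈ Icc (0 : Fin (d + 1) → ℝ) 1) :
    fderivWithin ℝ (interpVelocity G₀ G₁ i) (Icc 0 1) z
      (withTime (interpVelocity G₀ G₁ i z) 1) = 0 := by
  obtain ⟨u, hu, t, ht, rfl⟩ := exists_interp_eq h₀ h₁ i hz
  have hd : HasFDerivWithinAt (interpVelocity G₀ G₁ i) _ (Icc 0 1) _ :=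
    ((((unifCk_interpVelocity h₀ h₁ hk).contDiffOn i).differentiableOn
      (by norm_cast; omega)) _ hz).hasFDerivWithinAt
  have h1 := hd.comp_hasDerivWithinAt (f := fun τ => withTime ((1 - τ) • G₀ i u + τ • G₁ i u) τ) t
    (hasDerivWithinAt_interp h₀ h₁ i hu ht).withTime (fun τ (hτ : τ ∈ Icc (0 : ℝ) 1) => withTime_mem_cube.2 ⟨interp_mem_cube h₀ h₁ i hu hτ, hτ⟩)
  refine (uniqueDiffOn_Icc_zero_one _ ht).eq_deriv _ h1 ?_
  exact (hasDerivWithinAt_const t _ (G₁ i u - G₀ i u)).congr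
    (fun τ hτ => interpVelocity_interpMap h₀ h₁ i hu hτ)
    (interpVelocity_interpMap h₀ h₁ i hu ht)

/-- `q` is the density on the cube of a probability measure, is at least `c`, and has `C^k` norm at
most `C`. -/
structure CubeDensity (k : ℕ) (C c : ℝ) (q : (Fin d → ℝ) → ℝ) : Prop where
  contDiffOn : ContDiffOn ℝ k q (Icc 0 1)
  bound : ∀ m ≤ k, ∀ x ∈ Icc (0 : Fin d → ℝ) 1, ‖iteratedFDerivWithin ℝ m q (Icc 0 1) x‖ ≤ C
  lower : ∀ x ∈ Icc (0 : Fin d → ℝ) 1, c ≤ q x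
  prob : IsProbabilityMeasure ((volume.restrict (Icc (0 : Fin d → ℝ) 1)).withDensity
      fun x => ENNReal.ofReal (q x))

/-- The exact solution of the transport problem. The constant `M` is chosen before the densities,
which is the uniformity that the network sizes require. -/
theorem exists_transport_velocity (hk : 1 ≤ k) (C : ℝ) {c : ℝ} (hc : 0 < c) :
    ∃ M : ℝ, ∀ q₀ q₁ : (Fin d → ℝ) → ℝ, CubeDensity k C c q₀ → CubeDensity k C c q₁ →
      ∃ (f : (Fin (d + 1) → ℝ) → Fin d → ℝ) (X : (Fin d → ℝ) → ℝ → Fin d → ℝ),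
        ContDiffOn ℝ k f (Icc 0 1) ∧
        (∀ m ≤ k, ∀ z ∈ Icc (0 : Fin (d + 1) → ℝ) 1,
          ‖iteratedFDerivWithin ℝ m f (Icc 0 1) z‖ ≤ M) ∧
        (∀ z ∈ Icc (0 : Fin (d + 1) → ℝ) 1, ∀ j : Fin d,
          z j.castSucc = 0 ∨ z j.castSucc = 1 → f z j = 0) ∧
        (∀ z ∈ Icc (0 : Fin (d + 1) → ℝ) 1,
          fderivWithin ℝ f (Icc 0 1) z (withTime (f z) 1) = 0) ∧
        (∀ x ∈ Icc (0 : Fin d → ℝ) 1, X x 0 = x ∧ ∀ t ∈ Icc (0 : ℝ) 1,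
          X x t ∈ Icc (0 : Fin d → ℝ) 1 ∧
          HasDerivWithinAt (X x) (f (withTime (X x t) t)) (Icc 0 1) t) ∧
        ContinuousOn (fun x => X x 1) (Icc 0 1) ∧
        ((volume.restrict (Icc (0 : Fin d → ℝ) 1)).withDensity
          fun x => ENNReal.ofReal (q₀ x)).map (fun x => X x 1) =
          (volume.restrict (Icc (0 : Fin d → ℝ) 1)).withDensity
            fun x => ENNReal.ofReal (q₁ x) := by
  -- All admissible densities form a single family, and all pairs of them another, so one
  -- application of the family calculus yields bounds common to all.
  let I := {q : (Fin d → ℝ) → ℝ // CubeDensity k C c q}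
  have hp : UnifCk k (fun i : I => i.1) (Icc 0 1) := ⟨C, fun i => ⟨i.2.contDiffOn, i.2.bound⟩⟩
  have hlow : ∀ i : I, ∀ x ∈ Icc (0 : Fin d → ℝ) 1, c ≤ i.1 x := fun i => i.2.lower
  have hK := triFamily_knotheMap hp hc hlow
  have hKi := hK.inverse hk
  let G := TriFamily.inv (fun i : I => knotheMap i.1)
  have hG₀ : TriFamily k d (fun i : I × I => G i.1) :=
    ⟨hKi.unifCk.reindex _, fun i => hKi.dep i.1, let ⟨a, ha, h⟩ := hKi.mono; ⟨a, ha, fun i => h i.1⟩,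
      fun i => hKi.face_zero i.1, fun i => hKi.face_one i.1⟩
  have hG₁ : TriFamily k d (fun i : I × I => G i.2) :=
    ⟨hKi.unifCk.reindex _, fun i => hKi.dep i.2, let ⟨a, ha, h⟩ := hKi.mono; ⟨a, ha, fun i => h i.2⟩,
      fun i => hKi.face_zero i.2, fun i => hKi.face_one i.2⟩
  have hf := unifCk_interpVelocity hG₀ hG₁ hk
  obtain ⟨M, hM⟩ := hf
  refine ⟨M, fun q₀ q₁ h₀ h₁ => ?_⟩
  let i : I × I := (⟨q₀, h₀⟩, ⟨q₁, h₁⟩)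
  -- The starting point `x` has label `knotheMap q₀ x`; at time one the flow is the composition that
  -- passes from `q₀` to the uniform density and on to `q₁`.
  have hX1 : (fun x => (1 - (1 : ℝ)) • G i.1 (knotheMap q₀ x) + (1 : ℝ) • G i.2 (knotheMap q₀ x)) =
      G i.2 ∘ knotheMap q₀ := by
    ext1 x; simp
  have hcont : ContinuousOn (G i.2 ∘ knotheMap q₀) (Icc 0 1) :=
    (hKi.unifCk.continuousOn i.2).comp (hK.unifCk.continuousOn i.1) (hK.mapsTo i.1)
  refine ⟨interpVelocity (fun i : I × I => G i.1) (fun i : I × I => G i.2) i,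
    fun x t => (1 - t) • G i.1 (knotheMap q₀ x) + t • G i.2 (knotheMap q₀ x),
    (hM i).1, (hM i).2, fun z hz j hj => interpVelocity_face hG₀ hG₁ hk i hz j hj,
    fun z hz => fderivWithin_interpVelocity hG₀ hG₁ hk i hz, fun x hx => ⟨?_, fun t ht =>
      ⟨interp_mem_cube hG₀ hG₁ i (hK.mapsTo i.1 hx) ht,
        hasDerivWithinAt_interp hG₀ hG₁ i (hK.mapsTo i.1 hx) ht⟩⟩, ?_, ?_⟩
  · simpa using hK.inv_apply i.1 hx
  · rw [hX1]
    exact hcont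
  · rw [hX1]
    have e₀ := map_knotheMap hp hk hc hlow i.1 h₀.prob
    have e₁ := map_inv_knotheMap hp hk hc hlow i.2 h₁.prob
    have hae := ((hK.unifCk.continuousOn i.1).aemeasurable (μ := volume) measurableSet_Icc).mono_ac
      (withDensity_absolutelyContinuous _ (fun x => ENNReal.ofReal (q₀ x)))
    have hae' := (hKi.unifCk.continuousOn i.2).aemeasurable (μ := volume) measurableSet_Icc
    rw [← e₀] at hae'
    rw [← AEMeasurable.map_map_of_aemeasurable hae' hae]
    exact (congrArg _ e₀).trans e₁

end Interpolation

end UniformFamilies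

/-! ### Exact computation of sums of products by ReLU² networks. -/

section ProductNetwork

/-- The scalar activation `max{0,s}²`. -/
def relu2 (s : ℝ) : ℝ := (max 0 s) ^ 2

theorem relu2_add_relu2_neg (s : ℝ) : relu2 s + relu2 (-s) = s ^ 2 := by
  rcases le_total 0 s with h | h
  · simp [relu2, h]
  · simp [relu2, h]

/-- Output weights of a group of four neurons. -/
def quadSign : Fin 4 → ℝ := ![1 / 4, -1 / 4, 1 / 4, -1 / 4]

def quadLeft : Fin 4 → ℝ := ![1, 1, -1, -1]

def quadRight : Fin 4 → ℝ := ![1, -1, -1, 1]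

/-- Polarization, `4xy = (x + y)² - (x - y)²`, with each square split into the activation at `s` and
at `-s`. -/
theorem sum_quad_mul (x y : ℝ) :
    ∑ r, quadSign r * relu2 (quadLeft r * x + quadRight r * y) = x * y := by
  have h1 := relu2_add_relu2_neg (x + y)
  have h2 := relu2_add_relu2_neg (x - y)
  simp only [Fin.sum_univ_four, quadSign, quadLeft, quadRight, Matrix.cons_val]
  rw [show -1 * x + -1 * y = -(x + y) by ring, show -1 * x + 1 * y = -(x - y) by ring,
    show 1 * x + 1 * y = x + y by ring, show 1 * x + -1 * y = x - y by ring]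
  linarith [show (x + y) ^ 2 - (x - y) ^ 2 = 4 * (x * y) by ring]

theorem abs_quadSign (r : Fin 4) : |quadSign r| = 1 / 4 := by
  fin_cases r <;> norm_num [quadSign, abs_of_pos, abs_of_neg]

theorem abs_quadLeft (r : Fin 4) : |quadLeft r| = 1 := by
  fin_cases r <;> norm_num [quadLeft]

theorem abs_quadRight (r : Fin 4) : |quadRight r| = 1 := by
  fin_cases r <;> norm_num [quadRight]

variable {M : ℕ} [NeZero M]

/-- One level of a binary tree of products. -/
def treeStep (x : Fin M → ℝ) (q : Fin M) : ℝ :=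
  x (Fin.ofNat M (2 * q)) * x (Fin.ofNat M (2 * q + 1))

/-- All levels keep `M` nodes so that the hidden layers can be identical. Indices are read modulo
`M`; the condition on `i` selects the nodes whose leaves have not wrapped around. -/
theorem treeStep_iterate (x : Fin M → ℝ) (l i : ℕ) (hi : (i + 1) * 2 ^ l ≤ M) :
    treeStep^[l] x (Fin.ofNat M i) =
      ∏ q ∈ Finset.range (2 ^ l), x (Fin.ofNat M (i * 2 ^ l + q)) := by
  induction l generalizing i with
  | zero => simp
  | succ l ih =>
    have h2 : (i + 1) * 2 ^ (l + 1) = (2 * i + 1 + 1) * 2 ^ l := by ring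
    have hpos := Nat.one_le_two_pow (n := l)
    have hlt : i < M := by nlinarith [Nat.one_le_two_pow (n := l + 1)]
    have hval : ((Fin.ofNat M i : Fin M) : ℕ) = i := by simp [Fin.ofNat, Nat.mod_eq_of_lt hlt]
    rw [Function.iterate_succ_apply', treeStep, hval, ih _ (by nlinarith), ih _ (by linarith),
      pow_succ, mul_two, Finset.prod_range_add]
    congr 1
    · exact Finset.prod_congr rfl fun q _ => by congr 2; ring
    · exact Finset.prod_congr rfl fun q _ => by congr 2; ring

theorem treeStep_iterate_prod {m : ℕ} (x : Fin (2 ^ m) → ℝ) :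
    treeStep^[m] x 0 = ∏ q, x q := by
  have h := treeStep_iterate x m 0 (by simp)
  rw [← Fin.prod_univ_eq_prod_range (fun q => x (Fin.ofNat (2 ^ m) (0 * 2 ^ m + q)))] at h
  refine Eq.trans ?_ (h.trans ?_)
  · rfl
  · exact Finset.prod_congr rfl fun q _ => by
      congr 1
      ext
      simp [Fin.ofNat, Nat.mod_eq_of_lt q.2]

variable {T : Type} [Fintype T] {D d W : ℕ}

theorem AffineLayer.apply_reindex {ι κ : Type} [Fintype ι] {n m : ℕ} (e : ι ≃ Fin n)
    (e' : κ ≃ Fin m) (w : κ → ι → ℝ) (z : ι → ℝ) :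
    AffineLayer.apply ⟨Matrix.of fun i j => w (e'.symm i) (e.symm j), 0⟩ (fun i => z (e.symm i)) =
      fun i => ∑ a, w (e'.symm i) a * z a := by
  ext i
  simp only [AffineLayer.apply, add_zero, Matrix.mulVec, dotProduct, Matrix.of_apply]
  exact Fintype.sum_equiv e.symm _ _ fun _ => rfl

open Classical in
/-- The weights of a level of products, for neurons indexed by term, sign pattern and node. -/
def treeWeight (a b : T × Fin 4 × Fin M) : ℝ :=
  if a.1 = b.1 then quadSign b.2.1 *
    ((if b.2.2 = Fin.ofNat M (2 * a.2.2) then quadLeft a.2.1 else 0) +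
      if b.2.2 = Fin.ofNat M (2 * a.2.2 + 1) then quadRight a.2.1 else 0) else 0

omit [Fintype T] in
theorem abs_treeWeight_le (a b : T × Fin 4 × Fin M) : |treeWeight a b| ≤ 1 := by
  unfold treeWeight
  split_ifs <;> simp only [abs_mul, abs_quadSign, add_zero, zero_add, abs_quadLeft, abs_quadRight,
    abs_zero] <;> try norm_num
  -- If the two children coincide modulo `M`, both indicators contribute, and the weight is still at
  -- most `2 / 4`.
  have := abs_add_le (quadLeft a.2.1) (quadRight a.2.1)
  rw [abs_quadLeft, abs_quadRight] at this
  linarith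

theorem sum_treeWeight (z : T × Fin 4 × Fin M → ℝ) (a : T × Fin 4 × Fin M) :
    ∑ b, treeWeight a b * z b =
      quadLeft a.2.1 * ∑ r, quadSign r * z (a.1, r, Fin.ofNat M (2 * a.2.2)) +
      quadRight a.2.1 * ∑ r, quadSign r * z (a.1, r, Fin.ofNat M (2 * a.2.2 + 1)) := by
  classical
  simp only [treeWeight, Fintype.sum_prod_type, ite_mul, zero_mul]
  rw [Finset.sum_eq_single a.1 (fun t _ ht => by simp [ht.symm]) (by simp)]
  simp only [if_true, mul_add, add_mul, Finset.sum_add_distrib, mul_ite, mul_zero, ite_mul,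
    zero_mul, Finset.sum_ite_eq', Finset.mem_univ, Finset.mul_sum]
  congr 1 <;> exact Finset.sum_congr rfl fun r _ => by ring

/-- A number is carried by four neurons and decoded by the weights `quadSign`. A hidden layer
decodes the two children of a node and feeds `±x ± y` to the next four neurons, whose decoded value
is the product. After `m` such layers node `0` holds the whole product. Different terms do not
interact, which keeps the number of parameters linear in `Fintype.card T`. -/
theorem exists_product_network {B : ℝ} (hB : 1 ≤ B) {m : ℕ} (w : T → Fin (2 ^ m) → Fin 4 → Fin D → ℝ)
    (b : T → Fin (2 ^ m) → Fin 4 → ℝ) (c : Fin d → T → ℝ) (hw : ∀ t q r j, |w t q r j| ≤ B)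
    (hb : ∀ t q r, |b t q r| ≤ B) (hc : ∀ j t, |c j t| ≤ B) :
    (fun z j => ∑ t, c j t * ∏ q, ∑ r, quadSign r * relu2 (∑ l, w t q r l * z l + b t q r)) ∈
      reluSqClass D d (m + 2) (Fintype.card T * (4 * 2 ^ m))
        (Fintype.card T * (4 * 2 ^ m * (D + 1) + m * (4 * 2 ^ m) ^ 2 + d * (4 * 2 ^ m))) B := by
  classical
  have hcard : Fintype.card (T × Fin 4 × Fin (2 ^ m)) = Fintype.card T * (4 * 2 ^ m) := by simp
  let e : T × Fin 4 × Fin (2 ^ m) ≃ Fin (Fintype.card T * (4 * 2 ^ m)) := Fintype.equivFinOfCardEq hcard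
  let Lin : AffineLayer D (Fintype.card T * (4 * 2 ^ m)) :=
    ⟨Matrix.of fun i j => w (e.symm i).1 (e.symm i).2.2 (e.symm i).2.1 j,
      fun i => b (e.symm i).1 (e.symm i).2.2 (e.symm i).2.1⟩
  let Lhid : AffineLayer (Fintype.card T * (4 * 2 ^ m)) (Fintype.card T * (4 * 2 ^ m)) :=
    ⟨Matrix.of fun i j => treeWeight (e.symm i) (e.symm j), 0⟩
  let wo : Fin d → T × Fin 4 × Fin (2 ^ m) → ℝ := fun j a =>
    if a.2.2 = 0 then c j a.1 * quadSign a.2.1 else 0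
  let Lout : AffineLayer (Fintype.card T * (4 * 2 ^ m)) d :=
    ⟨Matrix.of fun i j => wo ((Equiv.refl _).symm i) (e.symm j), 0⟩
  have hLin : ∀ z, Lin.apply z = fun i => (fun a : T × Fin 4 × Fin (2 ^ m) =>
      ∑ l, w a.1 a.2.2 a.2.1 l * z l + b a.1 a.2.2 a.2.1) (e.symm i) := fun z => rfl
  refine ⟨⟨Lin, List.replicate m Lhid, Lout⟩, by simp [ReLUSqNetwork.depth], ?_, ?_, ?_⟩
  · have h1 : Lin.numNonzero ≤ Fintype.card T * (4 * 2 ^ m) * D + Fintype.card T * (4 * 2 ^ m) := by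
      refine add_le_add ((Finset.card_filter_le _ _).trans ?_) ((Finset.card_filter_le _ _).trans ?_)
      · simp
      · simp
    have h2 : Lhid.numNonzero ≤ Fintype.card T * (4 * 2 ^ m) ^ 2 := by
      have hb0 : (Finset.univ.filter fun i => Lhid.bias i ≠ 0).card = 0 := by simp [Lhid]
      rw [AffineLayer.numNonzero]
      simp only [Lhid] at hb0 ⊢
      rw [hb0, add_zero]
      have hc2 : Fintype.card T * (4 * 2 ^ m) ^ 2 = (Finset.univ :
          Finset (T × (Fin 4 × Fin (2 ^ m)) × (Fin 4 × Fin (2 ^ m)))).card := by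
        simp [pow_two]
      rw [hc2]
      refine Finset.card_le_card_of_injOn
        (fun ij => ((e.symm ij.1).1, (e.symm ij.1).2, (e.symm ij.2).2)) (by simp) ?_
      -- A nonzero hidden weight joins neurons of the same term, so a pair of neurons is determined
      -- by one term and two positions within it.
      have hne : ∀ i j, treeWeight (e.symm i) (e.symm j) ≠ 0 → (e.symm i).1 = (e.symm j).1 := by
        intro i j hij
        by_contra hne
        exact hij (by simp [treeWeight, hne])
      rintro ⟨i, j⟩ hij ⟨i', j'⟩ hij' h
      replace hij := (Finset.mem_filter.1 (Finset.mem_coe.1 hij)).2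
      replace hij' := (Finset.mem_filter.1 (Finset.mem_coe.1 hij')).2
      simp only [Prod.mk.injEq] at h ⊢
      have hi : e.symm i = e.symm i' := Prod.ext h.1 h.2.1
      have hj : e.symm j = e.symm j' :=
        Prod.ext ((hne _ _ hij).symm.trans (h.1.trans (hne _ _ hij'))) h.2.2
      exact ⟨e.symm.injective hi, e.symm.injective hj⟩
    have h3 : Lout.numNonzero ≤ d * (Fintype.card T * (4 * 2 ^ m)) := by
      have hb0 : (Finset.univ.filter fun i => Lout.bias i ≠ 0).card = 0 := by simp [Lout]
      rw [AffineLayer.numNonzero]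
      simp only [Lout] at hb0 ⊢
      rw [hb0, add_zero]
      refine (Finset.card_filter_le _ _).trans ?_
      simp
    have h4 : ((List.replicate m Lhid).map AffineLayer.numNonzero).sum ≤
        m * (Fintype.card T * (4 * 2 ^ m) ^ 2) := by
      rw [List.map_replicate, List.sum_replicate, smul_eq_mul]
      exact Nat.mul_le_mul_left _ h2
    calc _ ≤ _ := add_le_add (add_le_add h1 h4) h3
      _ = _ := by ring
  · refine ⟨⟨fun i j => hw _ _ _ _, fun i => hb _ _ _⟩, fun A hA => ?_, ⟨fun i j => ?_, fun i => ?_⟩⟩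
    · rw [List.eq_of_mem_replicate hA]
      exact ⟨fun i j => (abs_treeWeight_le _ _).trans hB, fun i => by simp [Lhid]; linarith⟩
    · simp only [Lout, wo, Matrix.of_apply]
      split_ifs
      · rw [abs_mul, abs_quadSign]
        have := hc ((Equiv.refl _).symm i) (e.symm j).1
        linarith [abs_nonneg (c ((Equiv.refl _).symm i) (e.symm j).1)]
      · rw [abs_zero]; linarith
    · simp [Lout]; linarith
  · ext z j
    -- The decoded content of a layer with preactivations `u`; on it a hidden layer acts as
    -- `treeStep`.
    let v : (T × Fin 4 × Fin (2 ^ m) → ℝ) → T → Fin (2 ^ m) → ℝ := fun u t q =>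
      ∑ r, quadSign r * relu2 (u (t, r, q))
    have hstep : ∀ u : T × Fin 4 × Fin (2 ^ m) → ℝ, ∃ u' : T × Fin 4 × Fin (2 ^ m) → ℝ,
        Lhid.apply (reluSq fun i => u (e.symm i)) = (fun i => u' (e.symm i)) ∧
        ∀ t, v u' t = treeStep (v u t) := by
      intro u
      refine ⟨fun a => quadLeft a.2.1 * v u a.1 (Fin.ofNat _ (2 * a.2.2)) +
        quadRight a.2.1 * v u a.1 (Fin.ofNat _ (2 * a.2.2 + 1)), ?_, fun t => ?_⟩
      · refine (AffineLayer.apply_reindex e e treeWeight (fun a => relu2 (u a))).trans ?_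
        ext i
        exact sum_treeWeight (fun a => relu2 (u a)) (e.symm i)
      · ext q
        exact sum_quad_mul _ _
    have hfold : ∀ (l : ℕ) (u : T × Fin 4 × Fin (2 ^ m) → ℝ), ∃ u' : T × Fin 4 × Fin (2 ^ m) → ℝ,
        (List.replicate l Lhid).foldl (fun z A => A.apply (reluSq z)) (fun i => u (e.symm i)) =
          (fun i => u' (e.symm i)) ∧ ∀ t, v u' t = treeStep^[l] (v u t) := by
      intro l
      induction l with
      | zero => exact fun u => ⟨u, rfl, fun t => rfl⟩
      | succ l ih =>
        intro u
        obtain ⟨u₁, h1, h2⟩ := hstep u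
        obtain ⟨u₂, h3, h4⟩ := ih u₁
        refine ⟨u₂, ?_, fun t => ?_⟩
        · rw [List.replicate_succ, List.foldl_cons, h1, h3]
        · rw [h4, h2, Function.iterate_succ_apply]
    obtain ⟨u, h1, h2⟩ := hfold m (fun a => ∑ l, w a.1 a.2.2 a.2.1 l * z l + b a.1 a.2.2 a.2.1)
    rw [ReLUSqNetwork.eval]
    simp only
    rw [hLin, h1]
    have h3 := AffineLayer.apply_reindex e (Equiv.refl (Fin d)) wo (fun a => relu2 (u a))
    refine (congrFun h3 j).trans ?_
    simp only [wo, Equiv.refl_symm, Equiv.refl_apply, Fintype.sum_prod_type]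
    refine Finset.sum_congr rfl fun t _ => ?_
    have h4 : ∏ q, v (fun a => ∑ l, w a.1 a.2.2 a.2.1 l * z l + b a.1 a.2.2 a.2.1) t q =
        v u t 0 := by
      rw [h2, treeStep_iterate_prod]
    simp only [v] at h4
    rw [h4, Finset.mul_sum]
    refine Finset.sum_congr rfl fun r _ => ?_
    simp only [ite_mul, zero_mul, Finset.sum_ite_eq', Finset.mem_univ, if_true]
    ring

end ProductNetwork

/-! ### Taylor polynomials with derivatives taken within a closed set. -/

section Taylor

variable {E : Type} [NormedAddCommGroup E] [NormedSpace ℝ E]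
  {F : Type} [NormedAddCommGroup F] [NormedSpace ℝ F] {s : Set E}

/-- The part of the symmetry of higher derivatives that differentiating `z ↦ Dᵐf(z - a, …, z - a)`
uses: the exceptional argument may be moved to the slot that is differentiated first. The induction
reduces to exchanging the two arguments of the second derivative, which is symmetric at points of
the closure of the interior. -/
theorem iteratedFDerivWithin_succ_update (hs : UniqueDiffOn ℝ s) (hsc : s ⊆ closure (interior s))
    {m : ℕ} {f : E → F} (hf : ContDiffOn ℝ (m + 1) f s) {x : E} (hx : x ∈ s) (v w : E)
    (i : Fin (m + 1)) :
    iteratedFDerivWithin ℝ (m + 1) f s x (Function.update (fun _ => w) i v) =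
      iteratedFDerivWithin ℝ m (fderivWithin ℝ f s) s x (fun _ => w) v := by
  induction m generalizing F with
  | zero =>
    obtain rfl : i = 0 := by ext; omega
    rw [iteratedFDerivWithin_succ_apply_right hs hx]
    simp
  | succ m ih =>
    rw [iteratedFDerivWithin_succ_apply_right hs hx]
    induction i using Fin.lastCases with
    | last =>
      congr 2
      · ext q
        simp [Fin.init]
      · simp
    | cast i =>
      have hf1 : ContDiffOn ℝ (m + 1) (fderivWithin ℝ f s) s := hf.fderivWithin hs (by norm_cast)
      have hf2 : ContDiffOn ℝ m (fderivWithin ℝ (fderivWithin ℝ f s) s) s :=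
        hf1.fderivWithin hs (by norm_cast)
      have hinit : Fin.init (Function.update (fun _ : Fin (m + 1 + 1) => w) i.castSucc v) =
          Function.update (fun _ => w) i v := by
        ext q
        by_cases hq : q = i
        · subst hq; simp [Fin.init]
        · simp [Fin.init, hq]
      rw [hinit, Function.update_of_ne (Fin.castSucc_lt_last i).ne', ih hf1 i,
        iteratedFDerivWithin_succ_apply_right hs hx]
      -- The exchange of two arguments as a continuous linear map, so that it commutes with the
      -- remaining `m` derivatives.
      let L : (E →L[ℝ] E →L[ℝ] F) →L[ℝ] (E →L[ℝ] E →L[ℝ] F) :=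
        (ContinuousLinearMap.flipₗᵢ ℝ E E F).toContinuousLinearEquiv.toContinuousLinearMap
      have hL : ∀ A v w, L A v w = A w v := fun A v w => rfl
      have hsymm : EqOn (fderivWithin ℝ (fderivWithin ℝ f s) s)
          (L ∘ fderivWithin ℝ (fderivWithin ℝ f s) s) s := by
        intro y hy
        ext v w
        rw [Function.comp_apply, hL]
        refine (hf y hy).isSymmSndFDerivWithinAt ?_ hs (hsc hy) hy v w
        rw [minSmoothness_of_isRCLikeNormedField]
        norm_cast
        omega
      have h1 := iteratedFDerivWithin_congr (𝕜 := ℝ) hsymm hx m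
      rw [ContinuousLinearMap.iteratedFDerivWithin_comp_left (𝕜 := ℝ) (F := E →L[ℝ] E →L[ℝ] F)
        (G := E →L[ℝ] E →L[ℝ] F) (f := fderivWithin ℝ (fderivWithin ℝ f s) s) L (hf2 x hx) hs hx
        le_rfl] at h1
      conv_lhs => rw [h1]
      rfl

/-- The Taylor polynomial at `a` of degree `n - 1`, with derivatives taken within `s`. -/
def taylorPoly (n : ℕ) (f : E → F) (s : Set E) (a z : E) : F :=
  ∑ m ∈ Finset.range n, ((m.factorial : ℝ)⁻¹) • iteratedFDerivWithin ℝ m f s a (fun _ => z - a)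

theorem taylorPoly_self (n : ℕ) (f : E → F) (a : E) : taylorPoly (n + 1) f s a a = f a := by
  rw [taylorPoly, Finset.sum_range_succ']
  simp only [sub_self, Nat.factorial_zero, Nat.cast_one, inv_one, one_smul,
    iteratedFDerivWithin_zero_apply]
  rw [Finset.sum_eq_zero, zero_add]
  intro m _
  rw [ContinuousMultilinearMap.map_coord_zero _ 0 rfl, smul_zero]

/-- By symmetry the term of degree `m + 1` has `m + 1` equal partial contributions, which cancel one
factor of the factorial. So the derivative of a Taylor polynomial of `f` is the Taylor polynomial of
`Df` of one degree less. -/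
theorem hasFDerivAt_taylorPoly (hs : UniqueDiffOn ℝ s) (hsc : s ⊆ closure (interior s))
    {n : ℕ} {f : E → F} (hf : ContDiffOn ℝ n f s) {a : E} (ha : a ∈ s) (z : E) :
    HasFDerivAt (taylorPoly (n + 1) f s a) (taylorPoly n (fderivWithin ℝ f s) s a z) z := by
  have hterm : ∀ m, m + 1 ≤ n → HasFDerivAt
      (fun z => (((m + 1).factorial : ℝ)⁻¹) •
        iteratedFDerivWithin ℝ (m + 1) f s a (fun _ => z - a))
      (((m.factorial : ℝ)⁻¹) •
        iteratedFDerivWithin ℝ m (fderivWithin ℝ f s) s a (fun _ => z - a)) z := by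
    intro m hm
    have h1 := HasFDerivAt.multilinear_comp (f := iteratedFDerivWithin ℝ (m + 1) f s a)
      (g := fun _ z => z - a) (g' := fun _ => ContinuousLinearMap.id ℝ E) (x := z)
      (fun _ => (hasFDerivAt_id z).sub_const a)
    refine (h1.const_smul (((m + 1).factorial : ℝ)⁻¹)).congr_fderiv ?_
    ext v
    have h2 : ∀ i : Fin (m + 1), iteratedFDerivWithin ℝ (m + 1) f s a
        (Function.update (fun _ => z - a) i v) = _ := fun i =>
      iteratedFDerivWithin_succ_update hs hsc (hf.of_le (by exact_mod_cast hm)) ha v (z - a) i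
    simp only [_root_.smul_apply, _root_.sum_apply,
      ContinuousLinearMap.comp_apply, ContinuousLinearMap.id_apply,
      ContinuousMultilinearMap.toContinuousLinearMap_apply, h2, Finset.sum_const, Finset.card_univ,
      Fintype.card_fin]
    rw [← Nat.cast_smul_eq_nsmul ℝ, smul_smul]
    congr 1
    rw [Nat.factorial_succ]
    have : ((m + 1 : ℕ) : ℝ) ≠ 0 := by positivity
    have : (m.factorial : ℝ) ≠ 0 := by positivity
    push_cast at *
    field_simp
  have hsplit : taylorPoly (n + 1) f s a = fun z => (∑ m ∈ Finset.range n,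
      (((m + 1).factorial : ℝ)⁻¹) • iteratedFDerivWithin ℝ (m + 1) f s a (fun _ => z - a)) + f a := by
    ext z
    rw [taylorPoly, Finset.sum_range_succ']
    simp
  rw [hsplit]
  refine HasFDerivAt.add_const _ ?_
  unfold taylorPoly
  exact HasFDerivAt.fun_sum fun m hm => hterm m (Finset.mem_range.1 hm)

/-- Induction through the derivative: the remainder of `Df` bounds the derivative of the remainder
of `f`, and the mean value inequality is applied on `s` intersected with the ball through `z`. The
factor `1 / n!` is lost, which is harmless here. -/
theorem norm_sub_taylorPoly_le (hs : UniqueDiffOn ℝ s) (hsc : s ⊆ closure (interior s))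
    (hconv : Convex ℝ s) {n : ℕ} {f : E → F} (hf : ContDiffOn ℝ n f s) {M : ℝ}
    (hM : ∀ x ∈ s, ‖iteratedFDerivWithin ℝ n f s x‖ ≤ M) {a z : E} (ha : a ∈ s) (hz : z ∈ s) :
    ‖f z - taylorPoly n f s a z‖ ≤ M * ‖z - a‖ ^ n := by
  induction n generalizing F z with
  | zero => simpa [taylorPoly] using hM z hz
  | succ n ih =>
    have hf1 : ContDiffOn ℝ n (fderivWithin ℝ f s) s := hf.fderivWithin hs (by norm_cast)
    have hM0 : 0 ≤ M := (norm_nonneg _).trans (hM a ha)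
    have hder : ∀ y ∈ s, HasFDerivWithinAt (fun y => f y - taylorPoly (n + 1) f s a y)
        (fderivWithin ℝ f s y - taylorPoly n (fderivWithin ℝ f s) s a y) s y := fun y hy =>
      ((hf.differentiableOn (by simp)) y hy).hasFDerivWithinAt.sub
        (hasFDerivAt_taylorPoly hs hsc (hf.of_le (by norm_cast; omega)) ha y).hasFDerivWithinAt
    have hbound : ∀ y ∈ s, ‖fderivWithin ℝ f s y - taylorPoly n (fderivWithin ℝ f s) s a y‖ ≤
        M * ‖y - a‖ ^ n := fun y hy => ih hf1 (fun x hx => by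
      rw [norm_iteratedFDerivWithin_fderivWithin hs hx]; exact hM x hx) hy
    have h := (hconv.inter (convex_closedBall a ‖z - a‖)).norm_image_sub_le_of_norm_hasFDerivWithin_le
      (f := fun y => f y - taylorPoly (n + 1) f s a y) (C := M * ‖z - a‖ ^ n)
      (fun y hy => (hder y hy.1).mono inter_subset_left)
      (fun y hy => (hbound y hy.1).trans (by
        have := mem_closedBall_iff_norm.1 hy.2
        gcongr))
      ⟨ha, mem_closedBall_self (norm_nonneg _)⟩ ⟨hz, mem_closedBall_iff_norm.2 le_rfl⟩
    rw [taylorPoly_self, sub_self, sub_zero] at h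
    rw [pow_succ, ← mul_assoc]
    exact h

theorem norm_fderivWithin_sub_taylorPoly_le (hs : UniqueDiffOn ℝ s)
    (hsc : s ⊆ closure (interior s)) (hconv : Convex ℝ s) {n : ℕ} {f : E → F}
    (hf : ContDiffOn ℝ (n + 1) f s) {M : ℝ}
    (hM : ∀ x ∈ s, ‖iteratedFDerivWithin ℝ (n + 1) f s x‖ ≤ M) {a z : E} (ha : a ∈ s)
    (hz : z ∈ s) :
    ‖fderivWithin ℝ f s z - taylorPoly n (fderivWithin ℝ f s) s a z‖ ≤ M * ‖z - a‖ ^ n :=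
  norm_sub_taylorPoly_le hs hsc hconv (hf.fderivWithin hs (by norm_cast))
    (fun x hx => by rw [norm_iteratedFDerivWithin_fderivWithin hs hx]; exact hM x hx) ha hz

/-- Indexing monomials by words instead of multi-indices writes each as a product of affine factors,
the shape a product network computes. -/
theorem taylorPoly_eq_sum {D : ℕ} {s : Set (Fin D → ℝ)} (n : ℕ) (f : (Fin D → ℝ) → F)
    (a z : Fin D → ℝ) :
    taylorPoly n f s a z = ∑ t : (Σ m : Fin n, Fin m → Fin D),
      (∏ q, (z (t.2 q) - a (t.2 q))) • (((t.1 : ℕ).factorial : ℝ)⁻¹ •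
        iteratedFDerivWithin ℝ t.1 f s a (fun q => Pi.single (t.2 q) 1)) := by
  classical
  rw [taylorPoly, Fintype.sum_sigma, ← Fin.sum_univ_eq_sum_range
    (fun m => ((m.factorial : ℝ)⁻¹) • iteratedFDerivWithin ℝ m f s a (fun _ => z - a)) n]
  refine Finset.sum_congr rfl fun m _ => ?_
  have hw : (fun _ : Fin m => z - a) = fun _ => ∑ j, (z j - a j) • Pi.single j (1 : ℝ) := by
    ext _ l
    simp [Finset.sum_apply, Pi.single_apply]
  rw [hw, ContinuousMultilinearMap.map_sum, Finset.smul_sum]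
  refine Finset.sum_congr rfl fun J _ => ?_
  rw [ContinuousMultilinearMap.map_smul_univ, smul_comm]

end Taylor

/-! ### Quadratic spline bumps as groups of four neurons. -/

section Bump

theorem hasDerivAt_relu2 (s : ℝ) : HasDerivAt relu2 (2 * max 0 s) s := by
  rcases lt_trichotomy s 0 with h | rfl | h
  · rw [max_eq_left h.le, mul_zero]
    refine (hasDerivAt_const s (0 : ℝ)).congr_of_eventuallyEq ?_
    filter_upwards [Iio_mem_nhds h] with y hy
    simp [relu2, (mem_Iio.1 hy).le]
  · rw [max_self, mul_zero]
    have h : relu2 =O[𝓝 0] fun x => ‖x - 0‖ ^ 2 := by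
      refine Asymptotics.IsBigO.of_bound 1 (Eventually.of_forall fun y => ?_)
      simp only [relu2, sub_zero, norm_pow, norm_norm, one_mul]
      gcongr
      rw [Real.norm_eq_abs, Real.norm_eq_abs, abs_of_nonneg (le_max_left _ _)]
      exact max_le (abs_nonneg _) (le_abs_self _)
    have := h.hasFDerivAt (𝕜 := ℝ) one_lt_two
    simpa using this.hasDerivAt
  · rw [max_eq_right h.le]
    have h1 : HasDerivAt (fun y : ℝ => y ^ 2) (2 * s) s := by simpa using hasDerivAt_pow 2 s
    refine h1.congr_of_eventuallyEq ?_
    filter_upwards [Ioi_mem_nhds h] with y hy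
    simp [relu2, (mem_Ioi.1 hy).le]

/-- A `C¹` piecewise quadratic step from `0` to `1` on `[0,1]`. -/
def smoothStep (s : ℝ) : ℝ := 2 * relu2 s - 4 * relu2 (s - 1 / 2) + 2 * relu2 (s - 1)

def smoothStepDeriv (s : ℝ) : ℝ := 4 * max 0 s - 8 * max 0 (s - 1 / 2) + 4 * max 0 (s - 1)

theorem hasDerivAt_smoothStep (s : ℝ) : HasDerivAt smoothStep (smoothStepDeriv s) s := by
  have h : ∀ a, HasDerivAt (fun s => relu2 (s - a)) (2 * max 0 (s - a)) s := fun a =>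
    (hasDerivAt_relu2 (s - a)).comp_sub_const s a
  refine ((((hasDerivAt_relu2 s).const_mul 2).sub ((h (1 / 2)).const_mul 4)).add
    ((h 1).const_mul 2)).congr_deriv ?_
  rw [smoothStepDeriv]
  ring

theorem smoothStep_of_nonpos {s : ℝ} (hs : s ≤ 0) : smoothStep s = 0 ∧ smoothStepDeriv s = 0 := by
  simp [smoothStep, smoothStepDeriv, relu2, hs, show s - 2⁻¹ ≤ 0 by linarith,
    show s ≤ 1 by linarith]

theorem smoothStep_of_one_le {s : ℝ} (hs : 1 ≤ s) : smoothStep s = 1 ∧ smoothStepDeriv s = 0 := by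
  rw [smoothStep, smoothStepDeriv, relu2, relu2, relu2, max_eq_right (by linarith : 0 ≤ s),
    max_eq_right (by linarith : 0 ≤ s - 1 / 2), max_eq_right (by linarith : 0 ≤ s - 1)]
  constructor <;> ring

theorem smoothStep_mem (s : ℝ) :
    smoothStep s ∈ Icc (0 : ℝ) 1 ∧ smoothStepDeriv s ∈ Icc (0 : ℝ) 2 := by
  rcases le_total s 0 with h | h
  · rw [(smoothStep_of_nonpos h).1, (smoothStep_of_nonpos h).2]; norm_num
  rcases le_total 1 s with h1 | h1
  · rw [(smoothStep_of_one_le h1).1, (smoothStep_of_one_le h1).2]; norm_num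
  rw [smoothStep, smoothStepDeriv, relu2, relu2, relu2, max_eq_right h,
    max_eq_left (by linarith : s - 1 ≤ 0)]
  rcases le_total s (1 / 2) with h2 | h2
  · rw [max_eq_left (by linarith : s - 1 / 2 ≤ 0)]
    refine ⟨⟨?_, ?_⟩, ?_, ?_⟩ <;> nlinarith
  · rw [max_eq_right (by linarith : 0 ≤ s - 1 / 2)]
    refine ⟨⟨?_, ?_⟩, ?_, ?_⟩ <;> nlinarith

/-- A `C¹` piecewise quadratic bump supported in `[-1,1]` whose integer translates sum to one. -/
def bump (s : ℝ) : ℝ := smoothStep (s + 1) - smoothStep s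

def bumpDeriv (s : ℝ) : ℝ := smoothStepDeriv (s + 1) - smoothStepDeriv s

theorem hasDerivAt_bump (s : ℝ) : HasDerivAt bump (bumpDeriv s) s := by
  have h : HasDerivAt (fun s => smoothStep (s + 1)) (smoothStepDeriv (s + 1)) s :=
    (hasDerivAt_smoothStep (s + 1)).comp_add_const s 1
  exact h.sub (hasDerivAt_smoothStep s)

theorem abs_bump_le (s : ℝ) : |bump s| ≤ 1 := by
  have h1 := (smoothStep_mem (s + 1)).1
  have h2 := (smoothStep_mem s).1
  rw [bump, abs_le]
  constructor <;> linarith [h1.1, h1.2, h2.1, h2.2]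

theorem abs_bumpDeriv_le (s : ℝ) : |bumpDeriv s| ≤ 2 := by
  have h1 := (smoothStep_mem (s + 1)).2
  have h2 := (smoothStep_mem s).2
  rw [bumpDeriv, abs_le]
  constructor <;> linarith [h1.1, h1.2, h2.1, h2.2]

theorem bump_eq_zero {s : ℝ} (hs : 1 ≤ |s|) : bump s = 0 ∧ bumpDeriv s = 0 := by
  rw [bump, bumpDeriv]
  rcases le_abs.1 hs with h | h
  · rw [(smoothStep_of_one_le h).1, (smoothStep_of_one_le h).2,
      (smoothStep_of_one_le (by linarith : 1 ≤ s + 1)).1,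
      (smoothStep_of_one_le (by linarith : 1 ≤ s + 1)).2]
    simp
  · rw [(smoothStep_of_nonpos (by linarith : s ≤ 0)).1, (smoothStep_of_nonpos (by linarith : s ≤ 0)).2,
      (smoothStep_of_nonpos (by linarith : s + 1 ≤ 0)).1,
      (smoothStep_of_nonpos (by linarith : s + 1 ≤ 0)).2]
    simp

/-- The sum telescopes to `smoothStep (y + 1) - smoothStep (y - N)`, which is `1 - 0` for `0 ≤ y ≤
N`. -/
theorem sum_bump {N : ℕ} {y : ℝ} (hy : y ∈ Icc (0 : ℝ) N) :
    ∑ j : Fin (N + 1), bump (y - (j : ℕ)) = 1 := by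
  rw [Fin.sum_univ_eq_sum_range (fun j => bump (y - (j : ℕ))) (N + 1)]
  have h : ∀ j : ℕ, bump (y - j) = smoothStep (y + 1 - j) - smoothStep (y + 1 - (j + 1 : ℕ)) := by
    intro j
    rw [bump]
    push_cast
    congr 2 <;> ring
  simp only [h]
  rw [Finset.sum_range_sub', (smoothStep_of_one_le _).1, (smoothStep_of_nonpos _).1, sub_zero]
  · push_cast; linarith [hy.2]
  · push_cast; linarith [hy.1]

/-- The function is a combination of four neurons with weights bounded by `B`. -/
def QuadFactor {D : ℕ} (B : ℝ) (h : (Fin D → ℝ) → ℝ) : Prop :=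
  ∃ (w : Fin 4 → Fin D → ℝ) (b : Fin 4 → ℝ), (∀ r l, |w r l| ≤ B) ∧ (∀ r, |b r| ≤ B) ∧
    ∀ z, h z = ∑ r, quadSign r * relu2 (∑ l, w r l * z l + b r)

theorem quadFactor_const_one {D : ℕ} {B : ℝ} (hB : 2 ≤ B) :
    QuadFactor B (fun _ : Fin D → ℝ => 1) := by
  refine ⟨0, fun r => quadLeft r * 1 + quadRight r * 1, fun r l => by simp; linarith, fun r => ?_,
    fun z => ?_⟩
  · refine (abs_add_le _ _).trans ?_
    rw [mul_one, mul_one, abs_quadLeft, abs_quadRight]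
    linarith
  · simpa using (sum_quad_mul 1 1).symm

/-- The affine factor is encoded as its product with `1`, so that all factors have the same
four-neuron form. -/
theorem quadFactor_sub {D : ℕ} {B : ℝ} (hB : 2 ≤ B) (j : Fin D) {a : ℝ} (ha : a ∈ Icc (0 : ℝ) 1) :
    QuadFactor B (fun z : Fin D → ℝ => z j - a) := by
  refine ⟨fun r l => if l = j then quadLeft r else 0, fun r => quadLeft r * (-a) + quadRight r * 1,
    fun r l => ?_, fun r => ?_, fun z => ?_⟩
  · beta_reduce
    split_ifs
    · rw [abs_quadLeft]; linarith
    · rw [abs_zero]; linarith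
  · refine (abs_add_le _ _).trans ?_
    rw [mul_one, abs_mul, abs_quadLeft, abs_quadRight, abs_neg, abs_of_nonneg ha.1]
    linarith [ha.2]
  · have h := sum_quad_mul (z j - a) 1
    rw [mul_one] at h
    beta_reduce
    rw [← h]
    refine Finset.sum_congr rfl fun r _ => ?_
    congr 2
    simp only [ite_mul, zero_mul, Finset.sum_ite_eq', Finset.mem_univ, if_true]
    ring

theorem relu2_mul {c : ℝ} (hc : 0 ≤ c) (s : ℝ) : relu2 (c * s) = c ^ 2 * relu2 s := by
  rw [relu2, relu2, ← mul_pow, mul_max_of_nonneg _ _ hc, mul_zero]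

/-- In the difference of two steps the terms at the common knot `0` cancel. What remains are knots
at `-1`, `-1/2`, `1/2`, `1` with coefficients `2`, `-4`, `4`, `-2`. The decoding weights being fixed
at `±1/4`, the amplitudes `8` and `16` enter as input factors `√8` and `4` by homogeneity of degree
two. -/
theorem quadFactor_bump {D N : ℕ} {B : ℝ} (hN : 1 ≤ N) (hB : 8 * N ≤ B) (j : Fin D) {i : ℕ}
    (hi : i ≤ N) : QuadFactor B (fun z : Fin D → ℝ => bump (N * z j - i)) := by
  have h8 : √8 ≤ 4 := by rw [Real.sqrt_le_left (by norm_num)]; norm_num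
  have h80 := Real.sqrt_nonneg 8
  let A : Fin 4 → ℝ := ![√8, 4, 4, √8]
  let S : Fin 4 → ℝ := ![1, 1 / 2, -1 / 2, -1]
  have hA : ∀ r, |A r| ≤ 4 := by
    intro r
    fin_cases r <;> simp only [A, Fin.mk_zero, Fin.mk_one, Fin.reduceFinMk, Matrix.cons_val] <;>
      rw [abs_of_nonneg (by positivity)] <;> exact h8
  have hS : ∀ r, |S r| ≤ 1 := by
    intro r
    fin_cases r <;> norm_num [S, abs_le]
  have hN' : (1 : ℝ) ≤ N := by exact_mod_cast hN
  have hi' : (i : ℝ) ≤ N := by exact_mod_cast hi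
  refine ⟨fun r l => if l = j then A r * N else 0, fun r => A r * (S r - i), fun r l => ?_,
    fun r => ?_, fun z => ?_⟩
  · beta_reduce
    split_ifs
    · rw [abs_mul, Nat.abs_cast]
      nlinarith [hA r]
    · rw [abs_zero]; linarith
  · rw [abs_mul]
    have h1 : |S r - i| ≤ 1 + N := (abs_sub _ _).trans (by
      rw [Nat.abs_cast]; exact add_le_add (hS r) hi')
    calc |A r| * |S r - i| ≤ 4 * (1 + N) := by
          gcongr
          exact hA r
      _ ≤ B := by linarith
  · have harg : ∀ r, ∑ l, (if l = j then A r * N else 0) * z l + A r * (S r - i) =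
        A r * (N * z j - i + S r) := by
      intro r
      simp only [ite_mul, zero_mul, Finset.sum_ite_eq', Finset.mem_univ, if_true]
      ring
    simp only [harg]
    have hA0 : ∀ r, 0 ≤ A r := by
      intro r
      fin_cases r <;> simp [A]
    simp only [relu2_mul (hA0 _)]
    simp only [Fin.sum_univ_four, quadSign, A, S, Matrix.cons_val,
      Real.sq_sqrt (by norm_num : (0 : ℝ) ≤ 8), bump, smoothStep]
    rw [show N * z j - i + 1 - 1 / 2 = N * z j - i + 1 / 2 by ring,
      show N * z j - i + 1 - 1 = N * z j - i by ring,
      show N * z j - i + -1 / 2 = N * z j - i - 1 / 2 by ring,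
      show N * z j - i + -1 = N * z j - i - 1 by ring]
    ring

theorem exists_quadFactor_network {T : Type} [Fintype T] {D d m : ℕ} {B : ℝ} (hB : 1 ≤ B)
    {h : T → Fin (2 ^ m) → (Fin D → ℝ) → ℝ} (hh : ∀ t q, QuadFactor B (h t q))
    {c : Fin d → T → ℝ} (hc : ∀ j t, |c j t| ≤ B) :
    (fun z j => ∑ t, c j t * ∏ q, h t q z) ∈
      reluSqClass D d (m + 2) (Fintype.card T * (4 * 2 ^ m))
        (Fintype.card T * (4 * 2 ^ m * (D + 1) + m * (4 * 2 ^ m) ^ 2 + d * (4 * 2 ^ m))) B := by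
  choose w b hw hb hz using hh
  simp only [hz]
  exact exists_product_network hB w b c hw hb hc

end Bump

/-! ### Quasi-interpolation by local Taylor polynomials. -/

section Approximation

variable {D d N k : ℕ}

/-- The point of the grid with mesh `1/N` with index `i`. -/
def gridPoint (i : Fin D → Fin (N + 1)) (l : Fin D) : ℝ := ((i l : ℕ) : ℝ) / N

theorem gridPoint_mem_cube (hN : 1 ≤ N) (i : Fin D → Fin (N + 1)) :
    gridPoint i ∈ Icc (0 : Fin D → ℝ) 1 := by
  have hN' : (0 : ℝ) < N := by exact_mod_cast hN
  have hi : ∀ l, ((i l : ℕ) : ℝ) ≤ N := fun l => by exact_mod_cast Nat.lt_succ_iff.1 (i l).2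
  exact ⟨fun l => by simp only [gridPoint, Pi.zero_apply]; positivity,
    fun l => by rw [gridPoint, Pi.one_apply, div_le_one hN']; exact hi l⟩

/-- The tensor product bump around a grid point. -/
def bumpProd (i : Fin D → Fin (N + 1)) (z : Fin D → ℝ) : ℝ := ∏ l, bump (N * z l - (i l : ℕ))

def bumpProdDeriv (i : Fin D → Fin (N + 1)) (z : Fin D → ℝ) : (Fin D → ℝ) →L[ℝ] ℝ :=
  ∑ l, (∏ j ∈ Finset.univ.erase l, bump (N * z j - (i j : ℕ))) •
    ((bumpDeriv (N * z l - (i l : ℕ)) * N) • ContinuousLinearMap.proj (R := ℝ) (φ := fun _ => ℝ) l)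

theorem hasFDerivAt_bumpProd (i : Fin D → Fin (N + 1)) (z : Fin D → ℝ) :
    HasFDerivAt (bumpProd i) (bumpProdDeriv i z) z := by
  refine HasFDerivAt.finsetProd (g := fun l (z : Fin D → ℝ) => bump (N * z l - (i l : ℕ)))
    fun l _ => ?_
  have h1 : HasFDerivAt (fun z : Fin D → ℝ => N * z l - ((i l : ℕ) : ℝ))
      ((N : ℝ) • ContinuousLinearMap.proj (R := ℝ) (φ := fun _ => ℝ) l) z :=
    ((ContinuousLinearMap.proj (R := ℝ) (φ := fun _ : Fin D => ℝ) l).hasFDerivAt.const_mul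
      (N : ℝ)).sub_const _
  refine ((hasDerivAt_bump (N * z l - (i l : ℕ))).comp_hasFDerivAt z h1).congr_fderiv ?_
  rw [smul_smul]

theorem abs_bumpProd_le (i : Fin D → Fin (N + 1)) (z : Fin D → ℝ) : |bumpProd i z| ≤ 1 := by
  rw [bumpProd, Finset.abs_prod]
  exact Finset.prod_le_one (fun _ _ => abs_nonneg _) fun _ _ => abs_bump_le _

theorem norm_bumpProdDeriv_le (i : Fin D → Fin (N + 1)) (z : Fin D → ℝ) :
    ‖bumpProdDeriv i z‖ ≤ D * (2 * N) := by
  have h : ∀ l, ‖(∏ j ∈ Finset.univ.erase l, bump (N * z j - (i j : ℕ))) •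
    ((bumpDeriv (N * z l - (i l : ℕ)) * N) •
      ContinuousLinearMap.proj (R := ℝ) (φ := fun _ : Fin D => ℝ) l)‖ ≤ 2 * N := by
    intro l
    have hp : ‖ContinuousLinearMap.proj (R := ℝ) (φ := fun _ : Fin D => ℝ) l‖ ≤ 1 :=
      ContinuousLinearMap.opNorm_le_bound _ zero_le_one fun x => by
        simpa using norm_le_pi_norm x l
    rw [norm_smul, norm_smul, norm_mul, Real.norm_eq_abs, Real.norm_eq_abs, Finset.abs_prod,
      Real.norm_natCast]
    have h1 : ∏ j ∈ Finset.univ.erase l, |bump (N * z j - (i j : ℕ))| ≤ 1 :=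
      Finset.prod_le_one (fun _ _ => abs_nonneg _) fun _ _ => abs_bump_le _
    have h2 := abs_bumpDeriv_le (N * z l - (i l : ℕ))
    have h3 : |bumpDeriv (N * z l - (i l : ℕ))| * N *
        ‖ContinuousLinearMap.proj (R := ℝ) (φ := fun _ : Fin D => ℝ) l‖ ≤ 2 * N * 1 := by gcongr
    refine (mul_le_mul h1 h3 (by positivity) zero_le_one).trans (by simp)
  refine (norm_sum_le_of_le _ fun l _ => h l).trans ?_
  simp

theorem bumpProd_eq_zero (i : Fin D → Fin (N + 1)) (z : Fin D → ℝ)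
    (h : ¬ ∀ l, |N * z l - (i l : ℕ)| < 1) : bumpProd i z = 0 ∧ bumpProdDeriv i z = 0 := by
  push Not at h
  obtain ⟨l, hl⟩ := h
  have hb := bump_eq_zero hl
  refine ⟨Finset.prod_eq_zero (Finset.mem_univ l) hb.1, Finset.sum_eq_zero fun m _ => ?_⟩
  by_cases hml : m = l
  · rw [hml, hb.2, zero_mul, zero_smul, smul_zero]
  · rw [Finset.prod_eq_zero (Finset.mem_erase.2 ⟨Ne.symm hml, Finset.mem_univ l⟩) hb.1, zero_smul]

theorem sum_bumpProd {z : Fin D → ℝ} (hz : z ∈ Icc (0 : Fin D → ℝ) 1) :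
    ∑ i : Fin D → Fin (N + 1), bumpProd i z = 1 := by
  have h := Finset.prod_univ_sum (fun _ : Fin D => (Finset.univ : Finset (Fin (N + 1))))
    (fun l j => bump (N * z l - (j : ℕ)))
  rw [Fintype.piFinset_univ] at h
  simp only [bumpProd]
  rw [← h]
  refine Finset.prod_eq_one fun l _ => sum_bump ?_
  have hl := cube_apply hz l
  exact ⟨mul_nonneg (Nat.cast_nonneg _) hl.1, mul_le_of_le_one_right (Nat.cast_nonneg _) hl.2⟩

theorem norm_sub_gridPoint_le (hN : 1 ≤ N) {i : Fin D → Fin (N + 1)} {z : Fin D → ℝ}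
    (h : ∀ l, |N * z l - (i l : ℕ)| < 1) : ‖z - gridPoint i‖ ≤ (N : ℝ)⁻¹ := by
  have hN' : (0 : ℝ) < N := by exact_mod_cast hN
  refine (pi_norm_le_iff_of_nonneg (by positivity)).2 fun l => ?_
  rw [Pi.sub_apply, gridPoint, Real.norm_eq_abs, ← mul_le_mul_iff_of_pos_left hN',
    mul_inv_cancel₀ hN'.ne']
  nth_rewrite 1 [← abs_of_pos hN']
  rw [← abs_mul, mul_sub, mul_div_cancel₀ _ hN'.ne']
  exact (h l).le

open Classical in
/-- The indices of the grid points whose bump does not vanish near `z`. -/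
def nearIndices (N : ℕ) (z : Fin D → ℝ) : Finset (Fin D → Fin (N + 1)) :=
  Fintype.piFinset fun l => Finset.univ.filter fun j : Fin (N + 1) => |N * z l - (j : ℕ)| < 1

theorem mem_nearIndices {z : Fin D → ℝ} {i : Fin D → Fin (N + 1)} :
    i ∈ nearIndices N z ↔ ∀ l, |N * z l - (i l : ℕ)| < 1 := by
  simp [nearIndices, Fintype.mem_piFinset]

/-- In each coordinate only `⌊y⌋` and `⌊y⌋ + 1` can be at distance less than one from `y`. -/
theorem card_nearIndices_le (z : Fin D → ℝ) : (nearIndices N z).card ≤ 2 ^ D := by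
  classical
  rw [nearIndices, Fintype.card_piFinset]
  refine (Finset.prod_le_pow_card _ _ 2 fun l _ => ?_).trans (by simp)
  set y := N * z l
  have h : ((Finset.univ.filter fun j : Fin (N + 1) => |y - (j : ℕ)| < 1).image
      fun j : Fin (N + 1) => ((j : ℕ) : ℤ)) ⊆ {⌊y⌋, ⌊y⌋ + 1} := by
    intro n hn
    obtain ⟨j, hj, rfl⟩ := Finset.mem_image.1 hn
    have hj' := abs_lt.1 (Finset.mem_filter.1 hj).2
    have h1 : ⌊y⌋ < ((j : ℕ) : ℤ) + 1 := by
      rw [Int.floor_lt]; push_cast; linarith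
    have h2 : ((j : ℕ) : ℤ) - 1 ≤ ⌊y⌋ := by
      rw [Int.le_floor]; push_cast; linarith
    simp only [Finset.mem_insert, Finset.mem_singleton]
    omega
  have hinj : Function.Injective fun j : Fin (N + 1) => ((j : ℕ) : ℤ) := fun a b hab =>
    Fin.ext (Nat.cast_injective (R := ℤ) hab)
  rw [← Finset.card_image_of_injective _ hinj]
  exact (Finset.card_le_card h).trans Finset.card_le_two

variable {F : Type} [NormedAddCommGroup F] [NormedSpace ℝ F]

/-- Local Taylor polynomials glued by the partition of unity. -/
def quasiInterpolant (N k : ℕ) (f : (Fin D → ℝ) → F) (z : Fin D → ℝ) : F :=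
  ∑ i : Fin D → Fin (N + 1), bumpProd i z • taylorPoly k f (Icc 0 1) (gridPoint i) z

theorem cube_subset_closure_interior :
    Icc (0 : Fin D → ℝ) 1 ⊆ closure (interior (Icc (0 : Fin D → ℝ) 1)) := by
  rw [← pi_univ_Icc, interior_pi_set finite_univ, closure_pi_set]
  simp only [Pi.zero_apply, Pi.one_apply, interior_Icc]
  rw [closure_Ioo (zero_ne_one)]

theorem norm_sum_nearIndices_le {G : Type*} [NormedAddCommGroup G] (z : Fin D → ℝ)
    {g : (Fin D → Fin (N + 1)) → G} {C : ℝ} (hg : ∀ i, i ∉ nearIndices N z → g i = 0)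
    (hC : ∀ i ∈ nearIndices N z, ‖g i‖ ≤ C) (hC0 : 0 ≤ C) : ‖∑ i, g i‖ ≤ 2 ^ D * C := by
  rw [← Finset.sum_subset (Finset.subset_univ (nearIndices N z)) fun i _ hi => hg i hi]
  refine (norm_sum_le_of_le _ hC).trans ?_
  rw [Finset.sum_const, nsmul_eq_mul]
  gcongr
  exact_mod_cast card_nearIndices_le z

theorem hasFDerivAt_quasiInterpolant (hN : 1 ≤ N) {f : (Fin D → ℝ) → F}
    (hf : ContDiffOn ℝ k f (Icc 0 1)) (z : Fin D → ℝ) :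
    HasFDerivAt (quasiInterpolant N (k + 1) f) (∑ i : Fin D → Fin (N + 1),
      (bumpProd i z • taylorPoly k (fderivWithin ℝ f (Icc 0 1)) (Icc 0 1) (gridPoint i) z +
        (bumpProdDeriv i z).smulRight (taylorPoly (k + 1) f (Icc 0 1) (gridPoint i) z))) z :=
  HasFDerivAt.fun_sum fun i _ => (hasFDerivAt_bumpProd i z).fun_smul
    (hasFDerivAt_taylorPoly uniqueDiffOn_cube cube_subset_closure_interior hf
      (gridPoint_mem_cube hN i) z)

/-- Since the bumps sum to one on the cube, the error is the sum of `bumpProd i • (Tᵢ - f)`. In its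
derivative, the gradient of the bump costs a factor of order `N`, which the extra order of accuracy
of `Tᵢ - f` over that of its derivative compensates. At most `2 ^ D` terms are nonzero at a point.
-/
theorem quasiInterpolant_error (hN : 1 ≤ N) {f : (Fin D → ℝ) → F} {M : ℝ}
    (hf : ContDiffOn ℝ (k + 1) f (Icc 0 1))
    (hM : ∀ x ∈ Icc (0 : Fin D → ℝ) 1, ‖iteratedFDerivWithin ℝ (k + 1) f (Icc 0 1) x‖ ≤ M)
    {z : Fin D → ℝ} (hz : z ∈ Icc (0 : Fin D → ℝ) 1) :
    ‖quasiInterpolant N (k + 1) f z - f z‖ ≤ 2 ^ D * ((1 + 2 * D) * M) * (N : ℝ)⁻¹ ^ k ∧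
    ‖fderiv ℝ (quasiInterpolant N (k + 1) f) z - fderivWithin ℝ f (Icc 0 1) z‖ ≤
      2 ^ D * ((1 + 2 * D) * M) * (N : ℝ)⁻¹ ^ k := by
  have hN' : (1 : ℝ) ≤ N := by exact_mod_cast hN
  have hh1 : (N : ℝ)⁻¹ ≤ 1 := inv_le_one_of_one_le₀ hN'
  have hM0 : 0 ≤ M := (norm_nonneg _).trans (hM z hz)
  set h := (N : ℝ)⁻¹ with hh
  have hh0 : 0 ≤ h := by positivity
  have hu : UniqueDiffOn ℝ (Icc (0 : Fin D → ℝ) 1) := uniqueDiffOn_cube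
  have hval : ∀ i ∈ nearIndices N z,
      ‖taylorPoly (k + 1) f (Icc 0 1) (gridPoint i) z - f z‖ ≤ M * h ^ (k + 1) := by
    intro i hi
    rw [norm_sub_rev]
    refine (norm_sub_taylorPoly_le hu cube_subset_closure_interior convex_cube
      (by exact_mod_cast hf) hM (gridPoint_mem_cube hN i) hz).trans ?_
    gcongr
    exact norm_sub_gridPoint_le hN (mem_nearIndices.1 hi)
  have hder : ∀ i ∈ nearIndices N z,
      ‖taylorPoly k (fderivWithin ℝ f (Icc 0 1)) (Icc 0 1) (gridPoint i) z -
        fderivWithin ℝ f (Icc 0 1) z‖ ≤ M * h ^ k := by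
    intro i hi
    rw [norm_sub_rev]
    refine (norm_fderivWithin_sub_taylorPoly_le hu cube_subset_closure_interior convex_cube
      hf hM (gridPoint_mem_cube hN i) hz).trans ?_
    gcongr
    exact norm_sub_gridPoint_le hN (mem_nearIndices.1 hi)
  have hzero : ∀ i, i ∉ nearIndices N z → bumpProd i z = 0 ∧ bumpProdDeriv i z = 0 := fun i hi =>
    bumpProd_eq_zero i z fun h => hi (mem_nearIndices.2 h)
  have hdiff : ∀ y ∈ Icc (0 : Fin D → ℝ) 1, quasiInterpolant N (k + 1) f y - f y =
      ∑ i : Fin D → Fin (N + 1),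
        bumpProd i y • (taylorPoly (k + 1) f (Icc 0 1) (gridPoint i) y - f y) := by
    intro y hy
    simp only [smul_sub, Finset.sum_sub_distrib]
    rw [← Finset.sum_smul, sum_bumpProd hy, one_smul]
    rfl
  constructor
  · rw [hdiff z hz, mul_assoc]
    refine norm_sum_nearIndices_le z (fun i hi => by rw [(hzero i hi).1, zero_smul])
      (fun i hi => ?_) (by positivity)
    rw [norm_smul]
    calc _ ≤ 1 * (M * h ^ (k + 1)) := by
          gcongr
          · exact abs_bumpProd_le i z
          · exact hval i hi
      _ ≤ 1 * (M * h ^ k) := by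
          gcongr 1
          gcongr 1
          exact pow_le_pow_of_le_one hh0 hh1 (Nat.le_succ k)
      _ ≤ _ := by
          rw [← mul_assoc]
          gcongr
          have : (0 : ℝ) ≤ D := by positivity
          linarith
  · have hD := hasFDerivAt_quasiInterpolant (k := k) hN (hf.of_le (by norm_cast; omega)) z
    have hfd := ((hf.differentiableOn (by simp)) z hz).hasFDerivWithinAt
    -- The representation with differences `Tᵢ - f` is available only on the cube, so it is
    -- differentiated within the cube and matched with the other derivative by uniqueness.
    have h1 : HasFDerivWithinAt (fun y => quasiInterpolant N (k + 1) f y - f y)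
        (∑ i : Fin D → Fin (N + 1), (bumpProd i z •
          (taylorPoly k (fderivWithin ℝ f (Icc 0 1)) (Icc 0 1) (gridPoint i) z -
            fderivWithin ℝ f (Icc 0 1) z) + (bumpProdDeriv i z).smulRight
          (taylorPoly (k + 1) f (Icc 0 1) (gridPoint i) z - f z))) (Icc 0 1) z := by
      refine HasFDerivWithinAt.congr ?_ hdiff (hdiff z hz)
      exact HasFDerivWithinAt.fun_sum fun i _ => (hasFDerivAt_bumpProd i z).hasFDerivWithinAt.fun_smul
        ((hasFDerivAt_taylorPoly hu cube_subset_closure_interior (hf.of_le (by norm_cast; omega))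
          (gridPoint_mem_cube hN i) z).hasFDerivWithinAt.sub hfd)
    rw [hD.fderiv, (hu z hz).eq (hD.hasFDerivWithinAt.sub hfd) h1, mul_assoc]
    refine norm_sum_nearIndices_le z (fun i hi => ?_) (fun i hi => ?_) (by positivity)
    · rw [(hzero i hi).1, (hzero i hi).2, zero_smul, zero_add]
      ext v
      simp
    · refine (norm_add_le _ _).trans ?_
      rw [norm_smul, ContinuousLinearMap.norm_smulRight_apply]
      calc _ ≤ 1 * (M * h ^ k) + (D * (2 * N)) * (M * h ^ (k + 1)) := by
            gcongr
            · exact abs_bumpProd_le i z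
            · exact hder i hi
            · exact norm_bumpProdDeriv_le i z
            · exact hval i hi
        _ = (1 + 2 * D * (N * h)) * M * h ^ k := by rw [pow_succ]; ring
        _ = (1 + 2 * D) * M * h ^ k := by
            rw [hh, mul_inv_cancel₀ (by positivity), mul_one]

end Approximation

/-! ### Networks that approximate a smooth function together with its derivative. -/

section NetworkApproximation

/-- Monomials have different degrees, but the product tree has a fixed number `Q` of leaves; the
missing factors are filled with ones. -/
theorem Fin.prod_dite_pad {D m Q : ℕ} (hQ : D + m ≤ Q) (a : Fin D → ℝ) (b : Fin m → ℝ) :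
    (∏ q : Fin Q, if hq : (q : ℕ) < D then a ⟨q, hq⟩ else
      if hq' : (q : ℕ) - D < m then b ⟨q - D, hq'⟩ else 1) = (∏ l, a l) * ∏ l, b l := by
  obtain ⟨e, rfl⟩ := Nat.exists_eq_add_of_le hQ
  rw [Fin.prod_univ_add, Fin.prod_univ_add]
  have h1 : ∀ l : Fin e, ¬ (D + m + (l : ℕ) < D) := fun l => by omega
  have h2 : ∀ l : Fin e, ¬ (D + m + (l : ℕ) - D < m) := fun l => by omega
  simp [h1, h2]

/-- The quasi-interpolant is itself a network, with one product for each grid point and monomial, so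
network size is the number of grid points times a constant. The slopes of the bumps need weights of
order `N`; the Taylor coefficients are bounded by `|M|`. -/
theorem exists_network_approx (D d k : ℕ) : ∃ K : ℕ, ∀ (M : ℝ) (f : (Fin D → ℝ) → Fin d → ℝ),
    ContDiffOn ℝ (k + 1) f (Icc 0 1) →
    (∀ m ≤ k + 1, ∀ x ∈ Icc (0 : Fin D → ℝ) 1, ‖iteratedFDerivWithin ℝ m f (Icc 0 1) x‖ ≤ M) →
    ∀ N : ℕ, 1 ≤ N → ∃ W S : ℕ, ∃ φ ∈ reluSqClass D d (D + (k + 1) + 2) W S ((|M| + 8) * N),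
      W ≤ K * (N + 1) ^ D ∧ S ≤ K * (N + 1) ^ D ∧ Differentiable ℝ φ ∧
      ∀ z ∈ Icc (0 : Fin D → ℝ) 1,
        ‖φ z - f z‖ ≤ 2 ^ D * ((1 + 2 * D) * M) * (N : ℝ)⁻¹ ^ k ∧
        ‖fderiv ℝ φ z - fderivWithin ℝ f (Icc 0 1) z‖ ≤
          2 ^ D * ((1 + 2 * D) * M) * (N : ℝ)⁻¹ ^ k := by
  classical
  let Mon := Σ m : Fin (k + 1), Fin m → Fin D
  -- The tree has `2 ^ p > p` leaves, enough for `D` bump factors and up to `k` affine factors, with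
  -- a depth depending on `D` and `k` only.
  let p := D + (k + 1)
  let A := 4 * 2 ^ p * (D + 1) + p * (4 * 2 ^ p) ^ 2 + d * (4 * 2 ^ p)
  refine ⟨Fintype.card Mon * A, fun M f hf hM N hN => ?_⟩
  have hN' : (1 : ℝ) ≤ N := by exact_mod_cast hN
  have hM0 := abs_nonneg M
  let T := (Fin D → Fin (N + 1)) × Mon
  have hT : Fintype.card T = (N + 1) ^ D * Fintype.card Mon := by simp [T]
  let h : T → Fin (2 ^ p) → (Fin D → ℝ) → ℝ := fun t q z =>
    if hq : (q : ℕ) < D then bump (N * z ⟨q, hq⟩ - (t.1 ⟨q, hq⟩ : ℕ)) else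
      if hq' : (q : ℕ) - D < t.2.1 then
        z (t.2.2 ⟨q - D, hq'⟩) - gridPoint t.1 (t.2.2 ⟨q - D, hq'⟩) else 1
  let c : Fin d → T → ℝ := fun j t => (((t.2.1 : ℕ).factorial : ℝ)⁻¹ •
    iteratedFDerivWithin ℝ t.2.1 f (Icc 0 1) (gridPoint t.1)
      (fun q => Pi.single (t.2.2 q) 1)) j
  have hB8 : 8 * (N : ℝ) ≤ (|M| + 8) * N := by nlinarith
  have hBM : |M| ≤ (|M| + 8) * N := by nlinarith
  have hh : ∀ t q, QuadFactor ((|M| + 8) * N) (h t q) := by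
    intro t q
    by_cases hq : (q : ℕ) < D
    · simp only [h, hq, dif_pos]
      exact quadFactor_bump hN hB8 _ (Nat.lt_succ_iff.1 (t.1 ⟨q, hq⟩).2)
    · by_cases hq' : (q : ℕ) - D < t.2.1
      · simp only [h, hq, hq', dif_pos, dif_neg, not_false_eq_true]
        exact quadFactor_sub (by linarith) _ (cube_apply (gridPoint_mem_cube hN t.1) _)
      · simp only [h, hq, hq', dif_neg, not_false_eq_true]
        exact quadFactor_const_one (by linarith)
  have hc : ∀ j t, |c j t| ≤ (|M| + 8) * N := by
    intro j t
    refine le_trans ?_ hBM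
    have h1 := ContinuousMultilinearMap.le_opNorm
      (iteratedFDerivWithin ℝ t.2.1 f (Icc 0 1) (gridPoint t.1))
      (fun q => Pi.single (t.2.2 q) (1 : ℝ))
    have h2 : ∏ q, ‖(Pi.single (t.2.2 q) (1 : ℝ) : Fin D → ℝ)‖ = 1 :=
      Finset.prod_eq_one fun q _ => by rw [Pi.norm_single, norm_one]
    rw [h2, mul_one] at h1
    have h3 := h1.trans (hM t.2.1 t.2.1.2.le _ (gridPoint_mem_cube hN t.1))
    have h4 : ((t.2.1 : ℕ).factorial : ℝ)⁻¹ ≤ 1 :=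
      inv_le_one_of_one_le₀ (by exact_mod_cast (t.2.1 : ℕ).factorial_pos)
    have h5 := norm_le_pi_norm (((t.2.1 : ℕ).factorial : ℝ)⁻¹ •
      iteratedFDerivWithin ℝ t.2.1 f (Icc 0 1) (gridPoint t.1)
      (fun q => Pi.single (t.2.2 q) (1 : ℝ))) j
    refine h5.trans ?_
    rw [norm_smul, Real.norm_of_nonneg (by positivity)]
    exact (mul_le_of_le_one_left (norm_nonneg _) h4).trans (h3.trans (le_abs_self M))
  have hnet := exists_quadFactor_network (by linarith : (1 : ℝ) ≤ (|M| + 8) * N) hh hc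
  have heq : (fun z j => ∑ t, c j t * ∏ q, h t q z) = quasiInterpolant N (k + 1) f := by
    ext z j
    simp only [quasiInterpolant, Finset.sum_apply, Pi.smul_apply, taylorPoly_eq_sum]
    rw [Fintype.sum_prod_type]
    refine Finset.sum_congr rfl fun i _ => ?_
    rw [smul_eq_mul, Finset.mul_sum]
    refine Finset.sum_congr rfl fun t _ => ?_
    have hp : D + (t.1 : ℕ) ≤ 2 ^ p := by
      have := Nat.lt_two_pow_self (n := p)
      have := t.1.2
      simp only [p] at *
      omega
    have := Fin.prod_dite_pad hp (fun l => bump (N * z l - (i l : ℕ)))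
      (fun q => z (t.2 q) - gridPoint i (t.2 q))
    simp only [h, c]
    rw [this, bumpProd]
    simp only [Pi.smul_apply, smul_eq_mul]
    ring
  rw [heq] at hnet
  refine ⟨_, _, _, hnet, ?_, ?_, fun z =>
    (hasFDerivAt_quasiInterpolant hN (hf.of_le (by norm_cast; omega)) z).differentiableAt,
    fun z hz => quasiInterpolant_error hN hf (hM (k + 1) le_rfl) hz⟩
  · rw [hT]
    calc (N + 1) ^ D * Fintype.card Mon * (4 * 2 ^ p) ≤ (N + 1) ^ D * Fintype.card Mon * A := by
          refine Nat.mul_le_mul_left _ ?_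
          simp only [A]
          nlinarith [Nat.zero_le (4 * 2 ^ p * D), Nat.zero_le (p * (4 * 2 ^ p) ^ 2),
            Nat.zero_le (d * (4 * 2 ^ p))]
      _ = _ := by ring
  · rw [hT]
    exact le_of_eq (by ring)

end NetworkApproximation

/-! ### Flows of fields that point strictly into the cube. -/

section InwardField

variable {d : ℕ}

theorem HasDerivWithinAt.eventually_nonneg {u : ℝ → ℝ} {u' x : ℝ}
    (h : HasDerivWithinAt u u' (Ici x) x) (h0 : 0 ≤ u x) (h1 : u x = 0 → 0 < u') :
    ∀ᶠ y in 𝓝[>] x, 0 ≤ u y := by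
  rcases h0.eq_or_lt with h0 | h0
  · have h2 := (hasDerivWithinAt_iff_tendsto_slope' (by simp)).1 (h.mono Ioi_subset_Ici_self)
    filter_upwards [h2.eventually (lt_mem_nhds (h1 h0.symm)), self_mem_nhdsWithin] with y hy hxy
    rw [slope_def_field, ← h0, sub_zero] at hy
    exact ((div_pos_iff_of_pos_right (sub_pos.2 hxy)).1 hy).le
  · have h2 : Tendsto u (𝓝[>] x) (𝓝 (u x)) :=
      h.continuousWithinAt.mono Ioi_subset_Ici_self
    filter_upwards [h2.eventually (lt_mem_nhds h0)] with y hy using hy.le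

/-- Continuous induction in time: the set of times at which the curve is in the cube is closed, and
strict inwardness extends it to the right. The velocity is an arbitrary function of time so that
both the field and its clamped extension are covered. -/
theorem mem_cube_of_inward {γ v : ℝ → Fin d → ℝ} (h0 : γ 0 ∈ Icc (0 : Fin d → ℝ) 1)
    (hd : ∀ t ∈ Icc (0 : ℝ) 1, HasDerivWithinAt γ (v t) (Icc 0 1) t)
    (hv : ∀ t ∈ Icc (0 : ℝ) 1, γ t ∈ Icc (0 : Fin d → ℝ) 1 → ∀ j,
      (γ t j = 0 → 0 < v t j) ∧ (γ t j = 1 → v t j < 0)) :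
    ∀ t ∈ Icc (0 : ℝ) 1, γ t ∈ Icc (0 : Fin d → ℝ) 1 := by
  have hcont : ContinuousOn γ (Icc 0 1) := fun t ht => (hd t ht).continuousWithinAt
  have hclosed : IsClosed (γ ⁻¹' (Icc (0 : Fin d → ℝ) 1) ∩ Icc (0 : ℝ) 1) := by
    rw [inter_comm]
    exact hcont.preimage_isClosed_of_isClosed isClosed_Icc isClosed_Icc
  refine hclosed.Icc_subset_of_forall_mem_nhdsWithin h0 ?_
  rintro t ⟨htc, ht⟩
  have ht' : t ∈ Icc (0 : ℝ) 1 := ⟨ht.1, ht.2.le⟩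
  have hd' : HasDerivWithinAt γ (v t) (Ici t) t :=
    (hd t ht').mono_of_mem_nhdsWithin (Icc_mem_nhdsGE_of_mem ht)
  rw [hasDerivWithinAt_pi] at hd'
  have h1 : ∀ j, ∀ᶠ y in 𝓝[>] t, 0 ≤ γ y j := fun j =>
    (hd' j).eventually_nonneg (cube_apply htc j).1 (hv t ht' htc j).1
  have h2 : ∀ j, ∀ᶠ y in 𝓝[>] t, 0 ≤ 1 - γ y j := fun j =>
    ((hd' j).const_sub 1).eventually_nonneg (sub_nonneg.2 (cube_apply htc j).2) fun h =>
      neg_pos.2 ((hv t ht' htc j).2 (by linarith))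
  filter_upwards [eventually_all.2 h1, eventually_all.2 h2] with y hy1 hy2
  exact ⟨hy1, fun j => sub_nonneg.1 (hy2 j)⟩

/-- The nearest point of the cube. -/
def clampCube (y : Fin d → ℝ) (j : Fin d) : ℝ := projIcc (0 : ℝ) 1 zero_le_one (y j)

theorem clampCube_mem (y : Fin d → ℝ) : clampCube y ∈ Icc (0 : Fin d → ℝ) 1 :=
  ⟨fun j => (projIcc (0 : ℝ) 1 zero_le_one (y j)).2.1,
    fun j => (projIcc (0 : ℝ) 1 zero_le_one (y j)).2.2⟩

theorem clampCube_of_mem {y : Fin d → ℝ} (hy : y ∈ Icc (0 : Fin d → ℝ) 1) : clampCube y = y := by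
  ext j
  rw [clampCube, projIcc_of_mem zero_le_one (cube_apply hy j)]

theorem norm_clampCube_sub_le (y y' : Fin d → ℝ) : ‖clampCube y - clampCube y'‖ ≤ ‖y - y'‖ := by
  refine (pi_norm_le_iff_of_nonneg (norm_nonneg _)).2 fun j => ?_
  exact (abs_projIcc_sub_projIcc zero_le_one).trans (norm_le_pi_norm (y - y') j)

theorem norm_withTime_sub_withTime (x y : Fin d → ℝ) (t : ℝ) :
    ‖withTime x t - withTime y t‖ ≤ ‖x - y‖ := by
  refine (pi_norm_le_iff_of_nonneg (norm_nonneg _)).2 fun j => ?_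
  induction j using Fin.lastCases with
  | last => simp
  | cast j => simpa using norm_le_pi_norm (x - y) j

/-- A velocity field on the cube that is Lipschitz and points strictly inwards on the faces. -/
structure InwardField (K : ℝ) (g : (Fin (d + 1) → ℝ) → Fin d → ℝ) : Prop where
  lipschitz : ∀ z ∈ Icc (0 : Fin (d + 1) → ℝ) 1, ∀ z' ∈ Icc (0 : Fin (d + 1) → ℝ) 1,
    ‖g z - g z'‖ ≤ K * ‖z - z'‖
  inward : ∀ z ∈ Icc (0 : Fin (d + 1) → ℝ) 1, ∀ j : Fin d,
    (z j.castSucc = 0 → 0 < g z j) ∧ (z j.castSucc = 1 → g z j < 0)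

namespace InwardField

variable {K : ℝ} {g : (Fin (d + 1) → ℝ) → Fin d → ℝ}

theorem continuousOn (hg : InwardField K g) : ContinuousOn g (Icc 0 1) := by
  have : LipschitzOnWith (Real.toNNReal K) g (Icc 0 1) := by
    refine LipschitzOnWith.of_dist_le_mul fun z hz z' hz' => ?_
    rw [dist_eq_norm, dist_eq_norm]
    refine (hg.lipschitz z hz z' hz').trans ?_
    gcongr
    exact Real.le_coe_toNNReal K
  exact this.continuousOn

theorem lipschitzOnWith (hg : InwardField K g) {t : ℝ} (ht : t ∈ Icc (0 : ℝ) 1) :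
    LipschitzOnWith (Real.toNNReal K) (fun y => g (withTime y t)) (Icc 0 1) := by
  refine LipschitzOnWith.of_dist_le_mul fun y hy y' hy' => ?_
  rw [dist_eq_norm, dist_eq_norm]
  refine (hg.lipschitz _ (withTime_mem_cube.2 ⟨hy, ht⟩) _ (withTime_mem_cube.2 ⟨hy', ht⟩)).trans ?_
  exact mul_le_mul (Real.le_coe_toNNReal K) (norm_withTime_sub_withTime _ _ _) (norm_nonneg _)
    NNReal.zero_le_coe

theorem mem_cube (hg : InwardField K g) {γ : ℝ → Fin d → ℝ} (h0 : γ 0 ∈ Icc (0 : Fin d → ℝ) 1)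
    (hd : ∀ t ∈ Icc (0 : ℝ) 1, HasDerivWithinAt γ (g (withTime (γ t) t)) (Icc 0 1) t) :
    ∀ t ∈ Icc (0 : ℝ) 1, γ t ∈ Icc (0 : Fin d → ℝ) 1 :=
  mem_cube_of_inward h0 hd fun t ht htc j => by
    simpa using hg.inward _ (withTime_mem_cube.2 ⟨htc, ht⟩) j

/-- The field is controlled only on the cube. Precomposing with the nearest-point map makes it
bounded and Lipschitz everywhere; the resulting solution never leaves the cube, so the clamping has
no effect on it. -/
theorem exists_trajectory (hg : InwardField K g) {x : Fin d → ℝ}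
    (hx : x ∈ Icc (0 : Fin d → ℝ) 1) :
    ∃ γ : ℝ → Fin d → ℝ, γ 0 = x ∧
      ∀ t ∈ Icc (0 : ℝ) 1, HasDerivWithinAt γ (g (withTime (γ t) t)) (Icc 0 1) t := by
  obtain ⟨C, hC⟩ := isCompact_Icc.exists_bound_of_continuousOn hg.continuousOn
  have hmem : ∀ y : Fin d → ℝ, ∀ t ∈ Icc (0 : ℝ) 1,
      withTime (clampCube y) t ∈ Icc (0 : Fin (d + 1) → ℝ) 1 := fun y t ht =>
    withTime_mem_cube.2 ⟨clampCube_mem y, ht⟩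
  -- With speed at most `C` and time at most `1`, the ball of radius `C` suffices for the whole
  -- interval.
  have hpl : IsPicardLindelof (fun t y => g (withTime (clampCube y) t))
      (⟨0, left_mem_Icc.2 zero_le_one⟩ : Icc (0 : ℝ) 1) x (Real.toNNReal C) 0 (Real.toNNReal C)
      (Real.toNNReal K) := by
    refine ⟨fun t ht => ?_, fun y _ => ?_, fun t ht y _ => ?_, by simp⟩
    · refine LipschitzOnWith.of_dist_le_mul fun y _ y' _ => ?_
      rw [dist_eq_norm, dist_eq_norm]
      refine (hg.lipschitz _ (hmem y t ht) _ (hmem y' t ht)).trans ?_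
      exact mul_le_mul (Real.le_coe_toNNReal K) ((norm_withTime_sub_withTime _ _ _).trans
        (norm_clampCube_sub_le _ _)) (norm_nonneg _) NNReal.zero_le_coe
    · refine hg.continuousOn.comp (f := fun t => withTime (clampCube y) t) ?_
        (fun t ht => hmem y t ht)
      refine (continuous_pi fun j => ?_).continuousOn
      induction j using Fin.lastCases with
      | last => simp only [withTime_last]; exact continuous_id
      | cast j => simpa using continuous_const
    · exact (hC _ (hmem y t ht)).trans (Real.le_coe_toNNReal C)
  obtain ⟨γ, hγ0, hγ⟩ := hpl.exists_eq_forall_mem_Icc_hasDerivWithinAt₀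
  simp only at hγ0 hγ
  have hin := mem_cube_of_inward (γ := γ) (by rw [hγ0]; exact hx) hγ fun t ht htc j => by
    rw [clampCube_of_mem htc]
    simpa using hg.inward _ (withTime_mem_cube.2 ⟨htc, ht⟩) j
  refine ⟨γ, hγ0, fun t ht => ?_⟩
  have := hγ t ht
  rwa [clampCube_of_mem (hin t ht)] at this

/-- Comparison of trajectories of a field `f` that is Lipschitz on the cube with those of a nearby
inward field. -/
theorem dist_le {f : (Fin (d + 1) → ℝ) → Fin d → ℝ} {L δ η : ℝ} (hL : 0 < L)
    (hf : ∀ z ∈ Icc (0 : Fin (d + 1) → ℝ) 1, ∀ z' ∈ Icc (0 : Fin (d + 1) → ℝ) 1,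
      ‖f z - f z'‖ ≤ L * ‖z - z'‖)
    (hfg : ∀ z ∈ Icc (0 : Fin (d + 1) → ℝ) 1, ‖g z - f z‖ ≤ δ) {X γ : ℝ → Fin d → ℝ}
    (hX : ∀ t ∈ Icc (0 : ℝ) 1, HasDerivWithinAt X (f (withTime (X t) t)) (Icc 0 1) t)
    (hXc : ∀ t ∈ Icc (0 : ℝ) 1, X t ∈ Icc (0 : Fin d → ℝ) 1)
    (hγ : ∀ t ∈ Icc (0 : ℝ) 1, HasDerivWithinAt γ (g (withTime (γ t) t)) (Icc 0 1) t)
    (hγc : ∀ t ∈ Icc (0 : ℝ) 1, γ t ∈ Icc (0 : Fin d → ℝ) 1) (h0 : ‖X 0 - γ 0‖ ≤ η) :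
    ‖X 1 - γ 1‖ ≤ η * Real.exp L + δ / L * (Real.exp L - 1) := by
  have hIco : ∀ t ∈ Ico (0 : ℝ) 1, t ∈ Icc (0 : ℝ) 1 := fun t ht => ⟨ht.1, ht.2.le⟩
  have h := dist_le_of_approx_trajectories_ODE_of_mem (a := 0) (b := 1) (K := Real.toNNReal L)
    (v := fun t y => f (withTime y t)) (s := fun _ => Icc (0 : Fin d → ℝ) 1) (f := X) (g := γ)
    (f' := fun t => f (withTime (X t) t)) (g' := fun t => g (withTime (γ t) t)) (εf := 0) (εg := δ)
    (δ := η) (fun t ht => ?_) (fun t ht => (hX t ht).continuousWithinAt)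
    (fun t ht => (hX t (hIco t ht)).mono_of_mem_nhdsWithin (Icc_mem_nhdsGE_of_mem ht))
    (fun t _ => by simp) (fun t ht => hXc t (hIco t ht))
    (fun t ht => (hγ t ht).continuousWithinAt)
    (fun t ht => (hγ t (hIco t ht)).mono_of_mem_nhdsWithin (Icc_mem_nhdsGE_of_mem ht))
    (fun t ht => ?_) (fun t ht => hγc t (hIco t ht)) (by rwa [dist_eq_norm]) 1
    (right_mem_Icc.2 zero_le_one)
  · rw [gronwallBound_of_K_ne_0 (by rw [Real.coe_toNNReal _ hL.le]; exact hL.ne'),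
      Real.coe_toNNReal _ hL.le, dist_eq_norm] at h
    simpa using h
  · refine LipschitzOnWith.of_dist_le_mul fun y hy y' hy' => ?_
    rw [dist_eq_norm, dist_eq_norm, Real.coe_toNNReal _ hL.le]
    refine (hf _ (withTime_mem_cube.2 ⟨hy, hIco t ht⟩) _
      (withTime_mem_cube.2 ⟨hy', hIco t ht⟩)).trans ?_
    gcongr
    exact norm_withTime_sub_withTime _ _ _
  · rw [dist_eq_norm]
    exact hfg _ (withTime_mem_cube.2 ⟨hγc t (hIco t ht), hIco t ht⟩)

end InwardField

end InwardField

/-! ### The network velocity field. -/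

section NetworkVelocity

variable {d : ℕ}

/-- `space` as a continuous linear map. -/
def spaceCLM (d : ℕ) : (Fin (d + 1) → ℝ) →L[ℝ] Fin d → ℝ :=
  ContinuousLinearMap.pi fun j => ContinuousLinearMap.proj (R := ℝ) (φ := fun _ => ℝ) j.castSucc

theorem spaceCLM_apply (z : Fin (d + 1) → ℝ) : spaceCLM d z = space z := rfl

theorem norm_spaceCLM_le : ‖spaceCLM d‖ ≤ 1 :=
  ContinuousLinearMap.opNorm_le_bound _ zero_le_one fun z => by
    rw [one_mul]
    exact (pi_norm_le_iff_of_nonneg (norm_nonneg _)).2 fun j => norm_le_pi_norm z j.castSucc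

theorem norm_withTime_one_le (v : Fin d → ℝ) : ‖withTime v 1‖ ≤ ‖v‖ + 1 := by
  refine (pi_norm_le_iff_of_nonneg (by positivity)).2 fun j => ?_
  induction j using Fin.lastCases with
  | last => simp
  | cast j =>
    rw [withTime_castSucc]
    linarith [norm_le_pi_norm v j]

/-- The field `f` with a push towards the centre of the cube. -/
def pushed (f : (Fin (d + 1) → ℝ) → Fin d → ℝ) (ε : ℝ) (z : Fin (d + 1) → ℝ) : Fin d → ℝ :=
  f z + ε • (fun _ => 2) - (4 * ε) • spaceCLM d z

theorem exists_pushed_bound (k : ℕ) (M : ℝ) : ∃ M' : ℝ, ∀ f : (Fin (d + 1) → ℝ) → Fin d → ℝ,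
    ContDiffOn ℝ k f (Icc 0 1) →
    (∀ m ≤ k, ∀ x ∈ Icc (0 : Fin (d + 1) → ℝ) 1, ‖iteratedFDerivWithin ℝ m f (Icc 0 1) x‖ ≤ M) →
    ∀ ε ∈ Icc (0 : ℝ) 1, ContDiffOn ℝ k (pushed f ε) (Icc 0 1) ∧
    ∀ m ≤ k, ∀ x ∈ Icc (0 : Fin (d + 1) → ℝ) 1,
      ‖iteratedFDerivWithin ℝ m (pushed f ε) (Icc 0 1) x‖ ≤ M' := by
  let I := {f : (Fin (d + 1) → ℝ) → Fin d → ℝ // ContDiffOn ℝ k f (Icc 0 1) ∧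
    ∀ m ≤ k, ∀ x ∈ Icc (0 : Fin (d + 1) → ℝ) 1, ‖iteratedFDerivWithin ℝ m f (Icc 0 1) x‖ ≤ M} ×
      Icc (0 : ℝ) 1
  have hu : UniqueDiffOn ℝ (Icc (0 : Fin (d + 1) → ℝ) 1) := uniqueDiffOn_cube
  have hε : ∀ i : I, |(i.2 : ℝ)| ≤ 1 := fun i => by rw [abs_of_nonneg i.2.2.1]; exact i.2.2.2
  have h1 : UnifCk k (fun (i : I) => i.1.1) (Icc 0 1) := ⟨M, fun i => i.1.2⟩
  have h2 : UnifCk k (fun (i : I) (_ : Fin (d + 1) → ℝ) => (i.2 : ℝ) • (fun _ : Fin d => (2 : ℝ)))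
      (Icc 0 1) := by
    refine UnifCk.const _ (C := ‖fun _ : Fin d => (2 : ℝ)‖) fun i => ?_
    rw [norm_smul]
    exact mul_le_of_le_one_left (norm_nonneg _) (hε i)
  have h3 : UnifCk k (fun (i : I) (z : Fin (d + 1) → ℝ) => (4 * (i.2 : ℝ)) • spaceCLM d z)
      (Icc 0 1) := by
    refine UnifCk.smul (UnifCk.const _ (C := 4) fun i => ?_)
      (UnifCk.of_contDiffOn (spaceCLM d).contDiff.contDiffOn hu isCompact_Icc) hu
    rw [Real.norm_eq_abs, abs_mul, abs_of_nonneg (by norm_num : (0 : ℝ) ≤ 4)]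
    linarith [hε i]
  obtain ⟨M', hM'⟩ := (h1.add h2 hu).sub h3 hu
  exact ⟨M', fun f hf hM ε hε => hM' (⟨f, hf, hM⟩, ⟨ε, hε⟩)⟩

theorem norm_pushed_sub_le (f : (Fin (d + 1) → ℝ) → Fin d → ℝ) {ε : ℝ} (hε : 0 ≤ ε)
    {z : Fin (d + 1) → ℝ} (hz : z ∈ Icc (0 : Fin (d + 1) → ℝ) 1) :
    ‖pushed f ε z - f z‖ ≤ 2 * ε := by
  refine (pi_norm_le_iff_of_nonneg (by positivity)).2 fun j => ?_
  have hj := cube_apply hz j.castSucc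
  simp only [pushed, spaceCLM_apply, space, Pi.sub_apply, Pi.add_apply, Pi.smul_apply, smul_eq_mul,
    Real.norm_eq_abs]
  rw [abs_le]
  constructor <;> nlinarith [hj.1, hj.2]

/-- The network approximates the pushed field to accuracy `ε` in value and derivative, with `N` of
order `ε^{-1/k}`. The push changes values by at most `2ε` and derivatives by at most `4ε`; this
explains the constants `3ε` and `5ε`, and the Lipschitz constant `M + 5`. -/
theorem exists_network_velocity (d : ℕ) {k : ℕ} (hk : 1 ≤ k) (M : ℝ) :
    ∃ C A : ℝ, 0 ≤ A ∧ ∀ f : (Fin (d + 1) → ℝ) → Fin d → ℝ, ContDiffOn ℝ (k + 1 : ℕ) f (Icc 0 1) →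
    (∀ m ≤ k + 1, ∀ x ∈ Icc (0 : Fin (d + 1) → ℝ) 1,
      ‖iteratedFDerivWithin ℝ m f (Icc 0 1) x‖ ≤ M) →
    (∀ z ∈ Icc (0 : Fin (d + 1) → ℝ) 1, ∀ j : Fin d,
      z j.castSucc = 0 ∨ z j.castSucc = 1 → f z j = 0) →
    (∀ z ∈ Icc (0 : Fin (d + 1) → ℝ) 1,
      fderivWithin ℝ f (Icc 0 1) z (withTime (f z) 1) = 0) →
    ∀ ε : ℝ, 0 < ε → ε ≤ 1 → ∃ (W S : ℕ) (B : ℝ),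
      ∃ φ ∈ reluSqClass (d + 1) d (d + 1 + (k + 1) + 2) W S B,
        (W : ℝ) ≤ C * ε ^ (-(((d : ℝ) + 1) / k)) ∧ (S : ℝ) ≤ C * ε ^ (-(((d : ℝ) + 1) / k)) ∧
        B ≤ C * ε ^ (-(1 / (k : ℝ))) ∧ Differentiable ℝ φ ∧ InwardField (M + 5) φ ∧
        ∀ z ∈ Icc (0 : Fin (d + 1) → ℝ) 1, ‖φ z - f z‖ ≤ 3 * ε ∧
          ‖fderiv ℝ φ z (withTime (φ z) 1)‖ ≤ A * ε := by
  obtain ⟨K, hK⟩ := exists_network_approx (d + 1) d k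
  obtain ⟨M', hM'⟩ := exists_pushed_bound (d := d) (k + 1) M
  set E : ℝ := 2 ^ (d + 1) * ((1 + 2 * (d + 1 : ℕ)) * |M'|) with hE
  have hE0 : 0 ≤ E := by positivity
  -- With `r ^ k = ε⁻¹` and `N ≥ P * r`, the inequality `P ≤ P ^ k` gives `E * N ^ (-k) ≤ ε`.
  set P : ℝ := 1 + E with hP
  refine ⟨K * (P + 2) ^ (d + 1) + (|M'| + 8) * (P + 1), 5 * (|M| + 4) + |M| * 3, by positivity,
    fun f hf hM hface hacc ε hε0 hε1 => ?_⟩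
  obtain ⟨hpd, hpM⟩ := hM' f hf hM ε ⟨hε0.le, hε1⟩
  have hu : UniqueDiffOn ℝ (Icc (0 : Fin (d + 1) → ℝ) 1) := uniqueDiffOn_cube
  have hM0 : 0 ≤ M := (norm_nonneg _).trans
    (hM 0 (Nat.zero_le _) 0 (left_mem_Icc.2 zero_le_one))
  have hk0 : (0 : ℝ) < k := by exact_mod_cast hk
  set r : ℝ := ε ^ (-(1 / (k : ℝ))) with hr
  have hr1 : 1 ≤ r := Real.one_le_rpow_of_pos_of_le_one_of_nonpos hε0 hε1
    (by rw [neg_nonpos]; positivity)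
  have hrk : r ^ k = ε⁻¹ := by
    rw [hr, ← Real.rpow_natCast, ← Real.rpow_mul hε0.le, neg_mul, one_div_mul_cancel hk0.ne',
      Real.rpow_neg_one]
  have hrd : r ^ (d + 1) = ε ^ (-(((d : ℝ) + 1) / k)) := by
    rw [hr, ← Real.rpow_natCast, ← Real.rpow_mul hε0.le]
    congr 1
    push_cast
    ring
  set N := ⌈P * r⌉₊ with hN
  have hP1 : 1 ≤ P := by linarith
  have hPr : P * r ≤ N := Nat.le_ceil _
  have hNle : (N : ℝ) ≤ (P + 1) * r := by
    have := (Nat.ceil_lt_add_one (by positivity : 0 ≤ P * r)).le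
    linarith
  have hN1 : 1 ≤ N := by
    have h1 : (1 : ℝ) ≤ N := (one_le_mul_of_one_le_of_one_le hP1 hr1).trans hPr
    exact_mod_cast h1
  obtain ⟨W, S, φ, hφ, hW, hS, hdiff, herr⟩ := hK M' (pushed f ε) (by exact_mod_cast hpd) hpM N hN1
  have hsmall : 2 ^ (d + 1) * ((1 + 2 * (d + 1 : ℕ)) * M') * (N : ℝ)⁻¹ ^ k ≤ ε := by
    have h1 : P * ε⁻¹ ≤ (N : ℝ) ^ k := by
      rw [← hrk]
      calc P * r ^ k ≤ P ^ k * r ^ k := by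
            gcongr
            exact le_self_pow₀ hP1 (by omega)
        _ = (P * r) ^ k := (mul_pow _ _ _).symm
        _ ≤ (N : ℝ) ^ k := by gcongr
    have h2 : 2 ^ (d + 1) * ((1 + 2 * (d + 1 : ℕ)) * M') ≤ P := by
      refine le_trans ?_ (by linarith : E ≤ P)
      rw [hE]
      gcongr
      exact le_abs_self M'
    have hNk : (0 : ℝ) < (N : ℝ) ^ k := by positivity
    rw [inv_pow, mul_inv_le_iff₀ hNk]
    calc _ ≤ P := h2
      _ = ε * (P * ε⁻¹) := by field_simp
      _ ≤ ε * (N : ℝ) ^ k := by gcongr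
  have hval : ∀ z ∈ Icc (0 : Fin (d + 1) → ℝ) 1, ‖φ z - pushed f ε z‖ ≤ ε := fun z hz =>
    (herr z hz).1.trans hsmall
  have hfd : ∀ z ∈ Icc (0 : Fin (d + 1) → ℝ) 1,
      HasFDerivWithinAt f (fderivWithin ℝ f (Icc 0 1) z) (Icc 0 1) z := fun z hz =>
    ((hf.differentiableOn (by norm_cast)) z hz).hasFDerivWithinAt
  have hpfd : ∀ z ∈ Icc (0 : Fin (d + 1) → ℝ) 1, fderivWithin ℝ (pushed f ε) (Icc 0 1) z =
      fderivWithin ℝ f (Icc 0 1) z - (4 * ε) • spaceCLM d := fun z hz =>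
    (((hfd z hz).add_const _).sub
      ((spaceCLM d).hasFDerivWithinAt.const_smul (4 * ε))).fderivWithin (hu z hz)
  have hder : ∀ z ∈ Icc (0 : Fin (d + 1) → ℝ) 1,
      ‖fderiv ℝ φ z - fderivWithin ℝ f (Icc 0 1) z‖ ≤ 5 * ε := by
    intro z hz
    have h1 := (herr z hz).2.trans hsmall
    rw [hpfd z hz] at h1
    have h2 : ‖(4 * ε) • spaceCLM d‖ ≤ 4 * ε := by
      rw [norm_smul, Real.norm_of_nonneg (by positivity)]
      exact mul_le_of_le_one_right (by positivity) norm_spaceCLM_le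
    calc _ = ‖(fderiv ℝ φ z - (fderivWithin ℝ f (Icc 0 1) z - (4 * ε) • spaceCLM d)) -
          (4 * ε) • spaceCLM d‖ := by congr 1; abel
      _ ≤ _ := (norm_sub_le _ _).trans (by linarith)
  have hfdM : ∀ z ∈ Icc (0 : Fin (d + 1) → ℝ) 1, ‖fderivWithin ℝ f (Icc 0 1) z‖ ≤ M := by
    intro z hz
    rw [← norm_iteratedFDerivWithin_one f (hu z hz)]
    exact hM 1 (by omega) z hz
  have hfM : ∀ z ∈ Icc (0 : Fin (d + 1) → ℝ) 1, ‖f z‖ ≤ M := by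
    intro z hz
    simpa using hM 0 (Nat.zero_le _) z hz
  have hclose : ∀ z ∈ Icc (0 : Fin (d + 1) → ℝ) 1, ‖φ z - f z‖ ≤ 3 * ε := fun z hz => by
    have h1 := norm_pushed_sub_le f hε0.le hz
    have h2 := hval z hz
    linarith [norm_sub_le_norm_sub_add_norm_sub (φ z) (pushed f ε z) (f z)]
  have hCW : (K : ℝ) * ((N : ℝ) + 1) ^ (d + 1) ≤
      (K * (P + 2) ^ (d + 1) + (|M'| + 8) * (P + 1)) * r ^ (d + 1) := by
    calc (K : ℝ) * ((N : ℝ) + 1) ^ (d + 1) ≤ K * ((P + 2) * r) ^ (d + 1) := by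
          gcongr
          linarith
      _ = K * (P + 2) ^ (d + 1) * r ^ (d + 1) := by rw [mul_pow]; ring
      _ ≤ _ := by
          gcongr
          exact le_add_of_nonneg_right (by positivity)
  refine ⟨W, S, _, φ, hφ, ?_, ?_, ?_, hdiff, ⟨fun z hz z' hz' => ?_, fun z hz j => ?_⟩,
    fun z hz => ⟨hclose z hz, ?_⟩⟩
  · rw [← hrd]
    refine le_trans ?_ hCW
    exact_mod_cast hW
  · rw [← hrd]
    refine le_trans ?_ hCW
    exact_mod_cast hS
  · calc (|M'| + 8) * (N : ℝ) ≤ (|M'| + 8) * ((P + 1) * r) := by gcongr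
      _ = (|M'| + 8) * (P + 1) * r := by ring
      _ ≤ _ := by
          gcongr
          exact le_add_of_nonneg_left (by positivity)
  · refine convex_cube.norm_image_sub_le_of_norm_fderiv_le (𝕜 := ℝ) (fun y _ => hdiff y)
      (fun y hy => ?_) hz' hz
    have h1 := norm_sub_norm_le (fderiv ℝ φ y) (fderivWithin ℝ f (Icc 0 1) y)
    linarith [hder y hy, hfdM y hy]
  -- On a face the normal component of `f` vanishes and the push is `±2ε` inwards, so an error of at
  -- most `ε` leaves it strictly inward.
  · have h1 := (norm_le_pi_norm (φ z - pushed f ε z) j).trans (hval z hz)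
    simp only [pushed, spaceCLM_apply, space, Pi.sub_apply, Pi.add_apply, Pi.smul_apply,
      smul_eq_mul, Real.norm_eq_abs] at h1
    constructor
    · intro hj
      rw [hface z hz j (Or.inl hj), hj] at h1
      linarith [(abs_le.1 h1).1]
    · intro hj
      rw [hface z hz j (Or.inr hj), hj] at h1
      linarith [(abs_le.1 h1).2]
  -- Because `Df (f, 1) = 0`, the acceleration is `(Dφ - Df)(φ, 1) + Df ((φ, 1) - (f, 1))`, and both
  -- terms are of order `ε`.
  · have hsplit : fderiv ℝ φ z (withTime (φ z) 1) =
        (fderiv ℝ φ z - fderivWithin ℝ f (Icc 0 1) z) (withTime (φ z) 1) +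
          fderivWithin ℝ f (Icc 0 1) z (withTime (φ z) 1 - withTime (f z) 1) := by
      rw [map_sub, hacc z hz, sub_zero, _root_.sub_apply, sub_add_cancel]
    have hφM : ‖withTime (φ z) 1‖ ≤ |M| + 4 := by
      have h1 := norm_withTime_one_le (φ z)
      have h2 := norm_sub_norm_le (φ z) (f z)
      linarith [hclose z hz, hfM z hz, le_abs_self M]
    have hw := (norm_withTime_sub_withTime (φ z) (f z) 1).trans (hclose z hz)
    rw [hsplit]
    refine (norm_add_le _ _).trans ?_
    have h1 : ‖(fderiv ℝ φ z - fderivWithin ℝ f (Icc 0 1) z) (withTime (φ z) 1)‖ ≤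
        5 * ε * (|M| + 4) := (ContinuousLinearMap.le_opNorm _ _).trans
      (mul_le_mul (hder z hz) hφM (norm_nonneg _) (by positivity))
    have h2 : ‖fderivWithin ℝ f (Icc 0 1) z (withTime (φ z) 1 - withTime (f z) 1)‖ ≤
        |M| * (3 * ε) := (ContinuousLinearMap.le_opNorm _ _).trans
      (mul_le_mul ((hfdM z hz).trans (le_abs_self M)) hw (norm_nonneg _) (abs_nonneg _))
    linarith

end NetworkVelocity

/-! ### Passage from the maximum norm to the Euclidean setting of the statement. -/

section Euclidean

variable {d k : ℕ}

/-- The identity, from the Euclidean norm to the maximum norm. -/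
abbrev toSup (d : ℕ) : EuclideanSpace ℝ (Fin d) ≃L[ℝ] (Fin d → ℝ) := EuclideanSpace.equiv (Fin d) ℝ

theorem toSup_preimage_cube : toSup d ⁻¹' Icc 0 1 = unitCube d := by
  ext x
  simp only [mem_preimage, mem_Icc, Pi.le_def, unitCube, mem_ofPred_eq]
  exact ⟨fun h i => ⟨h.1 i, h.2 i⟩, fun h => ⟨fun i => (h i).1, fun i => (h i).2⟩⟩

theorem mem_unitCube_iff {x : EuclideanSpace ℝ (Fin d)} :
    x ∈ unitCube d ↔ WithLp.ofLp x ∈ Icc (0 : Fin d → ℝ) 1 := by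
  rw [← toSup_preimage_cube]
  rfl

theorem isClosed_unitCube : IsClosed (unitCube d) :=
  toSup_preimage_cube (d := d) ▸ isClosed_Icc.preimage (toSup d).continuous

theorem volume_unitCube : volume (unitCube d) = 1 := by
  rw [← toSup_preimage_cube, ← volume_cube (n := d)]
  exact (PiLp.volume_preserving_ofLp (Fin d)).measure_preimage
    measurableSet_Icc.nullMeasurableSet

theorem norm_toLp_le (v : Fin d → ℝ) :
    ‖(WithLp.toLp 2 v : EuclideanSpace ℝ (Fin d))‖ ≤
      ‖((toSup d).symm : (Fin d → ℝ) →L[ℝ] EuclideanSpace ℝ (Fin d))‖ * ‖v‖ :=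
  ((toSup d).symm : (Fin d → ℝ) →L[ℝ] EuclideanSpace ℝ (Fin d)).le_opNorm v

theorem map_ofLp_withDensity (p : EuclideanSpace ℝ (Fin d) → ℝ≥0∞) :
    ((volume.restrict (unitCube d)).withDensity p).map WithLp.ofLp =
      (volume.restrict (Icc (0 : Fin d → ℝ) 1)).withDensity fun x => p (WithLp.toLp 2 x) := by
  have hm : MeasurableEmbedding (WithLp.ofLp : EuclideanSpace ℝ (Fin d) → Fin d → ℝ) :=
    (MeasurableEquiv.toLp 2 (Fin d → ℝ)).symm.measurableEmbedding
  ext s hs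
  rw [hm.map_apply, withDensity_apply _ (hm.measurable hs), withDensity_apply _ hs,
    Measure.restrict_restrict (hm.measurable hs), Measure.restrict_restrict hs,
    ← toSup_preimage_cube]
  exact (PiLp.volume_preserving_ofLp (Fin d)).setLIntegral_comp_preimage_emb hm
    (fun x => p (WithLp.toLp 2 x)) (s ∩ Icc 0 1)

/-- Changing the norm on the domain multiplies the `m`-th derivative by at most the `m`-th power of
an operator norm depending on `d` only. -/
theorem HasRegularDensity.exists_cubeDensity (k : ℕ) {L₁ L₂ : ℝ} (hL₁ : 0 ≤ L₁)
    {μ : Measure (EuclideanSpace ℝ (Fin d))} (hμ : IsProbabilityMeasure μ)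
    (h : HasRegularDensity d k L₁ L₂ μ) :
    ∃ q, CubeDensity k (L₁ *
        max 1 ‖((toSup d).symm : (Fin d → ℝ) →L[ℝ] EuclideanSpace ℝ (Fin d))‖ ^ k) L₂ q ∧
      μ.map WithLp.ofLp = (volume.restrict (Icc (0 : Fin d → ℝ) 1)).withDensity
        fun x => ENNReal.ofReal (q x) := by
  obtain ⟨p, hp, hnorm, hlow, rfl⟩ := h
  have hpre : (toSup d).symm ⁻¹' unitCube d = Icc 0 1 := by
    ext x
    exact mem_unitCube_iff
  have hmap := map_ofLp_withDensity (d := d) fun x => ENNReal.ofReal (p x)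
  refine ⟨p ∘ (toSup d).symm, ⟨?_, fun m hm x hx => ?_, fun x hx => hlow _ ?_, ?_⟩, hmap⟩
  · rw [← hpre]
    exact hp.comp_continuousLinearMap
      ((toSup d).symm : (Fin d → ℝ) →L[ℝ] EuclideanSpace ℝ (Fin d))
  · have hx' : (toSup d).symm x ∈ unitCube d := by rwa [← hpre] at hx
    have hu : UniqueDiffOn ℝ (unitCube d) := by
      rw [← toSup_preimage_cube]
      exact (ContinuousLinearEquiv.uniqueDiffOn_preimage_iff (toSup d)).2 uniqueDiffOn_cube
    have hbd : ‖iteratedFDerivWithin ℝ m p (unitCube d) ((toSup d).symm x)‖ ≤ L₁ := by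
      have h1 : ‖iteratedFDerivWithin ℝ m p (unitCube d) ((toSup d).symm x)‖ₑ ≤
          ENNReal.ofReal L₁ := le_trans (le_iSup₂_of_le m hm (le_iSup₂_of_le
          (f := fun x _ => ‖iteratedFDerivWithin ℝ m p (unitCube d) x‖ₑ) _ hx' le_rfl)) hnorm
      rwa [← ofReal_norm, ENNReal.ofReal_le_ofReal_iff hL₁] at h1
    have h2 := ContinuousLinearEquiv.iteratedFDerivWithin_comp_right (toSup d).symm p hu hx' m
    rw [hpre] at h2
    rw [h2]
    refine (ContinuousMultilinearMap.norm_compContinuousLinearMap_le _ _).trans ?_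
    rw [Finset.prod_const, Finset.card_univ, Fintype.card_fin]
    refine mul_le_mul hbd ?_ (by positivity) hL₁
    exact (pow_le_pow_left₀ (norm_nonneg _) (le_max_right _ _) m).trans
      (pow_le_pow_right₀ (le_max_left _ _) hm)
  · rw [← hpre] at hx
    exact hx
  · have := Measure.isProbabilityMeasure_map (μ := (volume.restrict (unitCube d)).withDensity
      fun x => ENNReal.ofReal (p x)) (f := (WithLp.ofLp : _ → Fin d → ℝ))
      (PiLp.volume_preserving_ofLp (Fin d)).measurable.aemeasurable
    rwa [hmap] at this

/-- The joint law of `T` and `Y` under `π` is a coupling, with cost at most `δ²`. -/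
theorem wassersteinDist_map_sq_le {E : Type*} [NormedAddCommGroup E] [MeasurableSpace E]
    [BorelSpace E] [SecondCountableTopology E] {π : Measure E} [IsProbabilityMeasure π]
    {T Y : E → E} (hT : AEMeasurable T π) (hY : AEMeasurable Y π) {δ : ℝ}
    (h : ∀ᵐ x ∂π, ‖T x - Y x‖ ≤ δ) :
    wassersteinDist 2 (π.map T) (π.map Y) ^ 2 ≤ ENNReal.ofReal (δ ^ 2) := by
  have hδ : 0 ≤ δ := let ⟨x, hx⟩ := h.exists; (norm_nonneg _).trans hx
  have hp := hT.prodMk hY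
  have h1 : (∫⁻ z, edist z.1 z.2 ^ (2 : ℝ) ∂π.map fun x => (T x, Y x)) ≤
      ENNReal.ofReal (δ ^ 2) := by
    rw [lintegral_map' (by fun_prop) hp]
    calc _ ≤ ∫⁻ _, ENNReal.ofReal (δ ^ 2) ∂π := by
          refine lintegral_mono_ae (h.mono fun x hx => ?_)
          rw [edist_dist, dist_eq_norm, ENNReal.ofReal_pow hδ, ENNReal.rpow_two]
          gcongr
      _ = _ := by simp
  rw [wassersteinDist, ← ENNReal.rpow_natCast, ← ENNReal.rpow_mul]
  norm_num
  refine (iInf₂_le (π.map fun x => (T x, Y x)) ⟨?_, ?_⟩).trans (by exact_mod_cast h1)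
  · exact AEMeasurable.map_map_of_aemeasurable measurable_fst.aemeasurable hp
  · exact AEMeasurable.map_map_of_aemeasurable measurable_snd.aemeasurable hp

theorem IsTrajectory.hasDerivWithinAt_ofLp {φ : (Fin (d + 1) → ℝ) → Fin d → ℝ}
    {x : EuclideanSpace ℝ (Fin d)} {γ : ℝ → EuclideanSpace ℝ (Fin d)}
    (h : IsTrajectory (toVelocity φ) x γ) : ∀ t ∈ Icc (0 : ℝ) 1,
      HasDerivWithinAt (fun s => WithLp.ofLp (γ s)) (φ (withTime (WithLp.ofLp (γ t)) t))
        (Icc 0 1) t := fun t ht =>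
  (toSup d : EuclideanSpace ℝ (Fin d) →L[ℝ] Fin d → ℝ).hasFDerivAt.comp_hasDerivWithinAt t (h.2 t ht)

namespace InwardField

variable {K : ℝ} {φ : (Fin (d + 1) → ℝ) → Fin d → ℝ}

/-- Uniqueness holds among all trajectories, not only those assumed to stay in the cube: inwardness
confines every competitor to the set where the field is Lipschitz. -/
theorem hasUniqueTrajectory (hφ : InwardField K φ) {x : EuclideanSpace ℝ (Fin d)}
    (hx : x ∈ unitCube d) : HasUniqueTrajectory (toVelocity φ) x := by
  obtain ⟨γ, h0, hγ⟩ := hφ.exists_trajectory (mem_unitCube_iff.1 hx)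
  have ht : IsTrajectory (toVelocity φ) x fun t => WithLp.toLp 2 (γ t) :=
    ⟨congrArg (WithLp.toLp 2) h0, fun t ht =>
      ((toSup d).symm : (Fin d → ℝ) →L[ℝ] EuclideanSpace ℝ (Fin d)).hasFDerivAt.comp_hasDerivWithinAt t (hγ t ht)⟩
  refine ⟨_, ht, fun γ' hγ' t htI => ?_⟩
  have h0' : WithLp.ofLp (γ' 0) = γ 0 := by rw [hγ'.1, h0]
  have hd' := hγ'.hasDerivWithinAt_ofLp
  have hx' := mem_unitCube_iff.1 hx
  have hIco : ∀ t ∈ Ico (0 : ℝ) 1, t ∈ Icc (0 : ℝ) 1 := fun t ht => ⟨ht.1, ht.2.le⟩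
  have := ODE_solution_unique_of_mem_Icc_right (v := fun t y => φ (withTime y t))
    (s := fun _ => Icc (0 : Fin d → ℝ) 1) (fun t ht => hφ.lipschitzOnWith (hIco t ht))
    (fun t ht => (hd' t ht).continuousWithinAt)
    (fun t ht => (hd' t (hIco t ht)).mono_of_mem_nhdsWithin (Icc_mem_nhdsGE_of_mem ht))
    (fun t ht => hφ.mem_cube (by rw [h0', h0]; exact hx') hd' t (hIco t ht))
    (fun t ht => (hγ t ht).continuousWithinAt)
    (fun t ht => (hγ t (hIco t ht)).mono_of_mem_nhdsWithin (Icc_mem_nhdsGE_of_mem ht))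
    (fun t ht => hφ.mem_cube (by rwa [h0]) hγ t (hIco t ht)) h0' htI
  exact congrArg (WithLp.toLp 2) this

theorem isTrajectory_flowMap (hφ : InwardField K φ) {x : EuclideanSpace ℝ (Fin d)}
    (hx : x ∈ unitCube d) : IsTrajectory (toVelocity φ) x (flowMap (toVelocity φ) x) := by
  have h : ∃ γ, IsTrajectory (toVelocity φ) x γ :=
    let ⟨γ, hγ, _⟩ := hφ.hasUniqueTrajectory hx
    ⟨γ, hγ⟩
  have he : flowMap (toVelocity φ) x = h.choose := funext fun t => dif_pos h
  rw [he]
  exact h.choose_spec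

theorem flowMap_mem (hφ : InwardField K φ) {x : EuclideanSpace ℝ (Fin d)}
    (hx : x ∈ unitCube d) {t : ℝ} (ht : t ∈ Icc (0 : ℝ) 1) :
    flowMap (toVelocity φ) x t ∈ unitCube d := by
  have h := hφ.isTrajectory_flowMap hx
  exact mem_unitCube_iff.2 (hφ.mem_cube (by rw [h.1]; exact mem_unitCube_iff.1 hx)
    h.hasDerivWithinAt_ofLp t ht)

/-- The Grönwall comparison of the field with itself, with no perturbation and different starting
points. Continuity makes the time-one map almost everywhere measurable, without which its
push-forward would be meaningless. -/
theorem continuousOn_flowMap (hφ : InwardField K φ) (hK : 0 < K) :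
    ContinuousOn (fun x => flowMap (toVelocity φ) x 1) (unitCube d) := by
  have h1 : LipschitzOnWith (Real.toNNReal (Real.exp K))
      (fun x => WithLp.ofLp (flowMap (toVelocity φ) (WithLp.toLp 2 x) 1))
      (Icc (0 : Fin d → ℝ) 1) := by
    refine LipschitzOnWith.of_dist_le_mul fun x hx y hy => ?_
    have hx' : WithLp.toLp 2 x ∈ unitCube d := mem_unitCube_iff.2 hx
    have hy' : WithLp.toLp 2 y ∈ unitCube d := mem_unitCube_iff.2 hy
    have := InwardField.dist_le hK hφ.lipschitz (δ := 0) (fun z _ => by simp)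
      (hφ.isTrajectory_flowMap hx').hasDerivWithinAt_ofLp
      (fun t ht => mem_unitCube_iff.1 (hφ.flowMap_mem hx' ht))
      (hφ.isTrajectory_flowMap hy').hasDerivWithinAt_ofLp
      (fun t ht => mem_unitCube_iff.1 (hφ.flowMap_mem hy' ht)) (η := ‖x - y‖)
      (by rw [(hφ.isTrajectory_flowMap hx').1, (hφ.isTrajectory_flowMap hy').1])
    rw [dist_eq_norm, dist_eq_norm, Real.coe_toNNReal _ (Real.exp_pos K).le]
    simpa [mul_comm] using this
  exact (toSup d).symm.continuous.comp_continuousOn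
    (h1.continuousOn.comp (toSup d).continuous.continuousOn fun x hx => mem_unitCube_iff.1 hx)

end InwardField

/-- The Lagrangian acceleration is the space-time derivative in the direction `(φ, 1)`, the quantity
controlled in the approximation. -/
theorem acceleration_toVelocity {φ : (Fin (d + 1) → ℝ) → Fin d → ℝ} (hφ : Differentiable ℝ φ)
    (x : EuclideanSpace ℝ (Fin d)) (t : ℝ) :
    acceleration (toVelocity φ) x t =
      WithLp.toLp 2 (fderiv ℝ φ (withTime (WithLp.ofLp x) t)
        (withTime (φ (withTime (WithLp.ofLp x) t)) 1)) := by
  set z := withTime (WithLp.ofLp x) t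
  let ι : (Fin d → ℝ) →L[ℝ] Fin (d + 1) → ℝ := ContinuousLinearMap.pi
    (Fin.snoc (α := fun _ => (Fin d → ℝ) →L[ℝ] ℝ) (fun j => ContinuousLinearMap.proj j) 0)
  have hι : ∀ v, ι v = withTime v 0 := fun v => by
    ext j
    induction j using Fin.lastCases with
    | last => simp [ι]
    | cast j => simp [ι]
  have hadd : ∀ (v : Fin d → ℝ) (s : ℝ), withTime v s = ι v + withTime 0 s := fun v s => by
    rw [hι]
    ext j
    induction j using Fin.lastCases with
    | last => simp
    | cast j => simp
  have h1 : HasFDerivAt (fun y => toVelocity φ y t)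
      (((toSup d).symm : (Fin d → ℝ) →L[ℝ] EuclideanSpace ℝ (Fin d)).comp
        ((fderiv ℝ φ z).comp (ι.comp (toSup d : EuclideanSpace ℝ (Fin d) →L[ℝ] Fin d → ℝ)))) x := by
    have h2 : HasFDerivAt (fun y : EuclideanSpace ℝ (Fin d) => withTime (WithLp.ofLp y) t)
        (ι.comp (toSup d : EuclideanSpace ℝ (Fin d) →L[ℝ] Fin d → ℝ)) x := by
      rw [show (fun y : EuclideanSpace ℝ (Fin d) => withTime (WithLp.ofLp y) t) =
        fun y => ι (WithLp.ofLp y) + withTime 0 t from funext fun y => hadd _ _]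
      exact (ι.comp (toSup d : EuclideanSpace ℝ (Fin d) →L[ℝ] Fin d → ℝ)).hasFDerivAt.add_const _
    exact ((toSup d).symm : (Fin d → ℝ) →L[ℝ] EuclideanSpace ℝ (Fin d)).hasFDerivAt.comp x
      ((hφ z).hasFDerivAt.comp x h2)
  have h3 : HasDerivAt (fun s => toVelocity φ x s)
      (WithLp.toLp 2 (fderiv ℝ φ z (withTime 0 1))) t := by
    have h4 : HasDerivAt (fun s => withTime (WithLp.ofLp x) s) (withTime (0 : Fin d → ℝ) 1) t := by
      refine hasDerivAt_pi.2 fun j => ?_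
      induction j using Fin.lastCases with
      | last => simpa using hasDerivAt_id' t
      | cast j => simpa using hasDerivAt_const t _
    exact ((toSup d).symm : (Fin d → ℝ) →L[ℝ] EuclideanSpace ℝ (Fin d)).hasFDerivAt.comp_hasDerivAt
      t ((hφ z).hasFDerivAt.comp_hasDerivAt t h4)
  rw [acceleration, h1.fderiv, h3.deriv, hadd (φ z) 1, map_add]
  rfl

theorem pathRegularizer_le {f : EuclideanSpace ℝ (Fin d) → ℝ → EuclideanSpace ℝ (Fin d)}
    {x : EuclideanSpace ℝ (Fin d)} {a : ℝ} (ha : 0 ≤ a)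
    (h : ∀ t ∈ Icc (0 : ℝ) 1, ‖acceleration f (flowMap f x t) t‖ ≤ a) :
    pathRegularizer f x ≤ ENNReal.ofReal (a ^ 2) := by
  calc pathRegularizer f x ≤ ∫⁻ _ in Icc (0 : ℝ) 1, ENNReal.ofReal (a ^ 2) := by
        refine setLIntegral_mono' measurableSet_Icc fun t ht => ?_
        rw [ENNReal.ofReal_pow ha, ← ofReal_norm]
        gcongr
        exact h t ht
    _ = _ := by simp

theorem regularizer_le {f : EuclideanSpace ℝ (Fin d) → ℝ → EuclideanSpace ℝ (Fin d)} {c : ℝ≥0∞}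
    (h : ∀ x ∈ unitCube d, pathRegularizer f x ≤ c) : regularizer f ≤ c := by
  calc regularizer f ≤ ∫⁻ _ in unitCube d, c :=
        setLIntegral_mono' isClosed_unitCube.measurableSet h
    _ = c := by simp [volume_unitCube]

end Euclidean

/-! ### Bounds for the two terms of the objective. -/

section Objective

variable {d k : ℕ}

/-- A transport map between the measures with densities `q₀` and `q₁`, in the coordinates of the
cube, yields a bound on the Wasserstein loss of any field whose flow is close to that map. -/
theorem wassersteinLoss_le {ρ π : Measure (EuclideanSpace ℝ (Fin d))} [IsProbabilityMeasure π]
    (hπ : π ≪ volume.restrict (unitCube d)) {q₀ q₁ : (Fin d → ℝ) → ℝ≥0∞}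
    (hπq : π.map WithLp.ofLp = (volume.restrict (Icc (0 : Fin d → ℝ) 1)).withDensity q₀)
    (hρq : ρ.map WithLp.ofLp = (volume.restrict (Icc (0 : Fin d → ℝ) 1)).withDensity q₁)
    {T : (Fin d → ℝ) → Fin d → ℝ} (hT : ContinuousOn T (Icc 0 1))
    (hmap : ((volume.restrict (Icc (0 : Fin d → ℝ) 1)).withDensity q₀).map T =
      (volume.restrict (Icc (0 : Fin d → ℝ) 1)).withDensity q₁)
    {g : EuclideanSpace ℝ (Fin d) → ℝ → EuclideanSpace ℝ (Fin d)}
    (hg : ContinuousOn (fun x => flowMap g x 1) (unitCube d)) {δ : ℝ}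
    (h : ∀ x ∈ unitCube d, ‖T (WithLp.ofLp x) - WithLp.ofLp (flowMap g x 1)‖ ≤ δ) :
    wassersteinLoss ρ π g ≤ ENNReal.ofReal
      ((‖((toSup d).symm : (Fin d → ℝ) →L[ℝ] EuclideanSpace ℝ (Fin d))‖ * δ) ^ 2) := by
  have hU : MeasurableSet (unitCube d) := isClosed_unitCube.measurableSet
  have hm : Measurable (WithLp.ofLp : EuclideanSpace ℝ (Fin d) → Fin d → ℝ) :=
    (PiLp.volume_preserving_ofLp (Fin d)).measurable
  have hm' : Measurable (WithLp.toLp 2 : (Fin d → ℝ) → EuclideanSpace ℝ (Fin d)) :=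
    (PiLp.volume_preserving_toLp (Fin d)).measurable
  have hTm : AEMeasurable T (π.map WithLp.ofLp) := by
    rw [hπq]
    exact (hT.aemeasurable measurableSet_Icc).mono_ac (withDensity_absolutelyContinuous _ _)
  have hTm' : AEMeasurable (T ∘ WithLp.ofLp) π := hTm.comp_measurable hm
  have hTT : AEMeasurable (fun x => (WithLp.toLp 2 (T (WithLp.ofLp x)) :
      EuclideanSpace ℝ (Fin d))) π := hm'.comp_aemeasurable hTm'
  have hρ : π.map (fun x => (WithLp.toLp 2 (T (WithLp.ofLp x)) : EuclideanSpace ℝ (Fin d))) = ρ := by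
    calc _ = ((π.map WithLp.ofLp).map T).map (WithLp.toLp 2) := by
          rw [AEMeasurable.map_map_of_aemeasurable hTm hm.aemeasurable,
            AEMeasurable.map_map_of_aemeasurable hm'.aemeasurable hTm']
          rfl
      _ = (ρ.map WithLp.ofLp).map (WithLp.toLp 2) := by rw [hπq, hmap, hρq]
      _ = ρ := by
          rw [Measure.map_map hm' hm]
          exact Measure.map_id
  rw [wassersteinLoss]
  conv_lhs => rw [← hρ]
  refine wassersteinDist_map_sq_le hTT ((hg.aemeasurable hU).mono_ac hπ) ?_
  filter_upwards [hπ.ae_le (ae_restrict_mem hU)] with x hx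
  calc _ = ‖(WithLp.toLp 2 (T (WithLp.ofLp x) - WithLp.ofLp (flowMap g x 1)) :
        EuclideanSpace ℝ (Fin d))‖ := rfl
    _ ≤ _ := norm_toLp_le _
    _ ≤ _ := by
        gcongr
        exact h x hx

theorem pathRegularizer_toVelocity_le {φ : (Fin (d + 1) → ℝ) → Fin d → ℝ} {K a : ℝ}
    (hφ : InwardField K φ) (hd : Differentiable ℝ φ) (ha : 0 ≤ a)
    (h : ∀ z ∈ Icc (0 : Fin (d + 1) → ℝ) 1, ‖fderiv ℝ φ z (withTime (φ z) 1)‖ ≤ a)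
    {x : EuclideanSpace ℝ (Fin d)} (hx : x ∈ unitCube d) :
    pathRegularizer (toVelocity φ) x ≤ ENNReal.ofReal
      ((‖((toSup d).symm : (Fin d → ℝ) →L[ℝ] EuclideanSpace ℝ (Fin d))‖ * a) ^ 2) := by
  refine pathRegularizer_le (by positivity) fun t ht => ?_
  rw [acceleration_toVelocity hd]
  refine (norm_toLp_le _).trans ?_
  gcongr
  exact h _ (withTime_mem_cube.2 ⟨mem_unitCube_iff.1 (hφ.flowMap_mem hx ht), ht⟩)

theorem HasRegularDensity.absolutelyContinuous {L₁ L₂ : ℝ}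
    {μ : Measure (EuclideanSpace ℝ (Fin d))} (h : HasRegularDensity d k L₁ L₂ μ) :
    μ ≪ volume.restrict (unitCube d) := by
  obtain ⟨p, -, -, -, rfl⟩ := h
  exact withDensity_absolutelyContinuous _ _

end Objective

end

/-! ### Assembly of the theorem. -/

theorem mainTheorem11 (d k : ℕ) (hd : 1 ≤ d) (hk : 2 ≤ k) :
    ∃ C₀ : ℝ, ∀ L₁ L₂ : ℝ, 1 < L₁ → 0 < L₂ →
      ∃ C' C : ℝ, ∀ ρ π : Measure (EuclideanSpace ℝ (Fin d)),
        IsProbabilityMeasure ρ → IsProbabilityMeasure π →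
        HasRegularDensity d k L₁ L₂ ρ → HasRegularDensity d k L₁ L₂ π →
        ∀ ε : ℝ, 0 < ε → ε ≤ 1 →
          ∃ (L W S : ℕ) (B : ℝ), ∃ φ ∈ reluSqClass (d + 1) d L W S B,
            (L : ℝ) ≤ C₀ ∧
            (W : ℝ) ≤ C' * ε ^ (-(((d : ℝ) + 1) / ((k : ℝ) - 1))) ∧
            (S : ℝ) ≤ C' * ε ^ (-(((d : ℝ) + 1) / ((k : ℝ) - 1))) ∧
            B ≤ C' * ε ^ (-(1 / ((k : ℝ) - 1))) ∧
            (∀ x ∈ unitCube d, HasUniqueTrajectory (toVelocity φ) x) ∧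
            objectiveW ρ π (toVelocity φ) ≤ ENNReal.ofReal (C * ε ^ 2) ∧
            ∀ x ∈ unitCube d,
              wassersteinLoss ρ π (toVelocity φ) + pathRegularizer (toVelocity φ) x
                ≤ ENNReal.ofReal (C * ε ^ 2) := by
  -- From here `k` is the approximation order, one less than the smoothness of the densities: one
  -- derivative is spent on approximating in `C¹`.
  obtain ⟨k, rfl⟩ : ∃ m, k = m + 1 := ⟨k - 1, by omega⟩
  have hk1 : ((k + 1 : ℕ) : ℝ) - 1 = k := by push_cast; ring
  rw [hk1]
  refine ⟨(d + 1 + (k + 1) + 2 : ℕ), fun L₁ L₂ hL₁ hL₂ => ?_⟩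
  let s := ‖((toSup d).symm : (Fin d → ℝ) →L[ℝ] EuclideanSpace ℝ (Fin d))‖
  obtain ⟨M, hM⟩ := exists_transport_velocity (d := d) (k := k + 1) (by omega)
    (L₁ * max 1 s ^ (k + 1)) hL₂
  obtain ⟨C', A, hA, hnet⟩ := exists_network_velocity d (k := k) (by omega) M
  -- The Grönwall constant for a perturbation `3ε` and Lipschitz constant `M + 1`, where the added
  -- `1` only ensures positivity.
  let A₂ := 3 / (M + 1) * (Real.exp (M + 1) - 1)
  refine ⟨C', (s * A₂) ^ 2 + (s * A) ^ 2, fun ρ π hρp hπp hρ hπ ε hε hε1 => ?_⟩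
  obtain ⟨q₀, hq₀, hπq⟩ := hπ.exists_cubeDensity (k + 1) (by linarith) hπp
  obtain ⟨q₁, hq₁, hρq⟩ := hρ.exists_cubeDensity (k + 1) (by linarith) hρp
  obtain ⟨f, X, hf, hfM, hface, hacc, hX, hXc, hmap⟩ := hM q₀ q₁ hq₀ hq₁
  obtain ⟨W, S, B, φ, hφ, hW, hS, hB, hdiff, hin, hclose⟩ := hnet f hf hfM hface hacc ε hε hε1
  have h0 : (0 : Fin (d + 1) → ℝ) ∈ Icc (0 : Fin (d + 1) → ℝ) 1 :=
    left_mem_Icc.2 zero_le_one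
  have hM0 : 0 ≤ M := (norm_nonneg _).trans (hfM 0 (Nat.zero_le _) 0 h0)
  have hflip : ∀ z ∈ Icc (0 : Fin (d + 1) → ℝ) 1, ∀ z' ∈ Icc (0 : Fin (d + 1) → ℝ) 1,
      ‖f z - f z'‖ ≤ (M + 1) * ‖z - z'‖ := fun z hz z' hz' => by
    refine convex_cube.norm_image_sub_le_of_norm_fderivWithin_le (𝕜 := ℝ)
      (hf.differentiableOn (by norm_cast)) (fun y hy => ?_) hz' hz
    rw [← norm_iteratedFDerivWithin_one f (uniqueDiffOn_cube y hy)]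
    linarith [hfM 1 (by omega) y hy]
  have hdist : ∀ x ∈ unitCube d,
      ‖X (WithLp.ofLp x) 1 - WithLp.ofLp (flowMap (toVelocity φ) x 1)‖ ≤ A₂ * ε := fun x hx => by
    have hx' := mem_unitCube_iff.1 hx
    have htr := hin.isTrajectory_flowMap hx
    have := InwardField.dist_le (by linarith) hflip (fun z hz => (hclose z hz).1)
      (fun t ht => ((hX _ hx').2 t ht).2) (fun t ht => ((hX _ hx').2 t ht).1)
      htr.hasDerivWithinAt_ofLp (fun t ht => mem_unitCube_iff.1 (hin.flowMap_mem hx ht)) (η := 0)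
      (by rw [(hX _ hx').1, htr.1, sub_self, norm_zero])
    calc _ ≤ _ := this
      _ = _ := by ring
  have hloss := wassersteinLoss_le hπ.absolutelyContinuous hπq hρq hXc hmap
    (hin.continuousOn_flowMap (by linarith)) hdist
  have hreg : ∀ x ∈ unitCube d, pathRegularizer (toVelocity φ) x ≤ _ := fun x hx =>
    pathRegularizer_toVelocity_le hin hdiff (by positivity) (fun z hz => (hclose z hz).2) hx
  -- One constant serves both conclusions: the cube has volume one, so the uniform bound on the path
  -- regularizer also bounds its integral.
  have hsum : ENNReal.ofReal ((s * (A₂ * ε)) ^ 2) + ENNReal.ofReal ((s * (A * ε)) ^ 2) =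
      ENNReal.ofReal (((s * A₂) ^ 2 + (s * A) ^ 2) * ε ^ 2) := by
    rw [← ENNReal.ofReal_add (by positivity) (by positivity)]
    ring_nf
  refine ⟨_, W, S, B, φ, hφ, le_rfl, hW, hS, hB, fun x hx => hin.hasUniqueTrajectory hx, ?_,
    fun x hx => ?_⟩
  · exact hsum ▸ add_le_add hloss (regularizer_le hreg)
  · exact hsum ▸ add_le_add hloss (hreg x hx)
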